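/- Let $p$ be an odd prime and let $\mathcal{G} = H \rtimes \Gamma$ be a profinite group, where $H$ is a finite normal subgroup and $\Gamma \leq \mathcal{G}$ is a subgroup topologically isomorphic to $\mathbb{Z}_p$ (a one-dimensional $p$-adic Lie group). Let $\Gamma_0 \leq \Gamma$ be an open subgroup that is central in $\mathcal{G}$. Let $\Lambda(\mathcal{G}) := \mathbb{Z}_p[[\mathcal{G}]] = \varprojlim \mathbb{Z}_p[\mathcal{G}/\mathcal{N}]$ be the Iwasawa algebra, where $\mathcal{N}$ runs over the open normal subgroups of $\mathcal{G}$, and let $\mathcal{Q}(\mathcal{G})$ be the ring obtained from $\Lambda(\mathcal{G})$ by adjoining inverses of all central regular elements. Let $N$ be a finite normal subgroup of $\mathcal{G}$ and let $e_N := |N|^{-1}\sum_{\sigma \in N} \sigma$, a central idempotent of $\mathcal{Q}(\mathcal{G})$. Suppose that $\Lambda(\mathcal{G})$ is $N$-hybrid, that is, (i) $e_N \in \Lambda(\mathcal{G})$ and (ii) $\Lambda(\mathcal{G})(1-e_N)$ is a maximal $\mathbb{Z}_p[[\Gamma_0]]$-order in $\mathcal{Q}(\mathcal{G})(1-e_N)$.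 Then there is a ring isomorphism $$\Lambda(\mathcal{G})(1-e_N) \simeq \prod_{i=1}^{k} M_{n_i \times n_i}(S_i)$$ for some integer $k \geq 0$, integers $n_i \geq 1$ and integrally closed commutative local domains $S_i$. (If $N$ is trivial, both sides are the zero ring and $k = 0$.) -/

import Mathlib

open scoped nonZeroDivisors

universe u v

noncomputable section

namespace Iwasawa

/-! ### Orders -/

section Orders

variable {R : Type u} {A : Type v} [Ring R] [Ring A]

/-- Let `A` be an algebra over a commutative ring `R`, given by a ring homomorphism `φ : R → A`
with central image. An `R`-order in `A` is a subring `L` of `A` (with the same identity) that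
contains the image of `R`, is finitely generated as an `R`-module, and is full: every element of
`A` is carried into `L` by some non-zero-divisor of `R`. When `R` is a domain with fraction field
`E` and `A` is an `E`-algebra, fullness says exactly that `L` spans `A` over `E`. -/
structure IsOrder (φ : R →+* A) (L : Subring A) : Prop where
  range_le : φ.range ≤ L
  finite : ∃ s : Finset A, (Submodule.span φ.range (s : Set A) : Set A) = L
  full : ∀ a : A, ∃ r ∈ R⁰, φ r * a ∈ L

/-- A maximal `R`-order in `A`: an `R`-order not properly contained in any other one. -/
structure IsMaximalOrder (φ : R →+* A) (L : Subring A) : Prop where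
  isOrder : IsOrder φ L
  eq_of_le : ∀ L' : Subring A, IsOrder φ L' → L ≤ L' → L' = L

end Orders

/-! ### The total ring of fractions with respect to central regular elements -/

section Fractions

variable (A : Type u) [Ring A]

/-- The central regular elements of a ring. -/
def centralRegular : Submonoid A := Submonoid.center A ⊓ A⁰

variable {A}

lemma centralRegular_comm (s : centralRegular A) (a : A) : (s : A) * a = a * s :=
  (Submonoid.mem_center_iff.mp s.2.1 a).symm

instance : OreLocalization.OreSet (centralRegular A) where
  ore_right_cancel r₁ r₂ s h := ⟨s, by
    rw [centralRegular_comm, centralRegular_comm, h]⟩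
  oreNum r _ := r
  oreDenom _ s := s
  ore_eq r s := centralRegular_comm s r

variable (A) in
/-- The ring obtained from `A` by adjoining inverses of all central regular elements. -/
abbrev TotalFractions : Type u := OreLocalization (centralRegular A) A

/-- The canonical map from a ring to its total ring of fractions. -/
abbrev toFractions : A →+* TotalFractions A := OreLocalization.numeratorRingHom

lemma fraction_commute {a : A} (ha : ∀ b, Commute a b) (s : centralRegular A)
    (x : TotalFractions A) :
    Commute (OreLocalization.oreDiv a s : TotalFractions A) x := by
  induction x using OreLocalization.ind with
  | _ b t =>
    have h₁ : (OreLocalization.oreDiv a s : TotalFractions A) * OreLocalization.oreDiv b t =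
        OreLocalization.oreDiv (a * b) (t * s) :=
      OreLocalization.oreDiv_mul_char a b s t a t (centralRegular_comm t a)
    have h₂ : (OreLocalization.oreDiv b t : TotalFractions A) * OreLocalization.oreDiv a s =
        OreLocalization.oreDiv (b * a) (s * t) :=
      OreLocalization.oreDiv_mul_char b a t s b s (centralRegular_comm s b)
    have h₃ : t * s = s * t := Subtype.ext (centralRegular_comm t s)
    rw [Commute, SemiconjBy, h₁, h₂, h₃, (ha b).eq]

/-- For a central idempotent `e`, the ring homomorphism `x ↦ e * x * e = x * e` from `A` onto
the ring `A e`, which has identity element `e`. -/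
def toCorner {e : A} (he : IsIdempotentElem e) (hc : ∀ x, Commute e x) : A →+* he.Corner where
  toFun x := ⟨e * x * e, x, rfl⟩
  map_one' := Subtype.ext (by
    change e * 1 * e = e
    rw [mul_one, he.eq])
  map_zero' := Subtype.ext (by
    change e * 0 * e = 0
    simp)
  map_add' x y := Subtype.ext (by
    change e * (x + y) * e = e * x * e + e * y * e
    rw [mul_add, add_mul])
  map_mul' x y := Subtype.ext (by
    change e * (x * y) * e = e * x * e * (e * y * e)
    have hx : ∀ z, e * z * e = e * z := fun z => by
      rw [mul_assoc, ← (hc z).eq, ← mul_assoc, he.eq]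
    rw [hx, hx, hx, mul_assoc e x, ← mul_assoc x e y, ← (hc x).eq, mul_assoc e x y,
      ← mul_assoc e e, he.eq])

end Fractions

/-! ### Iwasawa algebras -/

section Algebra

variable (p : ℕ) [Fact p.Prime] (G : Type u) [Group G] [TopologicalSpace G]

/-- The compatible families in `∏ ℤ_p[G/U]`, over all open normal subgroups `U` of `G`. -/
def compatible :
    Subalgebra ℤ_[p] (∀ U : OpenNormalSubgroup G, MonoidAlgebra ℤ_[p] (G ⧸ U.toSubgroup)) where
  carrier := {x | ∀ (U V : OpenNormalSubgroup G) (h : U.toSubgroup ≤ V.toSubgroup),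
    MonoidAlgebra.mapDomainAlgHom ℤ_[p] ℤ_[p]
      (QuotientGroup.map U.toSubgroup V.toSubgroup (MonoidHom.id G) h) (x U) = x V}
  mul_mem' hx hy U V h := by
    rw [Pi.mul_apply, map_mul, hx U V h, hy U V h, Pi.mul_apply]
  add_mem' hx hy U V h := by
    rw [Pi.add_apply, map_add, hx U V h, hy U V h, Pi.add_apply]
  algebraMap_mem' r U V h := by
    rw [Pi.algebraMap_apply, AlgHom.commutes, Pi.algebraMap_apply]

/-- The Iwasawa algebra `Λ(G) = ℤ_p[[G]] = lim ℤ_p[G/U]`, the inverse limit being taken over all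
open normal subgroups `U` of `G`. -/
abbrev IwasawaAlgebra : Type u := compatible p G

variable {G}

/-- The image in `Λ(G)` of an element of `G`. -/
def ofGroup : G →* IwasawaAlgebra p G where
  toFun g := ⟨fun U => MonoidAlgebra.single (g : G ⧸ U.toSubgroup) 1, fun U V h => by
    simp only [MonoidAlgebra.mapDomainAlgHom_apply, MonoidAlgebra.mapDomain_single]
    rfl⟩
  map_one' := rfl
  map_mul' g h := Subtype.ext (funext fun U => by
    simp [MonoidAlgebra.single_mul_single])

/-- The pullback of an open normal subgroup under a continuous homomorphism. -/
def comapOpenNormal {K : Type v} [Group K] [TopologicalSpace K] (f : K →* G) (hf : Continuous f)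
    (U : OpenNormalSubgroup G) : OpenNormalSubgroup K where
  toOpenSubgroup := U.toOpenSubgroup.comap f hf
  isNormal' := Subgroup.Normal.comap U.isNormal' f

/-- The homomorphism `Λ(K) → Λ(G)` induced by a continuous homomorphism `f : K → G`: its component
at `U` is the projection to `ℤ_p[K/f⁻¹(U)]` followed by the map to `ℤ_p[G/U]` induced by `f`. -/
def mapIwasawa {K : Type v} [Group K] [TopologicalSpace K] (f : K →* G) (hf : Continuous f) :
    IwasawaAlgebra p K →ₐ[ℤ_[p]] IwasawaAlgebra p G :=
  ((AlgHom.pi fun U : OpenNormalSubgroup G =>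
      (MonoidAlgebra.mapDomainAlgHom ℤ_[p] ℤ_[p]
        (QuotientGroup.map (comapOpenNormal f hf U).toSubgroup U.toSubgroup f le_rfl)).comp
      ((Pi.evalAlgHom ℤ_[p] _ (comapOpenNormal f hf U)).comp (compatible p K).val)).codRestrict
    (compatible p G) fun x U V h => by
      have key := x.2 (comapOpenNormal f hf U) (comapOpenNormal f hf V)
        (Subgroup.comap_mono h)
      change MonoidAlgebra.mapDomainAlgHom ℤ_[p] ℤ_[p] _
        (MonoidAlgebra.mapDomainAlgHom ℤ_[p] ℤ_[p] _ (x.1 (comapOpenNormal f hf U))) =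
        MonoidAlgebra.mapDomainAlgHom ℤ_[p] ℤ_[p] _ (x.1 (comapOpenNormal f hf V))
      rw [← key, ← AlgHom.comp_apply, ← AlgHom.comp_apply,
        ← MonoidAlgebra.mapDomainAlgHom_comp, ← MonoidAlgebra.mapDomainAlgHom_comp]
      congr 2
      ext k
      rfl)

lemma commute_of_forall_single {M : Type u} [Group M] {x : MonoidAlgebra ℤ_[p] M}
    (h : ∀ g : M, Commute x (MonoidAlgebra.single g 1)) (y : MonoidAlgebra ℤ_[p] M) :
    Commute x y := by
  induction y using MonoidAlgebra.induction_on with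
  | of g => exact h g
  | add a b ha hb => exact ha.add_right hb
  | smul r a ha => exact ha.smul_right r

/-- The homomorphism `Λ(Γ₀) → Λ(G)` induced by the inclusion of a subgroup `Γ₀` of `G`. -/
def ofSubgroup (Γ₀ : Subgroup G) : IwasawaAlgebra p Γ₀ →ₐ[ℤ_[p]] IwasawaAlgebra p G :=
  mapIwasawa p Γ₀.subtype continuous_subtype_val

lemma natCast_mem_centralRegular {m : ℕ} (hm : m ≠ 0) :
    (m : IwasawaAlgebra p G) ∈ centralRegular (IwasawaAlgebra p G) := by
  have hm' : (m : ℤ_[p]) ≠ 0 := Nat.cast_ne_zero.mpr hm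
  have key : ∀ x : IwasawaAlgebra p G, (m : IwasawaAlgebra p G) * x = 0 → x = 0 := by
    intro x hx
    refine Subtype.ext (funext fun U => ?_)
    have h := congrFun (congrArg Subtype.val hx) U
    have h' : (m : ℤ_[p]) • x.1 U = 0 := by
      rw [Nat.cast_smul_eq_nsmul, nsmul_eq_mul]
      exact h
    change x.1 U = 0
    ext g
    have h2 := congrArg (fun z => z.coeff g) h'
    simpa [hm'] using h2
  refine ⟨Submonoid.mem_center_iff.mpr fun x => (Nat.cast_commute m x).eq.symm, ?_⟩
  refine mem_nonZeroDivisors_iff.mpr ?_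
  exact ⟨key, fun x hx => key x (by rw [(Nat.cast_commute m x).eq, hx])⟩

/-! ### The idempotent `e_N` -/

variable (N : Subgroup G)

/-- The element `∑_{σ ∈ N} σ` of `Λ(G)`, for a finite subgroup `N`. -/
def sumElement [Finite N] : IwasawaAlgebra p G := ∑ᶠ σ : N, ofGroup p (σ : G)

lemma ofGroup_commute_sumElement [Finite N] [N.Normal] (g : G) :
    Commute (sumElement p N) (ofGroup p g) := by
  have := Fintype.ofFinite N
  rw [sumElement, finsum_eq_sum_of_fintype, Commute, SemiconjBy, Finset.sum_mul, Finset.mul_sum]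
  refine Fintype.sum_equiv (MulAut.conjNormal (H := N) g⁻¹).toEquiv _ _ fun σ => ?_
  rw [← map_mul, ← map_mul]
  congr 1
  change _ = g * ((MulAut.conjNormal (H := N) g⁻¹ σ : N) : G)
  rw [MulAut.conjNormal_apply]
  group

lemma sumElement_commute [Finite N] [N.Normal] (x : IwasawaAlgebra p G) :
    Commute (sumElement p N) x := by
  refine Subtype.ext (funext fun U => ?_)
  refine (commute_of_forall_single p (fun g => ?_) (x.1 U)).eq
  induction g using QuotientGroup.induction_on with
  | H g => exact congrFun (congrArg Subtype.val (ofGroup_commute_sumElement p N g).eq) U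

lemma sumElement_mul_self [Finite N] :
    sumElement p N * sumElement p N = Nat.card N * sumElement p N := by
  have := Fintype.ofFinite N
  have h : ∀ τ : N, ofGroup p (τ : G) * sumElement p N = sumElement p N := by
    intro τ
    rw [sumElement, finsum_eq_sum_of_fintype, Finset.mul_sum]
    exact Fintype.sum_equiv (Equiv.mulLeft τ) _ _ fun σ => by simp
  have h' : sumElement p N = ∑ τ : N, ofGroup p (τ : G) := finsum_eq_sum_of_fintype _
  calc sumElement p N * sumElement p N = ∑ τ : N, ofGroup p (τ : G) * sumElement p N := by
        rw [← Finset.sum_mul, ← h']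
    _ = Nat.card N * sumElement p N := by simp [h, Nat.card_eq_fintype_card]

/-- The central idempotent `e_N = |N|⁻¹ ∑_{σ ∈ N} σ` of the total ring of fractions `Q(G)`
of `Λ(G)`. -/
def traceIdempotent [Finite N] : TotalFractions (IwasawaAlgebra p G) :=
  OreLocalization.oreDiv (sumElement p N)
    ⟨(Nat.card N : IwasawaAlgebra p G), natCast_mem_centralRegular p Nat.card_pos.ne'⟩

lemma traceIdempotent_commute [Finite N] [N.Normal] (x : TotalFractions (IwasawaAlgebra p G)) :
    Commute (traceIdempotent p N) x :=
  fraction_commute (sumElement_commute p N) _ x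

lemma traceIdempotent_idem [Finite N] : IsIdempotentElem (traceIdempotent p N) := by
  have h := OreLocalization.oreDiv_mul_char (S := centralRegular (IwasawaAlgebra p G))
    (sumElement p N) (sumElement p N)
    ⟨_, natCast_mem_centralRegular p (Nat.card_pos (α := N)).ne'⟩
    ⟨_, natCast_mem_centralRegular p (Nat.card_pos (α := N)).ne'⟩ (sumElement p N)
    ⟨_, natCast_mem_centralRegular p (Nat.card_pos (α := N)).ne'⟩ (Nat.cast_commute _ _).eq
  rw [IsIdempotentElem, traceIdempotent, h, sumElement_mul_self, ← smul_eq_mul]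
  exact (OreLocalization.expand' (S := centralRegular (IwasawaAlgebra p G)) (sumElement p N) _
    ⟨_, natCast_mem_centralRegular p (Nat.card_pos (α := N)).ne'⟩).symm

/-! ### The complement of `e_N` and hybrid Iwasawa algebras -/

/-- The ring `Q(G)(1 - e_N)`, with identity element `1 - e_N`. -/
abbrev ComplementAlgebra [Finite N] : Type u := (traceIdempotent_idem p N).one_sub.Corner

/-- The ring homomorphism `Λ(G) → Q(G)(1 - e_N)`, `x ↦ x (1 - e_N)`. -/
def toComplement [Finite N] [N.Normal] : IwasawaAlgebra p G →+* ComplementAlgebra p N :=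
  (toCorner (traceIdempotent_idem p N).one_sub
    fun x => (Commute.one_left x).sub_left (traceIdempotent_commute p N x)).comp toFractions

/-- The ring `Λ(G)(1 - e_N) = {x (1 - e_N) | x ∈ Λ(G)}`, as a subring of `Q(G)(1 - e_N)`. -/
def complementOrder [Finite N] [N.Normal] : Subring (ComplementAlgebra p N) :=
  (toComplement p N).range

/-- The structure homomorphism `Λ(Γ₀) → Λ(G) → Q(G)(1 - e_N)`, `r ↦ r (1 - e_N)`, of the
`Λ(Γ₀)`-algebra `Q(G)(1 - e_N)`, for a central subgroup `Γ₀` of `G`. -/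
def structureHom [Finite N] [N.Normal] (Γ₀ : Subgroup G) :
    IwasawaAlgebra p Γ₀ →+* ComplementAlgebra p N :=
  (toComplement p N).comp (ofSubgroup p Γ₀).toRingHom

/-- `Λ(G)` is `N`-hybrid: `e_N` lies in `Λ(G)`, and `Λ(G)(1 - e_N)` is a maximal
`ℤ_p[[Γ₀]]`-order in `Q(G)(1 - e_N)`. Here `Γ₀` is a central subgroup of `G`. -/
structure IsHybrid [Finite N] [N.Normal] (Γ₀ : Subgroup G) : Prop where
  mem : traceIdempotent p N ∈ (toFractions : IwasawaAlgebra p G →+* _).range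
  isMaximalOrder : IsMaximalOrder (structureHom p N Γ₀) (complementOrder p N)

end Algebra

end Iwasawa

end

/-! Maximality forces `Λ(G)(1 - e_N)` to behave like a regular ring of dimension two: its radical is
generated by `p` and one more central element `t`, where `p` is regular, `t` is regular modulo `p`,
and the quotient by `(p, t)` is finite semisimple. Below, `Γ` is the image of `P : ℤ_p → G`, and `P
(p ^ m ℤ_p)` is central.

Maximality is used twice. First, let `a = 1 - e_N` modulo `p`, and let `J` be the ideal of `𝔽_p[H]`
that is everything on the `e_N`-part and the radical on the `a`-part, with preimage `𝒥` in `ℤ_p[H]`.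
The right order of `𝒥` is stable under conjugation by `G`, so it generates a finite ring extension
of `Λ(G)(1 - e_N)`, which must be trivial (`exists_map_eq_p_mul_of_stable`). Since `ℤ_p[H]` is
self-dual, an ideal containing `p` with right order `ℤ_p[H]` is invertible on one side, hence
projective. Then `𝔽_p[H]/J` is cohomologically trivial over a Sylow `p`-subgroup, so free over it,
so projective over `𝔽_p[H]`, and `J` is generated by an idempotent
(`exists_right_identity_of_order_eq`). As the radical contains no nonzero idempotent, `𝔽_p[H]a` is
semisimple (`modP_mul_eq_of_mem_jacobson`).

Next, let `V = P (p ^ (m + 1) ℤ_p)`. The ring `𝔽_p[G/V]a` is generated by the semisimple ring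
`𝔽_p[H]a` and an element `γ` of `p`-power order. On a `γ`-simple block the smallest power `γ ^ s`
acting trivially on the centre acts as conjugation by a unit `u` (Skolem-Noether), and `u` can be
normalised so that `u⁻¹ γ ^ s - 1` is central and nilpotent; this element generates the radical
(`exists_central_nilpotent_of_crossedProduct`). The sum over the blocks lifts to a central `t` in
`Λ(G)`, and the radical of the complement is generated by `p`, `P (p ^ (m + 1)) - 1` and `t`. Modulo
`p` the second generator is `T ^ p` with `T = P (p ^ m) - 1`, and `T` lies in the radical, so that
generator is redundant; regularity of `t` modulo `p` is inherited from `T` (`IsLiftable.eliminate`).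

Compactness lifts the Wedderburn decomposition of the quotient to a product of matrix rings over
corners (`IsLiftable.exists_matrix_decomposition`). The corners are commutative because the radical
has central generators and a finite field is generated by one element. They are local, and they are
domains because a nonzero element is a power of `p` times something that is a power of `t` times a
unit modulo `p`. The second use of maximality is integral closure: a central fraction integral over
the order generates a finite ring extension of it. -/

namespace Iwasawa

/-! ### Fixed points of `p`-groups -/

section FixedPoints

/-- Orbit counting: the number of fixed vectors is congruent to the cardinality of the space, which
is divisible by `p`, and zero is already one of them. -/
lemma exists_fixed_ne_zero {p : ℕ} [Fact p.Prime] {P M : Type*} [Group P] [AddCommGroup M]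
    [Module (ZMod p) M] [DistribMulAction P M] (hP : IsPGroup p P)
    (E : Submodule (ZMod p) M) [Finite E] (hE : E ≠ ⊥) (hs : ∀ (x : P), ∀ e ∈ E, x • e ∈ E) :
    ∃ e ∈ E, e ≠ 0 ∧ ∀ x : P, x • e = e := by
  let : MulAction P E :=
    { smul := fun x e => ⟨x • e.1, hs x e.1 e.2⟩
      one_smul := fun e => Subtype.ext (one_smul P e.1)
      mul_smul := fun x y e => Subtype.ext (mul_smul x y e.1) }
  have := Fintype.ofFinite E
  have hcard : p ∣ Nat.card E := by
    rw [Nat.card_eq_fintype_card, Module.card_eq_pow_finrank (K := ZMod p), ZMod.card]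
    refine dvd_pow_self p ?_
    have : Nontrivial E := (Submodule.nontrivial_iff_ne_bot).mpr hE
    exact (Module.finrank_pos (R := ZMod p) (M := E)).ne'
  obtain ⟨b, hb, hne⟩ := hP.exists_fixed_point_of_prime_dvd_card_of_fixed_point E hcard
    (a := 0) (fun x => Subtype.ext (smul_zero x))
  exact ⟨b.1, b.2, fun h => hne (Subtype.ext h.symm), fun x => congrArg Subtype.val (hb x)⟩

end FixedPoints

/-! ### The symmetric trace form on a group ring -/

section GroupRing

variable {k H : Type*} [CommRing k] [Group H]

/-- The form sending `x, y` to the coefficient of `x * y` at `1` is symmetric; with its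
nondegeneracy below, this makes the group ring self-dual. -/
lemma coeff_one_mul_comm (x y : MonoidAlgebra k H) : (x * y).coeff 1 = (y * x).coeff 1 := by
  induction x using MonoidAlgebra.induction_linear with
  | zero => simp
  | add a b ha hb => simp [add_mul, mul_add, ha, hb]
  | single h r =>
    rw [MonoidAlgebra.coeff_single_mul_apply, MonoidAlgebra.coeff_mul_single_apply]
    simp [mul_comm]

lemma sum_single_mul_coeff_one [Fintype H] (x : MonoidAlgebra k H) :
    ∑ h : H, MonoidAlgebra.single h ((MonoidAlgebra.single h⁻¹ 1 * x).coeff 1) = x := by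
  classical
  ext g
  simp [MonoidAlgebra.coeff_single_mul_apply]

lemma eq_zero_of_coeff_one_mul {x : MonoidAlgebra k H} (h : ∀ r, (x * r).coeff 1 = 0) : x = 0 := by
  ext g
  have := h (MonoidAlgebra.single g⁻¹ 1)
  rw [MonoidAlgebra.coeff_mul_single_apply] at this
  simpa using this

lemma exists_coeff_one_mul_eq [Finite H] (f : MonoidAlgebra k H →ₗ[k] k) :
    ∃ v : MonoidAlgebra k H, ∀ x, (v * x).coeff 1 = f x := by
  have := Fintype.ofFinite H
  refine ⟨∑ h : H, MonoidAlgebra.single h⁻¹ (f (MonoidAlgebra.single h 1)), fun x => ?_⟩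
  conv_rhs => rw [← sum_single_mul_coeff_one x]
  rw [Finset.sum_mul, MonoidAlgebra.coeff_sum, Finsupp.finsetSum_apply, map_sum]
  refine Finset.sum_congr rfl fun h _ => ?_
  rw [MonoidAlgebra.coeff_single_mul_apply, MonoidAlgebra.coeff_single_mul_apply]
  have : (MonoidAlgebra.single h (1 * x.coeff (h⁻¹⁻¹ * 1)) : MonoidAlgebra k H) =
      (x.coeff h) • MonoidAlgebra.single h 1 := by simp
  rw [this, map_smul]
  simp [mul_comm]

/-- The form in which self-duality is applied: every functional on a finite group algebra is a
pairing with some `v`, so a vector outside a subspace can be detected by an element orthogonal to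
that subspace. -/
lemma exists_coeff_one_separating {k : Type*} [Field k] [Finite H]
    (W : Submodule k (MonoidAlgebra k H)) {x : MonoidAlgebra k H} (hx : x ∉ W) :
    ∃ v : MonoidAlgebra k H, (∀ w ∈ W, (v * w).coeff 1 = 0) ∧ (v * x).coeff 1 ≠ 0 := by
  obtain ⟨f, hf, hW⟩ := Submodule.exists_le_ker_of_notMem hx
  obtain ⟨v, hv⟩ := exists_coeff_one_mul_eq f
  exact ⟨v, fun w hw => (hv w).trans (hW hw), by rwa [hv]⟩

end GroupRing

/-! ### Reduction of `ℤ_p[H]` modulo `p` -/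

section ModP

variable (p : ℕ) [Fact p.Prime] (H : Type*) [Group H]

/-- Reduction modulo `p` of the group ring. -/
noncomputable def modP : MonoidAlgebra ℤ_[p] H →+* MonoidAlgebra (ZMod p) H :=
  MonoidAlgebra.mapRingHom H PadicInt.toZMod

variable {p H}

@[simp] lemma modP_single (h : H) (r : ℤ_[p]) :
    modP p H (MonoidAlgebra.single h r) = MonoidAlgebra.single h (PadicInt.toZMod r) := by
  simp [modP]

lemma coeff_modP (x : MonoidAlgebra ℤ_[p] H) (h : H) :
    (modP p H x).coeff h = PadicInt.toZMod (x.coeff h) := by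
  simp [modP]

lemma modP_surjective : Function.Surjective (modP p H) :=
  MonoidAlgebra.map_surjective _ (ZMod.ringHom_surjective _)

lemma padicInt_toZMod_eq_zero_iff (r : ℤ_[p]) : PadicInt.toZMod r = 0 ↔ ∃ s, r = p * s := by
  rw [← RingHom.mem_ker, PadicInt.ker_toZMod, PadicInt.maximalIdeal_eq_span_p,
    Ideal.mem_span_singleton]
  rfl

lemma natCast_mul_eq_smul {k : Type*} [CommRing k] (n : ℕ) (x : MonoidAlgebra k H) :
    (n : MonoidAlgebra k H) * x = (n : k) • x := by
  rw [← nsmul_eq_mul, Nat.cast_smul_eq_nsmul]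

lemma modP_eq_zero_iff [Finite H] {x : MonoidAlgebra ℤ_[p] H} :
    modP p H x = 0 ↔ ∃ y, x = p * y := by
  constructor
  · intro h
    have h' : ∀ g, ∃ s, x.coeff g = p * s := fun g => by
      rw [← padicInt_toZMod_eq_zero_iff, ← coeff_modP, h]; rfl
    choose s hs using h'
    refine ⟨.ofCoeff (Finsupp.equivFunOnFinite.symm s), ?_⟩
    ext g
    rw [natCast_mul_eq_smul]
    simpa using hs g
  · rintro ⟨y, rfl⟩
    rw [map_mul, map_natCast]
    have : ((p : ℕ) : MonoidAlgebra (ZMod p) H) = 0 := by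
      rw [MonoidAlgebra.natCast_def]; simp
    rw [this, zero_mul]

lemma p_mul_cancel {x y : MonoidAlgebra ℤ_[p] H}
    (h : (p : MonoidAlgebra ℤ_[p] H) * x = p * y) : x = y := by
  ext g
  have := congrArg (fun z => z.coeff g) h
  simp only [natCast_mul_eq_smul] at this
  have hp : (p : ℤ_[p]) ≠ 0 := by exact_mod_cast (Fact.out : p.Prime).ne_zero
  simpa [hp] using this

end ModP

/-- The sum over `H` of a function, arranged by cosets of a subgroup `P`. -/
lemma sum_eq_sum_sum_cosets {H : Type*} [Group H] [Fintype H] {M : Type*} [AddCommMonoid M] (P : Subgroup H) [Fintype P]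
    (C : Finset H) (hC : Function.Bijective fun x : P × C => (x.1 : H) * x.2) (f : H → M) :
    ∑ h : H, f h = ∑ x : P, ∑ c ∈ C, f (x * c) := by
  rw [← Function.Bijective.sum_comp hC f, Fintype.sum_prod_type]
  exact Finset.sum_congr rfl fun x _ => Finset.sum_coe_sort C (fun c => f (x * c))

/-! ### Invertible ideals are projective -/

section Projective

variable {p : ℕ} [Fact p.Prime] {H : Type*} [Group H] [Finite H]

/-- If `J` is an invertible ideal, then `p` is a combination of products `k * j` with `j ∈ J` and
`J * k ⊆ (p)`. -/
lemma p_mem_closure_of_order_eq (J : Ideal (MonoidAlgebra (ZMod p) H)) [J.IsTwoSided]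
    (hJ : ∀ y, (∀ j, modP p H j ∈ J → ∃ j', modP p H j' ∈ J ∧ j * y = p * j') →
      modP p H y = 0) :
    (p : MonoidAlgebra ℤ_[p] H) ∈ AddSubgroup.closure
      {x | ∃ k j, (∀ j', modP p H j' ∈ J → ∃ m, j' * k = p * m) ∧ modP p H j ∈ J ∧ x = k * j} := by
  -- Let `𝒥` be the preimage of `J`. The elements `k / p` run through `{x | 𝒥 x ⊆ ℤ_p[H]}`, a
  -- one-sided inverse of `𝒥`, so after division by `p` the claim is `1 ∈ 𝒥⁻¹ 𝒥`. The set `T` is a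
  -- two-sided ideal containing `p 𝒥`.
  set T := AddSubgroup.closure
      {x | ∃ k j, (∀ j', modP p H j' ∈ J → ∃ m, j' * k = p * m) ∧ modP p H j ∈ J ∧ x = k * j}
    with hT
  have hpJ : modP p H (p : MonoidAlgebra ℤ_[p] H) = 0 := modP_eq_zero_iff.mpr ⟨1, by simp⟩
  have hTl : ∀ r, ∀ x ∈ T, r * x ∈ T := by
    intro r x hx
    induction hx using AddSubgroup.closure_induction with
    | mem x hx =>
      obtain ⟨k, j, hk, hj, rfl⟩ := hx
      refine AddSubgroup.subset_closure ⟨r * k, j, fun j' hj' => ?_, hj, by rw [mul_assoc]⟩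
      rw [← mul_assoc]
      exact hk _ (by rw [map_mul]; exact J.mul_mem_right _ hj')
    | zero => simp
    | add x y _ _ hx hy => rw [mul_add]; exact T.add_mem hx hy
    | neg x _ hx => rw [mul_neg]; exact T.neg_mem hx
  have hTr : ∀ r, ∀ x ∈ T, x * r ∈ T := by
    intro r x hx
    induction hx using AddSubgroup.closure_induction with
    | mem x hx =>
      obtain ⟨k, j, hk, hj, rfl⟩ := hx
      exact AddSubgroup.subset_closure ⟨k, j * r, hk,
        by rw [map_mul]; exact J.mul_mem_right _ hj, by rw [mul_assoc]⟩
    | zero => simp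
    | add x y _ _ hx hy => rw [add_mul]; exact T.add_mem hx hy
    | neg x _ hx => rw [neg_mul]; exact T.neg_mem hx
  have hpT : ∀ r j, modP p H j ∈ J → p * (r * j) ∈ T := fun r j hj => by
    refine AddSubgroup.subset_closure ⟨p * r, j, fun j' _ => ⟨j' * r, ?_⟩, hj, by rw [mul_assoc]⟩
    rw [← mul_assoc, ← mul_assoc, (Nat.cast_commute p j').eq]
  -- `I` is the reduction modulo `p` of `{y | p y ∈ T}`. It suffices that `1 ∈ I`, because the error
  -- is a multiple of `p` and `p * p` lies in `T`.
  let I : Submodule (ZMod p) (MonoidAlgebra (ZMod p) H) :=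
    { carrier := {v | ∃ y, modP p H y = v ∧ (p * y) ∈ T}
      zero_mem' := ⟨0, by simp, by simp⟩
      add_mem' := by
        rintro _ _ ⟨y, rfl, hy⟩ ⟨z, rfl, hz⟩
        exact ⟨y + z, map_add _ _ _, by rw [mul_add]; exact T.add_mem hy hz⟩
      smul_mem' := by
        rintro c _ ⟨y, rfl, hy⟩
        refine ⟨(c.val : MonoidAlgebra ℤ_[p] H) * y, ?_, ?_⟩
        · rw [map_mul, map_natCast, natCast_mul_eq_smul, ZMod.natCast_zmod_val]
        · rw [← mul_assoc, ← (Nat.cast_commute c.val (p : MonoidAlgebra ℤ_[p] H)).eq, mul_assoc]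
          exact hTl _ _ hy }
  by_cases h1 : (1 : MonoidAlgebra (ZMod p) H) ∈ I
  · obtain ⟨y, hy, hyT⟩ := h1
    obtain ⟨z, hz⟩ := modP_eq_zero_iff.mp (show modP p H (y - 1) = 0 by rw [map_sub, hy]; simp)
    have h2 : (p : MonoidAlgebra ℤ_[p] H) = p * y - p * (z * p) := by
      rw [← (Nat.cast_commute p z).eq, ← hz]; noncomm_ring
    rw [h2]
    exact T.sub_mem hyT (hpT z p (by rw [hpJ]; exact J.zero_mem))
  -- If `1 ∉ I`, some `v` is orthogonal to `I` but not to `1`. By duality a lift `y` of `v`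
  -- satisfies `𝒥 y ⊆ p 𝒥`, so the hypothesis on the right order gives `v = 0`, a contradiction.
  · exfalso
    obtain ⟨v, hvI, hv1⟩ := exists_coeff_one_separating I h1
    obtain ⟨y, rfl⟩ := modP_surjective v
    have hy : modP p H y = 0 := by
      refine hJ y fun j hj => ?_
      have hjy : modP p H (j * y) = 0 := by
        rw [map_mul]
        refine eq_zero_of_coeff_one_mul fun r => ?_
        obtain ⟨r, rfl⟩ := modP_surjective r
        rw [mul_assoc, coeff_one_mul_comm, mul_assoc, ← map_mul]
        exact hvI _ ⟨r * j, rfl, hpT r j hj⟩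
      obtain ⟨j', hj'⟩ := modP_eq_zero_iff.mp hjy
      refine ⟨j', ?_, hj'⟩
      -- If `j'` is not in `𝒥`, choose `k` orthogonal to `J` but not to `j'`. Since `J` is
      -- two-sided, `k` annihilates it on both sides modulo `p`; hence `k * j = p * z` with the
      -- class of `z` in `I`, and `z * y = k * j'` contradicts the orthogonality of `y` to `I`.
      by_contra hcon
      obtain ⟨k, hkJ, hk⟩ := exists_coeff_one_separating (J.restrictScalars (ZMod p)) hcon
      obtain ⟨k, rfl⟩ := modP_surjective k
      have hkJ' : ∀ w ∈ J, modP p H k * w = 0 := fun w hw =>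
        eq_zero_of_coeff_one_mul fun r => by
          rw [mul_assoc]; exact hkJ _ (J.mul_mem_right _ hw)
      obtain ⟨z, hz⟩ := modP_eq_zero_iff.mp
        (show modP p H (k * j) = 0 by rw [map_mul]; exact hkJ' _ hj)
      have hzI : modP p H z ∈ I := by
        refine ⟨z, rfl, ?_⟩
        rw [← hz]
        refine AddSubgroup.subset_closure ⟨k, j, fun i hi => modP_eq_zero_iff.mp ?_, hj, rfl⟩
        rw [map_mul]
        refine eq_zero_of_coeff_one_mul fun r => ?_
        rw [mul_assoc, coeff_one_mul_comm, mul_assoc]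
        exact hkJ _ (J.mul_mem_left _ hi)
      have h3 : z * y = k * j' := by
        apply p_mul_cancel
        rw [← mul_assoc, ← hz, mul_assoc, hj', ← mul_assoc, ← mul_assoc,
          (Nat.cast_commute p k).eq]
      apply hk
      rw [← map_mul, ← h3, map_mul, coeff_one_mul_comm]
      exact hvI _ hzI
    apply hv1
    rw [hy]; simp

/-- Relative projectivity of an invertible ideal. -/
lemma exists_transfer_of_order_eq [Fintype H] (J : Ideal (MonoidAlgebra (ZMod p) H)) [J.IsTwoSided]
    (hJ : ∀ y, (∀ j, modP p H j ∈ J → ∃ j', modP p H j' ∈ J ∧ j * y = p * j') →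
      modP p H y = 0) :
    ∃ ψ : MonoidAlgebra ℤ_[p] H → MonoidAlgebra ℤ_[p] H, ∀ j, modP p H j ∈ J →
      modP p H (ψ j) ∈ J ∧
      ∑ h : H, MonoidAlgebra.single h 1 * ψ (MonoidAlgebra.single h⁻¹ 1 * j) = j := by
  have hmem : ∀ (h : H) j, modP p H j ∈ J → modP p H (MonoidAlgebra.single h 1 * j) ∈ J :=
    fun h j hj => by rw [map_mul]; exact J.mul_mem_left _ hj
  -- For `t = k * j₀` the left-linear functional `m j = j * k / p` takes values in `ℤ_p[H]`. With `ψ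
  -- j` the coefficient of `m j` at `1` times `j₀`, the sum over `H` reassembles `m j * j₀`. The
  -- property is additive in `t`, and `t = p` is the case wanted.
  have key : ∀ t ∈ AddSubgroup.closure
      {x | ∃ k j, (∀ j', modP p H j' ∈ J → ∃ m, j' * k = p * m) ∧ modP p H j ∈ J ∧ x = k * j},
      ∃ ψ : MonoidAlgebra ℤ_[p] H → MonoidAlgebra ℤ_[p] H, ∀ j, modP p H j ∈ J →
      modP p H (ψ j) ∈ J ∧
      p * ∑ h : H, MonoidAlgebra.single h 1 * ψ (MonoidAlgebra.single h⁻¹ 1 * j) = j * t := by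
    intro t ht
    induction ht using AddSubgroup.closure_induction with
    | mem x hx =>
      obtain ⟨k, j₀, hk, hj₀, rfl⟩ := hx
      choose! m hm using hk
      refine ⟨fun j => MonoidAlgebra.single 1 ((m j).coeff 1) * j₀, fun j hj =>
        ⟨by rw [map_mul]; exact J.mul_mem_left _ hj₀, ?_⟩⟩
      have h1 : ∀ h : H, m (MonoidAlgebra.single h⁻¹ 1 * j) =
          MonoidAlgebra.single h⁻¹ 1 * m j := fun h => by
        apply p_mul_cancel
        rw [← hm _ (hmem _ _ hj), mul_assoc, hm _ hj, ← mul_assoc, ← mul_assoc,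
          (Nat.cast_commute p _).eq]
      simp only [h1, ← mul_assoc, MonoidAlgebra.single_mul_single, mul_one, one_mul]
      rw [← Finset.sum_mul, sum_single_mul_coeff_one, hm _ hj, mul_assoc]
    | zero => exact ⟨0, fun j _ => by simp⟩
    | add x y _ _ hx hy =>
      obtain ⟨ψ, hψ⟩ := hx
      obtain ⟨ψ', hψ'⟩ := hy
      refine ⟨ψ + ψ', fun j hj => ⟨?_, ?_⟩⟩
      · rw [Pi.add_apply, map_add]; exact J.add_mem (hψ j hj).1 (hψ' j hj).1
      · simp only [Pi.add_apply, mul_add, Finset.sum_add_distrib]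
        rw [(hψ j hj).2, (hψ' j hj).2]
    | neg x _ hx =>
      obtain ⟨ψ, hψ⟩ := hx
      refine ⟨-ψ, fun j hj => ⟨?_, ?_⟩⟩
      · rw [Pi.neg_apply, map_neg]; exact J.neg_mem (hψ j hj).1
      · simp only [Pi.neg_apply, mul_neg, Finset.sum_neg_distrib]
        rw [(hψ j hj).2]
  obtain ⟨ψ, hψ⟩ := key _ (p_mem_closure_of_order_eq J hJ)
  refine ⟨ψ, fun j hj => ⟨(hψ j hj).1, p_mul_cancel ?_⟩⟩
  rw [(hψ j hj).2, (Nat.cast_commute p j).eq]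

lemma exists_coset_representatives (P : Subgroup H) :
    ∃ C : Finset H, (Function.Bijective fun x : P × C => (x.1 : H) * x.2) ∧ C.card = P.index := by
  classical
  obtain ⟨S, hS, -⟩ := P.exists_isComplement_right 1
  have := Fintype.ofFinite H
  refine ⟨S.toFinset, ?_, ?_⟩
  · have h := hS
    rw [Subgroup.IsComplement] at h
    constructor
    · intro a b hab
      have := @h.1 (a.1, ⟨a.2.1, Set.mem_toFinset.mp a.2.2⟩)
        (b.1, ⟨b.2.1, Set.mem_toFinset.mp b.2.2⟩) hab
      simp only [Prod.mk.injEq, Subtype.mk.injEq] at this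
      exact Prod.ext this.1 (Subtype.ext this.2)
    · intro x
      obtain ⟨⟨a, b⟩, hab⟩ := h.2 x
      exact ⟨(a, ⟨b.1, Set.mem_toFinset.mpr b.2⟩), hab⟩
  · rw [Set.toFinset_card, ← Nat.card_eq_fintype_card, hS.card_right]

end Projective

/-! ### Vanishing of Tate cohomology for the group ring -/

section NormElement

variable {k H : Type*} [CommRing k] [Group H] [Fintype H]

/-- The group ring is free over `P`, so Tate cohomology in degree `-1` vanishes: the kernel of the
norm is the augmentation part. -/
lemma exists_sum_sub_of_norm_mul_eq_zero (P : Subgroup H) [Fintype P] {v : MonoidAlgebra k H}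
    (hv : (∑ x : P, MonoidAlgebra.single (x : H) 1) * v = 0) :
    ∃ w : P → MonoidAlgebra k H,
      v = ∑ x : P, (MonoidAlgebra.single (x : H) 1 * w x - w x) := by
  obtain ⟨C, hC, -⟩ := exists_coset_representatives P
  -- `φ` truncates to the coefficients on the transversal `C`. Then `v` is the sum of the `x * φ
  -- (x⁻¹ * v)`, while the `φ (x⁻¹ * v)` themselves add up to `φ` of the norm of `v`, which is zero.
  let φ : MonoidAlgebra k H → MonoidAlgebra k H := fun y =>
    ∑ c ∈ C, MonoidAlgebra.single c ((MonoidAlgebra.single c⁻¹ 1 * y).coeff 1)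
  have hφ : ∀ f : P → MonoidAlgebra k H, φ (∑ x, f x) = ∑ x, φ (f x) := fun f => by
    simp only [φ]
    rw [Finset.sum_comm]
    refine Finset.sum_congr rfl fun c _ => ?_
    rw [Finset.mul_sum, MonoidAlgebra.coeff_sum, Finsupp.finsetSum_apply]
    exact map_sum (MonoidAlgebra.singleAddHom c) _ _
  refine ⟨fun x => φ (MonoidAlgebra.single (x : H)⁻¹ 1 * v), ?_⟩
  rw [Finset.sum_sub_distrib, ← hφ]
  have h0 : ∑ x : P, MonoidAlgebra.single (x : H)⁻¹ 1 * v = 0 := by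
    rw [← Finset.sum_mul, ← hv]
    congr 1
    exact Fintype.sum_equiv (Equiv.inv P) _ _ fun x => by simp
  have h1 : φ 0 = 0 := by simp [φ]
  rw [h0, h1, sub_zero]
  conv_lhs => rw [← sum_single_mul_coeff_one v, sum_eq_sum_sum_cosets P C hC]
  refine Finset.sum_congr rfl fun x _ => ?_
  rw [Finset.mul_sum]
  refine Finset.sum_congr rfl fun c _ => ?_
  rw [MonoidAlgebra.single_mul_single, one_mul, ← mul_assoc, MonoidAlgebra.single_mul_single,
    one_mul, mul_inv_rev]

end NormElement

/-! ### Cohomological triviality, freeness and splitting -/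

section Free

variable {p : ℕ} [Fact p.Prime] {H : Type*} [Group H] [Fintype H]

/-- For a `p`-subgroup `P` whose norm element detects the augmentation, the quotient by a left
ideal is relatively trivial. -/
lemma exists_trace_eq_of_norm (P : Subgroup H) [Fintype P] (hP : IsPGroup p P)
    (J : Ideal (MonoidAlgebra (ZMod p) H))
    (hJ : ∀ s : MonoidAlgebra (ZMod p) H,
      (∑ x : P, MonoidAlgebra.single (x : H) 1) * s ∈ J →
      ∃ j ∈ J, ∃ w : P → MonoidAlgebra (ZMod p) H,
        s = j + ∑ x : P, (MonoidAlgebra.single (x : H) 1 * w x - w x)) :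
    ∃ ψ : MonoidAlgebra (ZMod p) H →ₗ[ZMod p] MonoidAlgebra (ZMod p) H,
      (∀ j ∈ J, ψ j = 0) ∧
      ∀ s, s - ∑ x : P, MonoidAlgebra.single (x : H) 1 *
        ψ (MonoidAlgebra.single (x : H)⁻¹ 1 * s) ∈ J := by
  classical
  let V := MonoidAlgebra (ZMod p) H
  -- `V ⧸ W` is the space of `P`-coinvariants of `V / J`; lifts `s i` of a basis of it will form a
  -- basis of `V / J` over `𝔽_p[P]`.
  let W : Submodule (ZMod p) V := J.restrictScalars (ZMod p) ⊔
    Submodule.span (ZMod p) {y | ∃ (x : P) (w : V), y = MonoidAlgebra.single (x : H) 1 * w - w}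
  have hJW : ∀ j ∈ J, j ∈ W := fun j hj => Submodule.mem_sup_left hj
  have hIW : ∀ (x : P) (w : V), MonoidAlgebra.single (x : H) 1 * w - w ∈ W := fun x w =>
    Submodule.mem_sup_right (Submodule.subset_span ⟨x, w, rfl⟩)
  have : Module.Finite (ZMod p) V :=
    Module.Finite.equiv (MonoidAlgebra.coeffLinearEquiv (ZMod p) : V ≃ₗ[ZMod p] (H →₀ ZMod p)).symm
  have : Finite V := Module.finite_of_finite (ZMod p)
  let b := Module.finBasis (ZMod p) (V ⧸ W)
  set n := Module.finrank (ZMod p) (V ⧸ W)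
  choose s hs using fun i => W.mkQ_surjective (b i)
  let π := (J.restrictScalars (ZMod p)).mkQ
  -- The comparison map `𝔽_p[P]^n → V` attached to the `s i`; bijectivity modulo `J` says that `V /
  -- J` is free over `𝔽_p[P]`.
  let Φ : (Fin n × P → ZMod p) →ₗ[ZMod p] V := 
    Fintype.linearCombination (ZMod p) (fun t => MonoidAlgebra.single (t.2 : H) 1 * s t.1)
  have hΦ : ∀ c, Φ c = ∑ x : P, MonoidAlgebra.single (x : H) 1 * ∑ i, c (i, x) • s i := fun c => by
    rw [Fintype.linearCombination_apply, Fintype.sum_prod_type_right]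
    refine Finset.sum_congr rfl fun x _ => ?_
    rw [Finset.mul_sum]
    refine Finset.sum_congr rfl fun i _ => ?_
    rw [mul_smul_comm]
  have hΦs : ∀ (y : P) c, MonoidAlgebra.single (y : H) 1 * Φ c =
      Φ (fun t => c (t.1, y⁻¹ * t.2)) := fun y c => by
    rw [hΦ, hΦ, Finset.mul_sum]
    refine Fintype.sum_equiv (Equiv.mulLeft y) _ _ fun x => ?_
    rw [← mul_assoc, MonoidAlgebra.single_mul_single]
    simp
  -- injectivity
  have hinj : ∀ c, Φ c ∈ J → c = 0 := by
    let : DistribMulAction P (Fin n × P → ZMod p) :=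
      { smul := fun y c t => c (t.1, y⁻¹ * t.2)
        one_smul := fun c => funext fun t => by
          change c (t.1, 1⁻¹ * t.2) = c t
          simp
        mul_smul := fun x y c => funext fun t => by
          change c (t.1, (x * y)⁻¹ * t.2) = c (t.1, y⁻¹ * (x⁻¹ * t.2))
          rw [mul_inv_rev, mul_assoc]
        smul_zero := fun x => rfl
        smul_add := fun x c d => rfl }
    let E : Submodule (ZMod p) (Fin n × P → ZMod p) := (J.restrictScalars (ZMod p)).comap Φ
    by_contra hcon
    push Not at hcon
    obtain ⟨c, hc, hc0⟩ := hcon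
    obtain ⟨d, hd, hd0, hfix⟩ := exists_fixed_ne_zero hP E
      (fun h => hc0 (by have : c ∈ E := hc; rwa [h] at this))
      (fun y c hc => by
        change Φ (fun t => c (t.1, y⁻¹ * t.2)) ∈ J
        rw [← hΦs]
        exact J.mul_mem_left _ hc)
    -- A `P`-fixed `d` is constant along `P`, so `Φ d` is the norm element times a combination of
    -- the `s i`. The hypothesis places this combination in `W`, and independence of the basis gives
    -- `d = 0`.
    have hd1 : ∀ i x, d (i, x) = d (i, 1) := fun i x => by
      have := congrFun (hfix x) (i, x)
      change d (i, x⁻¹ * x) = d (i, x) at this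
      rw [← this, inv_mul_cancel]
    have hdJ : Φ d ∈ J := hd
    rw [hΦ] at hdJ
    simp only [hd1, ← Finset.sum_mul] at hdJ
    obtain ⟨j, hj, w, hw⟩ := hJ _ hdJ
    have h0 : W.mkQ (∑ i, d (i, 1) • s i) = 0 := by
      rw [Submodule.mkQ_apply, Submodule.Quotient.mk_eq_zero, hw]
      exact W.add_mem (hJW _ hj) (W.sum_mem fun x _ => hIW x _)
    simp only [map_sum, map_smul, hs] at h0
    have h1 := Fintype.linearIndependent_iff.mp b.linearIndependent _ h0
    exact hd0 (funext fun ⟨i, x⟩ => (hd1 i x).trans (h1 i))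
  -- surjectivity
  have hsurj : ∀ v, ∃ c, v - Φ c ∈ J := by
    let W' : Submodule (ZMod p) V := J.restrictScalars (ZMod p) ⊔ LinearMap.range Φ
    suffices hW' : W' = ⊤ by
      intro v
      have hv : v ∈ W' := hW' ▸ Submodule.mem_top
      obtain ⟨j, hj, _, ⟨c, rfl⟩, rfl⟩ := Submodule.mem_sup.mp hv
      exact ⟨c, by simpa using hj⟩
    -- Nakayama's lemma in dual form: a proper image is annihilated by a nonzero `P`-invariant
    -- functional. Such a functional factors through `V ⧸ W` and vanishes on every `s i`, so it is
    -- zero.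
    let : DistribMulAction P (Module.Dual (ZMod p) V) :=
      { smul := fun y f => f.comp (LinearMap.mulLeft (ZMod p) (MonoidAlgebra.single (y : H)⁻¹ 1))
        one_smul := fun f => LinearMap.ext fun v => by
          change f (MonoidAlgebra.single ((1 : P) : H)⁻¹ 1 * v) = f v
          simp [← MonoidAlgebra.one_def]
        mul_smul := fun x y f => LinearMap.ext fun v => by
          change f (MonoidAlgebra.single ((x * y : P) : H)⁻¹ 1 * v) =
            f (MonoidAlgebra.single (y : H)⁻¹ 1 * (MonoidAlgebra.single (x : H)⁻¹ 1 * v))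
          rw [← mul_assoc, MonoidAlgebra.single_mul_single]
          simp
        smul_zero := fun x => rfl
        smul_add := fun x c d => rfl }
    by_contra hne
    have : Finite (Module.Dual (ZMod p) V) := Module.finite_of_finite (ZMod p)
    obtain ⟨f, hf, hf0, hfix⟩ := exists_fixed_ne_zero hP W'.dualAnnihilator
      (fun h => hne (Subspace.dualAnnihilator_inj.mp (h.trans Submodule.dualAnnihilator_top.symm)))
      (fun y f hf => by
        rw [Submodule.mem_dualAnnihilator] at hf ⊢
        intro w hw
        obtain ⟨j, hj, _, ⟨c, rfl⟩, rfl⟩ := Submodule.mem_sup.mp hw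
        change f (MonoidAlgebra.single (y : H)⁻¹ 1 * (j + Φ c)) = 0
        have := hΦs y⁻¹ c
        rw [Subgroup.coe_inv] at this
        rw [mul_add, this]
        exact hf _ (Submodule.add_mem_sup (J.mul_mem_left _ hj) ⟨_, rfl⟩))
    rw [Submodule.mem_dualAnnihilator] at hf
    have hfx : ∀ (x : P) v, f (MonoidAlgebra.single (x : H) 1 * v) = f v := fun x v => by
      have := congrArg (fun g : Module.Dual (ZMod p) V => g v) (hfix x⁻¹)
      change f (MonoidAlgebra.single ((x⁻¹ : P) : H)⁻¹ 1 * v) = f v at this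
      simpa using this
    have hfW : W ≤ LinearMap.ker f := by
      refine sup_le (fun j hj => hf _ (Submodule.mem_sup_left hj)) (Submodule.span_le.mpr ?_)
      rintro _ ⟨x, w, rfl⟩
      simp [hfx]
    apply hf0
    refine LinearMap.ext fun v => ?_
    have hv : v - ∑ i, b.repr (W.mkQ v) i • s i ∈ W := by
      rw [← Submodule.Quotient.mk_eq_zero, ← Submodule.mkQ_apply, map_sub, map_sum]
      simp only [map_smul, hs]
      rw [b.sum_repr, sub_self]
    have h1 : f v = f (∑ i, b.repr (W.mkQ v) i • s i) := by
      have : f (v - ∑ i, b.repr (W.mkQ v) i • s i) = 0 := hfW hv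
      rwa [map_sub, sub_eq_zero] at this
    rw [h1, map_sum, LinearMap.zero_apply]
    refine Finset.sum_eq_zero fun i _ => ?_
    have hsi : f (s i) = 0 := by
      refine hf _ (Submodule.mem_sup_right ⟨Pi.single (i, 1) 1, ?_⟩)
      simp [Φ, Fintype.linearCombination_apply, Pi.single_apply, ← MonoidAlgebra.one_def]
    rw [map_smul, hsi, smul_zero]
  have hbij : Function.Bijective (π.comp Φ) := by
    constructor
    · rw [injective_iff_map_eq_zero]
      intro c hc
      exact hinj c ((Submodule.Quotient.mk_eq_zero _).mp hc)
    · intro y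
      obtain ⟨v, rfl⟩ := (J.restrictScalars (ZMod p)).mkQ_surjective y
      obtain ⟨c, hc⟩ := hsurj v
      refine ⟨c, ((Submodule.Quotient.eq _).mpr hc).symm⟩
  let e := LinearEquiv.ofBijective _ hbij
  -- The coordinate of `𝔽_p[P]^n` at `1 ∈ P`; the sum of its conjugates under `P` recovers `Φ`.
  let ℓ : (Fin n × P → ZMod p) →ₗ[ZMod p] V :=
    ∑ i, (LinearMap.proj (i, (1 : P))).smulRight (s i)
  have hℓ : ∀ c, ℓ c = ∑ i, c (i, 1) • s i := fun c => by simp [ℓ]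
  refine ⟨ℓ.comp (e.symm.toLinearMap.comp π), fun j hj => ?_, fun v => ?_⟩
  · have : π j = 0 := (Submodule.Quotient.mk_eq_zero _).mpr hj
    simp [this]
  · obtain ⟨c, hc⟩ := hsurj v
    have he : ∀ (x : P), e.symm (π (MonoidAlgebra.single (x : H)⁻¹ 1 * v)) =
        fun t => c (t.1, x * t.2) := fun x => by
      rw [LinearEquiv.symm_apply_eq]
      refine (Submodule.Quotient.eq _).mpr ?_
      change _ - Φ _ ∈ J
      have h := hΦs x⁻¹ c
      rw [inv_inv, Subgroup.coe_inv] at h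
      rw [← h, ← mul_sub]
      exact J.mul_mem_left _ hc
    have hfin : ∑ x : P, MonoidAlgebra.single (x : H) 1 *
        (ℓ.comp (e.symm.toLinearMap.comp π)) (MonoidAlgebra.single (x : H)⁻¹ 1 * v) = Φ c := by
      rw [hΦ]
      refine Finset.sum_congr rfl fun x _ => ?_
      rw [LinearMap.comp_apply, LinearMap.comp_apply, LinearEquiv.coe_coe, he, hℓ]
      simp
    rw [hfin]
    exact hc

/-- A two-sided ideal of `F_p[H]` whose preimage in `ℤ_p[H]` has trivial right order is generated,
as a left ideal, by an idempotent. -/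
theorem exists_right_identity_of_order_eq (J : Ideal (MonoidAlgebra (ZMod p) H)) [J.IsTwoSided]
    (hJ : ∀ y, (∀ j, modP p H j ∈ J → ∃ j', modP p H j' ∈ J ∧ j * y = p * j') →
      modP p H y = 0) :
    ∃ f ∈ J, ∀ w ∈ J, w * f = w := by
  classical
  obtain ⟨P⟩ := (inferInstance : Nonempty (Sylow p H))
  obtain ⟨C, hC, hCcard⟩ := exists_coset_representatives (P : Subgroup H)
  obtain ⟨ψ, hψ⟩ := exists_transfer_of_order_eq J hJ
  obtain ⟨θ, hθJ, hθ⟩ := exists_trace_eq_of_norm (P : Subgroup H) P.isPGroup' J (by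
    intro s hs
    obtain ⟨b, rfl⟩ := modP_surjective s
    set ν : MonoidAlgebra ℤ_[p] H := ∑ x : (P : Subgroup H), MonoidAlgebra.single (x : H) 1 with hν
    have hνm : modP p H ν = ∑ x : (P : Subgroup H), MonoidAlgebra.single (x : H) 1 := by
      simp [hν]
    rw [← hνm, ← map_mul] at hs
    have hxν : ∀ x : (P : Subgroup H), MonoidAlgebra.single (x : H) 1 * (ν * b) = ν * b := by
      intro x
      rw [← mul_assoc, hν, Finset.mul_sum]
      congr 1
      exact Fintype.sum_equiv (Equiv.mulLeft x) _ _ fun y => by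
        simp [MonoidAlgebra.single_mul_single]
    -- Here `ν * b` is a `P`-invariant element of `𝒥`. Since `H = P C`, the partial transfer over
    -- `C` produces `j' ∈ 𝒥` with `ν * j' = ν * b`; then `b - j'` is killed by the norm and lies in
    -- the augmentation part.
    let j' := ∑ c ∈ C, MonoidAlgebra.single c 1 * ψ (MonoidAlgebra.single c⁻¹ 1 * (ν * b))
    have hj' : ν * j' = ν * b := by
      conv_rhs => rw [← (hψ _ hs).2, sum_eq_sum_sum_cosets (P : Subgroup H) C hC]
      rw [hν, Finset.sum_mul]
      refine Finset.sum_congr rfl fun x _ => ?_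
      rw [Finset.mul_sum]
      refine Finset.sum_congr rfl fun c _ => ?_
      have h := hxν x⁻¹
      rw [Subgroup.coe_inv] at h
      have h2 : (MonoidAlgebra.single ((x : H) * c)⁻¹ 1 : MonoidAlgebra ℤ_[p] H) =
          MonoidAlgebra.single c⁻¹ 1 * MonoidAlgebra.single (x : H)⁻¹ 1 := by
        rw [MonoidAlgebra.single_mul_single, mul_inv_rev, one_mul]
      rw [← hν, h2, mul_assoc (MonoidAlgebra.single c⁻¹ 1), h, ← mul_assoc,
        MonoidAlgebra.single_mul_single, one_mul]
    have hj'J : modP p H j' ∈ J := by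
      rw [map_sum]
      refine J.sum_mem fun c _ => ?_
      rw [map_mul]
      refine J.mul_mem_left _ (hψ _ ?_).1
      rw [map_mul]
      exact J.mul_mem_left _ hs
    obtain ⟨w, hw⟩ := exists_sum_sub_of_norm_mul_eq_zero (P : Subgroup H)
      (v := modP p H b - modP p H j') (by
        rw [← hνm, ← map_sub, ← map_mul, mul_sub, hj', sub_self, map_zero])
    exact ⟨_, hj'J, w, by rw [← hw]; abel⟩)
  have hidx : ((C.card : ℕ) : ZMod p) ≠ 0 := by
    rw [hCcard, Ne, ZMod.natCast_eq_zero_iff]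
    exact P.not_dvd_index
  -- Averaging from `P` to `H`, possible because the index of a Sylow subgroup is prime to `p`. The
  -- map `τ` is left-linear, kills `J` and is the identity modulo `J`, so it splits the projection
  -- onto the quotient by `J`; the idempotent is `1 - τ 1`.
  let τ : MonoidAlgebra (ZMod p) H → MonoidAlgebra (ZMod p) H := fun w =>
    (C.card : ZMod p)⁻¹ • ∑ h : H, MonoidAlgebra.single h 1 * θ (MonoidAlgebra.single h⁻¹ 1 * w)
  have hτ : ∀ w, w * τ 1 = τ w := by
    intro w
    induction w using MonoidAlgebra.induction_linear with
    | zero => simp [τ]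
    | add a b ha hb =>
      rw [add_mul, ha, hb]
      simp only [τ, mul_add, map_add, Finset.sum_add_distrib, smul_add]
    | single g r =>
      have hr : (MonoidAlgebra.single g r : MonoidAlgebra (ZMod p) H) =
        r • MonoidAlgebra.single g 1 := by simp
      simp only [τ]
      rw [mul_smul_comm, Finset.mul_sum]
      congr 1
      refine Fintype.sum_equiv (Equiv.mulLeft g) _ _ fun h => ?_
      rw [hr, mul_smul_comm, map_smul, mul_smul_comm, smul_mul_assoc, ← mul_assoc,
        MonoidAlgebra.single_mul_single, MonoidAlgebra.single_mul_single]
      simp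
  have h1 : 1 - τ 1 ∈ J := by
    have h2 : (1 : MonoidAlgebra (ZMod p) H) - τ 1 = (C.card : ZMod p)⁻¹ •
        ((C.card : ZMod p) • 1 -
          ∑ h : H, MonoidAlgebra.single h 1 * θ (MonoidAlgebra.single h⁻¹ 1 * 1)) := by
      rw [smul_sub, smul_smul, inv_mul_cancel₀ hidx, one_smul]
    rw [h2]
    refine (J.restrictScalars (ZMod p)).smul_mem _ ?_
    change _ ∈ J
    -- Substituting `h ↦ h⁻¹` decomposes `H` as `C⁻¹ P`, so that the inner sum over `P` is the one
    -- controlled by `hθ`.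
    have h3 : ∑ h : H, MonoidAlgebra.single h 1 * θ (MonoidAlgebra.single h⁻¹ 1 * 1) =
        ∑ c ∈ C, MonoidAlgebra.single c⁻¹ 1 * ∑ x : (P : Subgroup H),
          MonoidAlgebra.single (x : H) 1 * θ (MonoidAlgebra.single (x : H)⁻¹ 1 *
            MonoidAlgebra.single c 1) := by
      rw [← Equiv.sum_comp (Equiv.inv H), sum_eq_sum_sum_cosets (P : Subgroup H) C hC, Finset.sum_comm]
      refine Finset.sum_congr rfl fun c _ => ?_
      rw [Finset.mul_sum, ← Equiv.sum_comp (Equiv.inv (P : Subgroup H))]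
      refine Finset.sum_congr rfl fun x _ => ?_
      rw [← mul_assoc, MonoidAlgebra.single_mul_single, MonoidAlgebra.single_mul_single]
      simp
    have h4 : ((C.card : ZMod p) • 1 : MonoidAlgebra (ZMod p) H) =
        ∑ c ∈ C, MonoidAlgebra.single c⁻¹ 1 * MonoidAlgebra.single c 1 := by
      simp only [MonoidAlgebra.single_mul_single, inv_mul_cancel, mul_one,
        ← MonoidAlgebra.one_def, Finset.sum_const]
      rw [Nat.cast_smul_eq_nsmul]
    rw [h3, h4, ← Finset.sum_sub_distrib]
    refine J.sum_mem fun c _ => ?_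
    rw [← mul_sub]
    exact J.mul_mem_left _ (hθ _)
  refine ⟨1 - τ 1, h1, fun w hw => ?_⟩
  have h0 : τ w = 0 := by
    simp only [τ]
    rw [Finset.sum_eq_zero, smul_zero]
    intro h _
    rw [hθJ _ (J.mul_mem_left _ hw), mul_zero]
  rw [mul_sub, mul_one, hτ, h0, sub_zero]

end Free

/-! ### Semisimple rings: central idempotents and Skolem-Noether -/

section Semisimple

variable {B : Type*} [Ring B]

/-- Splitting off `I` gives a right identity of `I`, and the same in the opposite ring gives a left
identity. The two coincide, and `f * b = f * b * f = b * f` makes it central. -/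
lemma exists_central_idempotent_of_isTwoSided [IsSemisimpleRing B] (I : Ideal B) [I.IsTwoSided] :
    ∃ f ∈ I, (∀ w ∈ I, w * f = w) ∧ (∀ w ∈ I, f * w = w) ∧ ∀ b, f * b = b * f := by
  have right : ∀ {B : Type _} [Ring B] [IsSemisimpleRing B] (I : Ideal B),
      ∃ f ∈ I, ∀ w ∈ I, w * f = w := by
    intro B _ _ I
    obtain ⟨K, hK⟩ := exists_isCompl I
    obtain ⟨f, hf, g, hg, hfg⟩ := Submodule.mem_sup.mp
      (show (1 : B) ∈ I ⊔ K by rw [hK.sup_eq_top]; trivial)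
    refine ⟨f, hf, fun w hw => ?_⟩
    have h1 : w - w * f = w * g := by
      rw [eq_sub_of_add_eq hfg]; noncomm_ring
    have h2 : w - w * f ∈ I ⊓ K :=
      ⟨I.sub_mem hw (I.mul_mem_left _ hf), by rw [h1]; exact K.mul_mem_left _ hg⟩
    rw [hK.inf_eq_bot] at h2
    exact (sub_eq_zero.mp h2).symm
  obtain ⟨f, hf, hfr⟩ := right I
  let I' : Ideal Bᵐᵒᵖ :=
    { carrier := {x | x.unop ∈ I}
      zero_mem' := I.zero_mem
      add_mem' := fun h h' => I.add_mem h h'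
      smul_mem' := fun c x h => I.mul_mem_right _ h }
  obtain ⟨g, hg, hgl⟩ := right I'
  have hgl' : ∀ w ∈ I, g.unop * w = w := fun w hw =>
    congrArg MulOpposite.unop (hgl (MulOpposite.op w) hw)
  have hfg : f = g.unop := (hgl' f hf).symm.trans (hfr _ hg)
  have hfl : ∀ w ∈ I, f * w = w := fun w hw => by rw [hfg]; exact hgl' w hw
  refine ⟨f, hf, hfr, hfl, fun b => ?_⟩
  rw [← hfr _ (I.mul_mem_right b hf), mul_assoc, hfl _ (I.mul_mem_left b hf)]

/-- A ring automorphism of a matrix algebra over a field fixing the scalars is inner. -/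
lemma exists_conj_of_fixes_scalars {n : ℕ} {F : Type*} [Field F]
    (α : Matrix (Fin n) (Fin n) F ≃+* Matrix (Fin n) (Fin n) F)
    (hα : ∀ c : F, α (algebraMap F _ c) = algebraMap F _ c) :
    ∃ u : (Matrix (Fin n) (Fin n) F)ˣ, ∀ b, u * b = α b * u := by
  let α' : Matrix (Fin n) (Fin n) F ≃ₐ[F] Matrix (Fin n) (Fin n) F := AlgEquiv.ofRingEquiv hα
  let e : Matrix (Fin n) (Fin n) F ≃ₐ[F] Module.End F (Fin n → F) := Matrix.toLinAlgEquiv'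
  obtain ⟨T, hT⟩ := AlgEquiv.eq_linearEquivConjAlgEquiv ((e.symm.trans α').trans e)
  refine ⟨⟨e.symm T.toLinearMap, e.symm T.symm.toLinearMap, ?_, ?_⟩, fun b => ?_⟩
  · rw [← map_mul, ← map_one e.symm]; congr 1; ext; simp
  · rw [← map_mul, ← map_one e.symm]; congr 1; ext; simp
  · have h := DFunLike.congr_fun hT (e b)
    apply e.injective
    have h2 : e (α b) = T.toLinearMap ∘ₗ e b ∘ₗ T.symm.toLinearMap := by
      have h3 : e (α b) = ((e.symm.trans α').trans e) (e b) := by simp [α']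
      rw [h3, hT]
      rfl
    change e (e.symm _ * b) = e (α b * e.symm _)
    rw [map_mul, map_mul, h2]
    ext; simp

/-- A single simple block below `ε` suffices. Its centre is fixed by `α`, in particular its unit, so
`α` restricts to an automorphism of a matrix ring over a finite field that fixes scalars. This
restriction is inner, and the implementing unit extended by zero works for all of `B`. -/
lemma exists_skolem_noether [Finite B] [IsSemisimpleRing B] (α : B ≃+* B) {ε : B}
    (hidem : ε * ε = ε) (hcent : ∀ b, ε * b = b * ε) (hne : ε ≠ 0)
    (hα : ∀ c, (∀ b, c * b = b * c) → α (ε * c) = ε * c) :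
    ∃ u, u ≠ 0 ∧ ε * u = u ∧ ∀ b, u * b = α b * u := by
  classical
  obtain ⟨n, D, d, _, hd, ⟨e⟩⟩ := IsSemisimpleRing.exists_ringEquiv_pi_matrix_divisionRing B
  have hcomp : ∃ i, e ε i ≠ 0 := by
    by_contra! h
    exact hne (e.injective (by rw [map_zero]; exact funext h))
  obtain ⟨i, hi⟩ := hcomp
  have := hd i
  have hfinM : Finite (Matrix (Fin (d i)) (Fin (d i)) (D i)) :=
    Finite.of_surjective (fun b => e b i) (fun x => ⟨e.symm (Pi.single i x), by simp⟩)
  have hfin : Finite (D i) :=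
    Finite.of_surjective (fun b => e b i 0 0)
      (fun x => ⟨e.symm (Pi.single i (Matrix.scalar _ x)), by simp⟩)
  let : Field (D i) := littleWedderburn (D i)
  have hcm : ∀ x y : D i, x * y = y * x := fun x y => mul_comm x y
  -- central elements of the component
  have hcen : ∀ c : D i, ∀ b, e.symm (Pi.single i (Matrix.scalar _ c)) * b =
      b * e.symm (Pi.single i (Matrix.scalar _ c)) := fun c b => by
    apply e.injective
    rw [map_mul, map_mul, e.apply_symm_apply]
    funext j
    rcases eq_or_ne j i with rfl | hj
    · simp only [Pi.mul_apply, Pi.single_eq_same]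
      exact (Matrix.scalar_commute c (fun r' => hcm _ _) _).eq
    · simp [hj]
  have hεi : e ε i = 1 := by
    -- a nonzero central idempotent of a simple ring
    have h1 : e ε i * e ε i = e ε i := by rw [← Pi.mul_apply, ← map_mul, hidem]
    have h2 : ∀ X, e ε i * X = X * e ε i := fun X => by
      have := congrFun (congrArg e (hcent (e.symm (Pi.single i X)))) i
      simpa using this
    have h3 : e ε i ∈ Set.center (Matrix (Fin (d i)) (Fin (d i)) (D i)) :=
      Semigroup.mem_center_iff.mpr fun X => (h2 X).symm
    have h4 : ∃ c : D i, e ε i = Matrix.scalar _ c := by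
      obtain ⟨c, hc⟩ := (Matrix.mem_range_scalar_iff_commute_single').mpr
        (fun a b => (h2 (Matrix.single a b 1)).symm)
      exact ⟨c, hc.symm⟩
    obtain ⟨c, hc⟩ := h4
    rw [hc, ← map_mul] at h1
    have h5 : c * c = c := Matrix.scalar_inj.mp h1
    have h6 : c ≠ 0 := by rintro rfl; exact hi (by rw [hc, map_zero])
    rw [hc, (mul_eq_left₀ h6).mp h5, map_one]
  have hε1 : ∀ X, ε * e.symm (Pi.single i X) = e.symm (Pi.single i X) := fun X => by
    apply e.injective
    rw [map_mul, e.apply_symm_apply]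
    funext j
    rcases eq_or_ne j i with rfl | hj
    · simp [hεi]
    · simp [hj]
  have hfixc : ∀ c : D i, α (e.symm (Pi.single i (Matrix.scalar _ c))) =
      e.symm (Pi.single i (Matrix.scalar _ c)) := fun c => by
    have := hα _ (hcen c)
    rwa [hε1] at this
  have hsupp : ∀ X, e (α (e.symm (Pi.single i X))) =
      Pi.single i (e (α (e.symm (Pi.single i X))) i) := fun X => by
    have h1 : e.symm (Pi.single i X) = e.symm (Pi.single i (Matrix.scalar _ 1)) *
        e.symm (Pi.single i X) := by
      rw [← map_mul, ← Pi.single_mul, map_one, one_mul]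
    have h2 : e (α (e.symm (Pi.single i X))) =
        Pi.single i (Matrix.scalar _ 1) * e (α (e.symm (Pi.single i X))) := by
      conv_lhs => rw [h1, map_mul, hfixc, map_mul, e.apply_symm_apply]
    rw [h2]
    funext j
    rcases eq_or_ne j i with rfl | hj
    · simp
    · simp [hj]
  let β₀ : Matrix (Fin (d i)) (Fin (d i)) (D i) →+* Matrix (Fin (d i)) (Fin (d i)) (D i) :=
    { toFun := fun X => e (α (e.symm (Pi.single i X))) i
      map_one' := by
        have := hfixc 1
        rw [map_one] at this
        rw [this]; simp
      map_mul' := fun X Y => by rw [Pi.single_mul, map_mul, map_mul, map_mul, Pi.mul_apply]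
      map_zero' := by simp
      map_add' := fun X Y => by rw [Pi.single_add, map_add, map_add, map_add, Pi.add_apply] }
  have hβinj : Function.Injective β₀ := by
    intro X Y h
    have h1 : e (α (e.symm (Pi.single i X))) = e (α (e.symm (Pi.single i Y))) := by
      rw [hsupp X, hsupp Y]; exact congrArg _ h
    exact Pi.single_injective i (e.symm.injective (α.injective (e.injective h1)))
  let β := RingEquiv.ofBijective β₀ ⟨hβinj, Finite.surjective_of_injective hβinj⟩
  obtain ⟨u, hu⟩ := exists_conj_of_fixes_scalars β (fun c => by
    have := hfixc c
    change e (α (e.symm (Pi.single i (Matrix.scalar _ c)))) i = _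
    rw [this]; simp; rfl)
  refine ⟨e.symm (Pi.single i u), ?_, hε1 _, fun b => ?_⟩
  · intro h
    have h1 : (u : Matrix (Fin (d i)) (Fin (d i)) (D i)) = 0 := by
      have := congrFun (congrArg e h) i
      rwa [e.apply_symm_apply, Pi.single_eq_same, map_zero, Pi.zero_apply] at this
    have := u.isUnit
    rw [h1, isUnit_zero_iff] at this
    exact zero_ne_one this
  · have hb : e.symm (Pi.single i (e b i)) = e.symm (Pi.single i (Matrix.scalar _ 1)) * b := by
      apply e.injective
      rw [map_mul, e.apply_symm_apply, e.apply_symm_apply]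
      funext j
      rcases eq_or_ne j i with rfl | hj
      · simp
      · simp [hj]
    have h1 : e (α b) i = β (e b i) := by
      change _ = e (α (e.symm (Pi.single i (e b i)))) i
      rw [hb, map_mul, hfixc, map_mul, e.apply_symm_apply]
      simp
    apply e.injective
    rw [map_mul, map_mul, e.apply_symm_apply]
    funext j
    rcases eq_or_ne j i with rfl | hj
    · simp only [Pi.mul_apply, Pi.single_eq_same, h1]
      exact hu _
    · simp [hj]

end Semisimple

/-! ### Crossed products: separating operators and the implementing unit -/

section CrossedProduct

lemma pow_mul_map {A B : Type*} [Ring A] [Ring B] {ι : B →ₙ+* A} {σ : RingAut B} {γ : A}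
    (hγ : ∀ b, γ * ι b = ι (σ b) * γ) (n : ℕ) (b : B) :
    γ ^ n * ι b = ι ((σ ^ n) b) * γ ^ n := by
  induction n generalizing b with
  | zero => simp
  | succ n ih => rw [pow_succ, mul_assoc, hγ, ← mul_assoc, ih, pow_succ]; simp [mul_assoc]


variable {p : ℕ} [Fact p.Prime] {A B : Type*} [Ring A] [CharP A p] [Ring B] [Finite B]
  [IsSemisimpleRing B] [Algebra (ZMod p) B]
  {ι : B →ₙ+* A} {σ : RingAut B} {γ : A} {m : ℕ}

/-- If the powers `γ ^ l`, `0 < l < s`, act nontrivially on the centre of the `γ`-simple component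
`ε`, then the coefficients of `γ ^ l` can be removed from the elements of a two-sided ideal. -/
lemma exists_separating_operator {ε : B} (hσε : σ ε = ε) (hidem : ε * ε = ε)
    (hcent : ∀ b, ε * b = b * ε)
    (hsimple : ∀ I : Ideal B, I.IsTwoSided → (∀ b ∈ I, σ b ∈ I) → (∀ b ∈ I, ε * b = b) →
      I = ⊥ ∨ ε ∈ I) (hγ : ∀ b, γ * ι b = ι (σ b) * γ) {s : ℕ}
    (hs : ∀ l, 0 < l → l < s → ∃ c, (∀ b, c * b = b * c) ∧ (σ ^ l) (ε * c) ≠ ε * c)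
    (n : ℕ) (hn : n < s) :
    ∃ (op : A →+ A) (D : ℕ → B), (∀ I : Ideal A, I.IsTwoSided → ∀ x ∈ I, op x ∈ I) ∧
      (∀ b l, op (ι b * γ ^ l) = ι (D l * b) * γ ^ l) ∧ D 0 = ε ∧
      ∀ l, 0 < l → l ≤ n → D l = 0 := by
  have hσlε : ∀ l : ℕ, (σ ^ l) ε = ε := fun l => by
    induction l with
    | zero => simp
    | succ l ih => rw [pow_succ, RingAut.mul_apply, hσε, ih]
  have hσc : ∀ (l : ℕ) c, (∀ b, c * b = b * c) → ∀ b, (σ ^ l) c * b = b * (σ ^ l) c :=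
    fun l c hc b => by
      obtain ⟨b, rfl⟩ := (σ ^ l).surjective b
      rw [← map_mul, hc, map_mul]
  induction n with
  | zero =>
    exact ⟨AddMonoidHom.mulLeft (ι ε), fun _ => ε, fun I _ x hx => I.mul_mem_left _ hx,
      fun b l => by simp [mul_assoc], rfl, fun l h h' => by omega⟩
  | succ k ih =>
    obtain ⟨op, D, hop, hD, hD0, hDl⟩ := ih (by omega)
    -- For central `c`, the operator `x ↦ x * ι (ε * c) - ι ((σ ^ (k + 1)) (ε * c)) * x` kills the
    -- coefficient of `γ ^ (k + 1)` and multiplies the constant coefficient by the corresponding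
    -- element of `T`. Combinations of these reach every element of the ideal spanned by `T`.
    let T : Set B := {d | ∃ c, (∀ b, c * b = b * c) ∧ d = ε * c - (σ ^ (k + 1)) (ε * c)}
    have hTc : ∀ d ∈ T, ∀ b, d * b = b * d := by
      rintro _ ⟨c, hc, rfl⟩ b
      have h1 : ∀ b, ε * c * b = b * (ε * c) := fun b => by
        rw [mul_assoc, hc, ← mul_assoc, hcent, mul_assoc]
      rw [sub_mul, mul_sub, h1, hσc _ _ h1]
    have hspan : ∀ d ∈ Ideal.span T, ∃ (op : A →+ A) (D : ℕ → B),
        (∀ I : Ideal A, I.IsTwoSided → ∀ x ∈ I, op x ∈ I) ∧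
        (∀ b l, op (ι b * γ ^ l) = ι (D l * b) * γ ^ l) ∧ D 0 = d ∧ D (k + 1) = 0 := by
      intro d hd
      induction hd using Submodule.span_induction with
      | mem d hd =>
        obtain ⟨c, hc, rfl⟩ := hd
        refine ⟨AddMonoidHom.mulRight (ι (ε * c)) - AddMonoidHom.mulLeft (ι ((σ ^ (k + 1)) (ε * c))),
          fun l => (σ ^ l) (ε * c) - (σ ^ (k + 1)) (ε * c), fun I _ x hx => ?_, fun b l => ?_, ?_, ?_⟩
        · exact I.sub_mem (I.mul_mem_right _ hx) (I.mul_mem_left _ hx)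
        · have h1 : ∀ b, ε * c * b = b * (ε * c) := fun b => by
            rw [mul_assoc, hc, ← mul_assoc, hcent, mul_assoc]
          simp only [AddMonoidHom.sub_apply, AddMonoidHom.coe_mulLeft,
            AddMonoidHom.coe_mulRight]
          rw [mul_assoc, pow_mul_map hγ, ← mul_assoc, ← map_mul, ← mul_assoc, ← map_mul,
            ← sub_mul, ← map_sub, sub_mul, hσc l _ h1]
        · simp
        · simp
      | zero => exact ⟨0, 0, fun I _ x _ => I.zero_mem, fun b l => by simp, rfl, rfl⟩
      | add d d' _ _ h h' =>
        obtain ⟨op, D, h1, h2, h3, h4⟩ := h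
        obtain ⟨op', D', h1', h2', h3', h4'⟩ := h'
        refine ⟨op + op', D + D', fun I hI x hx => I.add_mem (h1 I hI x hx) (h1' I hI x hx),
          fun b l => ?_, ?_, ?_⟩
        · rw [AddMonoidHom.add_apply, h2, h2', Pi.add_apply, add_mul, map_add, add_mul]
        · rw [Pi.add_apply, h3, h3']
        · rw [Pi.add_apply, h4, h4', add_zero]
      | smul a d _ h =>
        obtain ⟨op, D, h1, h2, h3, h4⟩ := h
        refine ⟨(AddMonoidHom.mulLeft (ι a)).comp op, fun l => a * D l,
          fun I hI x hx => I.mul_mem_left _ (h1 I hI x hx), fun b l => ?_, ?_, ?_⟩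
        · rw [AddMonoidHom.comp_apply, h2, AddMonoidHom.coe_mulLeft, ← mul_assoc, ← map_mul,
            mul_assoc a]
        · change a * D 0 = a • d
          rw [h3, smul_eq_mul]
        · change a * D (k + 1) = 0
          rw [h4, mul_zero]
    -- The span of `T` is a two-sided `σ`-stable ideal below `ε`. It is nonzero because `σ ^ (k +
    -- 1)` moves some central element, so `γ`-simplicity puts `ε` in it.
    have hmem : ε ∈ Ideal.span T := by
      have h2s : (Ideal.span T).IsTwoSided := ⟨fun {x} b hx => by
        induction hx using Submodule.span_induction with
        | mem d hd => rw [hTc d hd]; exact Ideal.mul_mem_left _ _ (Ideal.subset_span hd)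
        | zero => simp
        | add d d' _ _ h h' => rw [add_mul]; exact Ideal.add_mem _ h h'
        | smul a d _ h => rw [smul_eq_mul, mul_assoc]; exact Ideal.mul_mem_left _ _ h⟩
      rcases hsimple (Ideal.span T) h2s (fun x hx => by
        induction hx using Submodule.span_induction with
        | mem d hd =>
          obtain ⟨c, hc, rfl⟩ := hd
          refine Ideal.subset_span ⟨σ c, by simpa using hσc 1 c hc, ?_⟩
          rw [map_sub, map_mul, hσε, map_mul, map_mul, map_mul, hσlε, hσε, ← RingAut.mul_apply,
            ← RingAut.mul_apply, ← pow_succ, ← pow_succ']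
        | zero => simp
        | add d d' _ _ h h' => rw [map_add]; exact Ideal.add_mem _ h h'
        | smul a d _ h => rw [smul_eq_mul, map_mul]; exact Ideal.mul_mem_left _ _ h) (fun x hx => by
        induction hx using Submodule.span_induction with
        | mem d hd =>
          obtain ⟨c, hc, rfl⟩ := hd
          rw [mul_sub, ← mul_assoc, hidem, map_mul, hσlε, ← mul_assoc, hidem]
        | zero => simp
        | add d d' _ _ h h' => rw [mul_add, h, h']
        | smul a d _ h => rw [smul_eq_mul, ← mul_assoc, hcent, mul_assoc, h]) with h | h
      · obtain ⟨c, hc, hne⟩ := hs (k + 1) (by omega) hn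
        have h3 : ε * c - (σ ^ (k + 1)) (ε * c) ∈ Ideal.span T := Ideal.subset_span ⟨c, hc, rfl⟩
        rw [h, Submodule.mem_bot, sub_eq_zero] at h3
        exact absurd h3.symm hne
      · exact h
    obtain ⟨op', D', hop', hD', hD0', hDl'⟩ := hspan ε hmem
    refine ⟨op'.comp op, fun l => D' l * D l, fun I hI x hx => hop' I hI _ (hop I hI x hx),
      fun b l => ?_,
      (congrArg₂ (· * ·) hD0' hD0).trans hidem, fun l hl hl' => ?_⟩
    · rw [AddMonoidHom.comp_apply, hD, hD', mul_assoc]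
    · change D' l * D l = 0
      rcases Nat.lt_or_ge k l with h | h
      · obtain rfl : l = k + 1 := by omega
        rw [hDl', zero_mul]
      · rw [hDl l hl h, mul_zero]

/-- The `γ`-simple case: an invertible element fixed by `σ`, of `p`-power order, which
implements a power of `σ`. -/
lemma exists_fixed_implementing_unit (hσ : σ ^ p ^ m = 1) {ε : B} (hσε : σ ε = ε)
    (hidem : ε * ε = ε) (hcent : ∀ b, ε * b = b * ε) (hne : ε ≠ 0)
    (hsimple : ∀ I : Ideal B, I.IsTwoSided → (∀ b ∈ I, σ b ∈ I) → (∀ b ∈ I, ε * b = b) →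
      I = ⊥ ∨ ε ∈ I) {s : ℕ}
    (hs : ∀ c, (∀ b, c * b = b * c) → (σ ^ s) (ε * c) = ε * c) :
    ∃ u v : B, u * v = ε ∧ v * u = ε ∧ ε * u = u ∧ ε * v = v ∧ σ u = u ∧ σ v = v ∧
      (∀ b, u * b = (σ ^ s) b * u) ∧ v ^ p ^ m = ε := by
  -- a nonzero implementing element, then a fixed one
  obtain ⟨u₀, hu₀, hεu₀, hu₀b⟩ := exists_skolem_noether (σ ^ s) hidem hcent hne hs
  let P := Subgroup.zpowers σ
  have hP : IsPGroup p P := by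
    refine IsPGroup.of_card_dvd_pow (n := m) ?_
    rw [Nat.card_zpowers]
    exact orderOf_dvd_of_pow_eq_one hσ
  -- The implementing elements form an `𝔽_p`-space stable under the `p`-group generated by `σ`,
  -- since `σ` commutes with `σ ^ s`; hence one of them is nonzero and fixed.
  let U : Submodule (ZMod p) B :=
    { carrier := {u | ε * u = u ∧ ∀ b, u * b = (σ ^ s) b * u}
      zero_mem' := by simp
      add_mem' := fun ⟨h1, h2⟩ ⟨h1', h2'⟩ => ⟨by rw [mul_add, h1, h1'],
        fun b => by rw [add_mul, mul_add, h2, h2']⟩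
      smul_mem' := fun c u ⟨h1, h2⟩ => ⟨by rw [mul_smul_comm, h1],
        fun b => by rw [smul_mul_assoc, mul_smul_comm, h2]⟩ }
  have hzε : ∀ x ∈ P, x ε = ε := by
    intro x hx
    have : P ≤ MulAction.stabilizer (RingAut B) ε := by
      rw [Subgroup.zpowers_le]; exact hσε
    exact this hx
  obtain ⟨u, ⟨hεu, hub⟩, hu0, hufix⟩ := exists_fixed_ne_zero (P := P) (M := B) hP U
    (fun h => hu₀ (by
      have h1 : u₀ ∈ U := ⟨hεu₀, hu₀b⟩
      rwa [h] at h1))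
    (fun x u ⟨h1, h2⟩ => by
      change ε * x.1 u = x.1 u ∧ ∀ b, x.1 u * b = (σ ^ s) b * x.1 u
      refine ⟨?_, fun b => ?_⟩
      · conv_lhs => rw [← hzε x.1 x.2]
        rw [← map_mul, h1]
      · obtain ⟨b, rfl⟩ := x.1.surjective b
        have hcomm : (σ ^ s) (x.1 b) = x.1 ((σ ^ s) b) := by
          obtain ⟨z, hz⟩ := x.2
          rw [← hz, ← RingAut.mul_apply, ← RingAut.mul_apply]
          congr 1
          exact ((Commute.refl σ).pow_left s).zpow_right z
        rw [← map_mul, h2, map_mul, hcomm])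
  have hσu : σ u = u := hufix ⟨σ, Subgroup.mem_zpowers σ⟩
  have hσsu : (σ ^ s) u = u := by
    have := hub u
    have h2 : ∀ l : ℕ, (σ ^ l) u = u := fun l => by
      induction l with
      | zero => simp
      | succ l ih => rw [pow_succ, RingAut.mul_apply, hσu, ih]
    exact h2 s
  -- `u` is invertible
  have hinv : ∀ u, ε * u = u → u ≠ 0 → σ u = u → ∀ τ : RingAut B, (∀ b, u * b = τ b * u) →
      ∃ v, u * v = ε ∧ v * u = ε ∧ ε * v = v ∧ σ v = v := by
    intro u hεu hu0 hσu τ hub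
    have huε : u * ε = u := by rw [← hcent, hεu]
    -- As `u` is normalising and fixed by `σ`, the left ideal it generates is two-sided and
    -- `σ`-stable, so it contains `ε`.
    obtain ⟨v, hv⟩ : ∃ v, v * u = ε := by
      have h2s : (Ideal.span {u}).IsTwoSided := ⟨fun {x} b hx => by
        obtain ⟨a, rfl⟩ := Ideal.mem_span_singleton'.mp hx
        rw [mul_assoc, hub, ← mul_assoc]
        exact Ideal.mul_mem_left _ _ (Ideal.mem_span_singleton_self u)⟩
      rcases hsimple (Ideal.span {u}) h2s (fun x hx => by
        obtain ⟨a, rfl⟩ := Ideal.mem_span_singleton'.mp hx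
        rw [map_mul, hσu]
        exact Ideal.mul_mem_left _ _ (Ideal.mem_span_singleton_self u)) (fun x hx => by
        obtain ⟨a, rfl⟩ := Ideal.mem_span_singleton'.mp hx
        rw [← mul_assoc, hcent, mul_assoc, hεu]) with h | h
      · exact absurd (Ideal.span_singleton_eq_bot.mp h) hu0
      · exact Ideal.mem_span_singleton'.mp h
    have hv' : u * (ε * τ.symm v) = ε := by
      rw [← mul_assoc, huε, hub, τ.apply_symm_apply, hv]
    have heq : ε * v = ε * τ.symm v := by
      calc ε * v = v * (u * (ε * τ.symm v)) := by rw [hv', hcent]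
        _ = ε * τ.symm v := by rw [← mul_assoc, hv, ← mul_assoc, hidem]
    have huv : u * (ε * v) = ε := by rw [heq, hv']
    have hvu : ε * v * u = ε := by rw [mul_assoc, hv, hidem]
    have hεσ : ε * σ (ε * v) = σ (ε * v) := by
      rw [show ε * σ (ε * v) = σ ε * σ (ε * v) by rw [hσε], ← map_mul, ← mul_assoc, hidem]
    refine ⟨ε * v, huv, hvu, by rw [← mul_assoc, hidem], ?_⟩
    have h1 : σ (ε * v) * u = ε := by
      conv_lhs => rw [← hσu, ← map_mul, hvu, hσε]
    calc σ (ε * v) = σ (ε * v) * (u * (ε * v)) := by rw [huv, ← hcent, hεσ]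
      _ = ε * v := by rw [← mul_assoc, h1, ← mul_assoc, hidem]
  -- the `p ^ m`-th power of `u` is a central fixed element
  let K := {c : B // (∀ b, c * b = b * c) ∧ σ c = c ∧ ε * c = c}
  have hpow : ∀ {c : B}, ((∀ b, c * b = b * c) ∧ σ c = c ∧ ε * c = c) →
      ((∀ b, c ^ p ^ m * b = b * c ^ p ^ m) ∧ σ (c ^ p ^ m) = c ^ p ^ m ∧
        ε * c ^ p ^ m = c ^ p ^ m) := by
    rintro c ⟨h1, h2, h3⟩
    refine ⟨fun b => (Commute.pow_left (show Commute c b from h1 b) _).eq, by rw [map_pow, h2], ?_⟩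
    obtain ⟨k, hk⟩ := Nat.exists_eq_succ_of_ne_zero
      (pow_ne_zero m (Fact.out : p.Prime).ne_zero)
    rw [hk, pow_succ', ← mul_assoc, h3]
  have hεpow : ∀ k, 0 < k → ε ^ k = ε := fun k hk =>
    (show IsIdempotentElem ε from hidem).pow_eq hk.ne'
  have hMpos : 0 < p ^ m := pow_pos (Fact.out : p.Prime).pos m
  -- By `hinv` every nonzero element of `K` is invertible, so `K` has no nonzero nilpotents and the
  -- `p ^ m`-th power map is injective; by finiteness it is onto. This provides a root `d` of the
  -- central element `u ^ p ^ m`.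
  let F : K → K := fun c => ⟨c.1 ^ p ^ m, hpow c.2⟩
  have : Nontrivial B := ⟨ε, 0, hne⟩
  have hcharB : CharP B p := charP_of_injective_algebraMap (algebraMap (ZMod p) B).injective p
  have hFinj : Function.Injective F := by
    intro c d hcd
    have h1 : c.1 ^ p ^ m = d.1 ^ p ^ m := congrArg Subtype.val hcd
    by_contra hne'
    have h2 : (c.1 - d.1) ^ p ^ m = 0 := by
      rw [sub_pow_char_pow_of_commute _ _ (c.2.1 d.1), h1, sub_self]
    have h3 : c.1 - d.1 ≠ 0 := fun h => hne' (Subtype.ext (sub_eq_zero.mp h))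
    have h4 : ∀ b, (c.1 - d.1) * b = b * (c.1 - d.1) := fun b => by
      rw [sub_mul, mul_sub, c.2.1, d.2.1]
    obtain ⟨z, hz, -⟩ := hinv (c.1 - d.1) (by rw [mul_sub, c.2.2.2, d.2.2.2]) h3
      (by rw [map_sub, c.2.2.1, d.2.2.1]) 1 (fun b => h4 b)
    have h5 : ε ^ p ^ m = 0 := by
      rw [← hz, Commute.mul_pow (h4 z), h2, zero_mul]
    rw [hεpow _ hMpos] at h5
    exact hne h5
  have huM : (∀ b, u ^ p ^ m * b = b * u ^ p ^ m) ∧ σ (u ^ p ^ m) = u ^ p ^ m ∧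
      ε * u ^ p ^ m = u ^ p ^ m := by
    refine ⟨fun b => ?_, by rw [map_pow, hσu], ?_⟩
    · have h1 : ∀ n : ℕ, ∀ b, u ^ n * b = ((σ ^ s) ^ n) b * u ^ n := fun n => by
        induction n with
        | zero => simp
        | succ n ih =>
          intro b
          rw [pow_succ, mul_assoc, hub, ← mul_assoc, ih, mul_assoc, pow_succ (σ ^ s)]
          rfl
      rw [h1, ← pow_mul, mul_comm s, pow_mul, hσ, one_pow]
      rfl
    · obtain ⟨k, hk⟩ := Nat.exists_eq_succ_of_ne_zero hMpos.ne'
      rw [hk, pow_succ', ← mul_assoc, hεu]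
  obtain ⟨d, hd⟩ := Finite.surjective_of_injective hFinj ⟨u ^ p ^ m, huM⟩
  have hd' : d.1 ^ p ^ m = u ^ p ^ m := congrArg Subtype.val hd
  obtain ⟨v, huv, hvu, hεv, hσv⟩ := hinv u hεu hu0 hσu (σ ^ s) hub
  have hd0 : d.1 ≠ 0 := by
    intro h0
    rw [h0, zero_pow hMpos.ne'] at hd'
    have h5 : ε ^ p ^ m = 0 := by
      rw [← huv, (show Commute u v from huv.trans hvu.symm).mul_pow, ← hd', zero_mul]
    rw [hεpow _ hMpos] at h5
    exact hne h5
  obtain ⟨z, hdz, hzd, hεz, hσz⟩ := hinv d.1 d.2.2.2 hd0 d.2.2.1 1 (fun b => d.2.1 b)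
  have hzc : ∀ b, z * b = b * z := fun b => by
    calc z * b = z * b * (d.1 * z) := by rw [hdz, ← hcent, ← mul_assoc, hεz]
      _ = z * (b * d.1) * z := by simp only [mul_assoc]
      _ = z * d.1 * b * z := by rw [← d.2.1]; simp only [mul_assoc]
      _ = b * z := by rw [hzd, hcent, mul_assoc, hεz]
  -- With `z` the inverse of `d`, the unit `u / d` still implements `σ ^ s`, and both it and its
  -- inverse `d * v` have `p ^ m`-th power `ε`.
  refine ⟨z * u, d.1 * v, ?_, ?_, ?_, ?_, ?_, ?_, fun b => ?_, ?_⟩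
  · rw [mul_assoc, ← mul_assoc u, ← d.2.1 u, mul_assoc, huv, ← mul_assoc, hzd, hidem]
  · rw [mul_assoc, ← mul_assoc v, ← hzc v, mul_assoc, hvu, ← mul_assoc, hdz, hidem]
  · rw [← mul_assoc, hεz]
  · rw [← mul_assoc, d.2.2.2]
  · rw [map_mul, hσz, hσu]
  · rw [map_mul, d.2.2.1, hσv]
  · rw [mul_assoc, hub, ← mul_assoc, hzc, mul_assoc]
  · rw [Commute.mul_pow (d.2.1 v), hd',
      ← (show Commute u v from huv.trans hvu.symm).mul_pow, huv, hεpow _ hMpos]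

end CrossedProduct

/-! ### Crossed products: the radical -/

section CrossedProduct

variable {p : ℕ} [Fact p.Prime] {A B : Type*} [Ring A] [CharP A p] [Ring B] [Finite B]
  [IsSemisimpleRing B] [Algebra (ZMod p) B]
  {ι : B →ₙ+* A} {σ : RingAut B} {γ : A} {m : ℕ}

/-- The `γ`-simple case of `exists_central_nilpotent_of_crossedProduct`. -/
lemma exists_central_nilpotent_of_simple (hι : Function.Injective ι)
    (hσ : σ ^ p ^ m = 1) (hγm : γ ^ p ^ m = 1) (hγ : ∀ b, γ * ι b = ι (σ b) * γ)
    (ha : ∀ x, ι 1 * x = x * ι 1)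
    (hA : ∀ x : A, ∃ c : ℕ → B, ι 1 * x = ∑ i ∈ Finset.range (p ^ m), ι (c i) * γ ^ i)
    {ε : B} (hσε : σ ε = ε) (hidem : ε * ε = ε) (hcent : ∀ b, ε * b = b * ε) (hne : ε ≠ 0)
    (hsimple : ∀ I : Ideal B, I.IsTwoSided → (∀ b ∈ I, σ b ∈ I) → (∀ b ∈ I, ε * b = b) →
      I = ⊥ ∨ ε ∈ I) :
    ∃ t : A, (∀ x, t * x = x * t) ∧ ι ε * t = t ∧ IsNilpotent t ∧
      ∀ I : Ideal A, I.IsTwoSided → (∀ x ∈ I, IsNilpotent x) → ∀ x ∈ I, ∃ y, ι ε * x = t * y := by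
  classical
  have hMpos : 0 < p ^ m := pow_pos (Fact.out : p.Prime).pos m
  have hex : ∃ s, 0 < s ∧ ∀ c, (∀ b, c * b = b * c) → (σ ^ s) (ε * c) = ε * c :=
    ⟨p ^ m, hMpos, fun c _ => by rw [hσ]; rfl⟩
  -- `s` is the order of `σ` on the centre of the block `ε B`: smaller powers are outer enough to be
  -- separated, while `σ ^ s` is inner.
  let s := Nat.find hex
  obtain ⟨hspos, hs⟩ : 0 < s ∧ ∀ c, (∀ b, c * b = b * c) → (σ ^ s) (ε * c) = ε * c :=
    Nat.find_spec hex
  have hsmin : ∀ l, 0 < l → l < s →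
      ∃ c, (∀ b, c * b = b * c) ∧ (σ ^ l) (ε * c) ≠ ε * c := fun l h0 hl => by
    have := Nat.find_min hex hl
    push Not at this
    exact this h0
  obtain ⟨u, v, huv, hvu, hεu, hεv, hσu, hσv, hub, hvM⟩ :=
    exists_fixed_implementing_unit hσ hσε hidem hcent hne hsimple hs
  have hγv : Commute (ι v) γ := by
    rw [Commute, SemiconjBy, hγ, hσv]
  have hγε : Commute (ι ε) γ := by
    rw [Commute, SemiconjBy, hγ, hσε]
  have hε1 : ∀ x, ι ε * (ι 1 * x) = ι ε * x := fun x => by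
    rw [← mul_assoc, ← map_mul, mul_one]
  have hγs : ∀ b, γ ^ s * ι b = ι ((σ ^ s) b) * γ ^ s := fun b => pow_mul_map hγ s b
  have hspan : ∀ z : A, (∀ b, z * ι b = ι b * z) → z * γ = γ * z → z * ι 1 = z →
      ∀ x, z * x = x * z := by
    intro z hzb hzγ hz1 x
    obtain ⟨c, hc⟩ := hA x
    calc z * x = z * (ι 1 * x) := by rw [← mul_assoc, hz1]
      _ = (ι 1 * x) * z := by
        rw [hc]
        refine (Commute.sum_right _ _ _ fun i _ => ?_).eq
        exact Commute.mul_right (hzb _) (Commute.pow_right hzγ i)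
      _ = x * z := by rw [ha x, mul_assoc, ha z, hz1]
  have hεc : ∀ x, ι ε * x = x * ι ε := hspan _
    (fun b => by rw [← map_mul, ← map_mul, hcent]) hγε.eq (by rw [← map_mul, mul_one])
  -- The inverse `v` of `u` undoes the action of `γ ^ s`, so `ι v * γ ^ s` centralises the block.
  -- Its `p ^ m`-th power is `ι ε`, hence in characteristic `p` the difference is nilpotent.
  set t : A := ι v * γ ^ s - ι ε with ht
  have htc : ∀ x, t * x = x * t := by
    refine hspan t (fun b => ?_) ?_ ?_
    · have h1 : v * (σ ^ s) b = ε * b * v := by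
        calc v * (σ ^ s) b = v * ((σ ^ s) b * (u * v)) := by
              rw [huv, ← hcent ((σ ^ s) b), ← mul_assoc, ← hcent v, hεv]
          _ = v * u * b * v := by rw [← mul_assoc ((σ ^ s) b), ← hub]; simp only [mul_assoc]
          _ = ε * b * v := by rw [hvu]
      rw [ht, sub_mul, mul_sub, mul_assoc, hγs, ← mul_assoc, ← map_mul, h1, ← mul_assoc (ι b),
        ← map_mul, ← map_mul, ← map_mul, hcent b, mul_assoc, hεv]
    · rw [ht, sub_mul, mul_sub, hγε.eq, mul_assoc, ← mul_assoc γ, ← hγv.eq, mul_assoc, pow_mul_comm']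
    · rw [ht, sub_mul, mul_assoc, ← ha, ← mul_assoc, ← map_mul, ← map_mul, mul_one, mul_one]
  have hεt : ι ε * t = t := by
    rw [ht, mul_sub, ← mul_assoc, ← map_mul, ← map_mul, hεv, hidem]
  have hιε : ∀ k, 0 < k → ι ε ^ k = ι ε := fun k hk =>
    (show IsIdempotentElem (ι ε) by rw [IsIdempotentElem, ← map_mul, hidem]).pow_eq hk.ne'
  have hιpow : ∀ k, 0 < k → ι v ^ k = ι (v ^ k) := fun k hk => by
    induction k, hk using Nat.le_induction with
    | base => simp
    | succ k _ ih => rw [pow_succ, ih, pow_succ, map_mul]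
  have htn : IsNilpotent t := by
    refine ⟨p ^ m, ?_⟩
    rw [ht, sub_pow_char_pow_of_commute _ _ (hεc _).symm, (hγv.pow_right s).mul_pow,
      ← pow_mul, mul_comm s, pow_mul, hγm, one_pow, mul_one, hιpow _ hMpos, hvM, hιε _ hMpos,
      sub_self]
  refine ⟨t, htc, hεt, htn, fun I hI hnil x hx => ?_⟩
  -- the ideal generated by `I` and `t`
  let I' : Ideal A := I ⊔ Ideal.span {t}
  have hI'2 : I'.IsTwoSided := ⟨fun {x} b hx => by
    obtain ⟨y, hy, z, hz, rfl⟩ := Submodule.mem_sup.mp hx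
    obtain ⟨w, rfl⟩ := Ideal.mem_span_singleton'.mp hz
    rw [add_mul, mul_assoc, htc, ← mul_assoc]
    exact Submodule.add_mem_sup (I.mul_mem_right _ hy)
      (Ideal.mul_mem_left _ _ (Ideal.mem_span_singleton_self t))⟩
  have htI' : ∀ y, t * y ∈ I' := fun y => by
    rw [htc]
    exact Submodule.mem_sup_right (Ideal.mul_mem_left _ _ (Ideal.mem_span_singleton_self t))
  -- An element of `I'` is the sum of a nilpotent element and a multiple of the central nilpotent
  -- `t`; for `ι ε` these summands commute, so the nonzero idempotent would be nilpotent.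
  have hεI' : ι ε ∉ I' := by
    intro h
    obtain ⟨y, hy, z, hz, hyz⟩ := Submodule.mem_sup.mp h
    obtain ⟨w, rfl⟩ := Ideal.mem_span_singleton'.mp hz
    have h1 : IsNilpotent (w * t) := Commute.isNilpotent_mul_left (htc w).symm htn
    have h2 : y = ι ε - w * t := eq_sub_of_add_eq hyz
    have h3 : Commute y (w * t) := by
      rw [h2]
      exact Commute.sub_left (hεc _) (Commute.refl _)
    obtain ⟨k, hk⟩ := Commute.isNilpotent_add h3 (hnil y hy) h1
    rw [hyz] at hk
    have hk' : ι ε ^ (k + 1) = 0 := by rw [pow_succ, hk, zero_mul]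
    rw [hιε _ k.succ_pos] at hk'
    exact hne (hι (by rw [hk', map_zero]))
  -- reduction modulo `t` to degree `< s`
  have hred : ∀ i b, ∃ c : ℕ → B, (∀ j, ε * c j = c j) ∧
      ∃ y, ι ε * (ι b * γ ^ i) = ∑ j ∈ Finset.range s, ι (c j) * γ ^ j + t * y := by
    intro i
    induction i using Nat.strong_induction_on with
    | _ i ih =>
      intro b
      rcases Nat.lt_or_ge i s with h | h
      · refine ⟨fun j => if j = i then ε * b else 0, fun j => ?_, 0, ?_⟩
        · by_cases hj : j = i <;> simp [hj, ← mul_assoc, hidem]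
        · rw [Finset.sum_eq_single i (fun j _ hj => by simp [hj])
            (fun hi => absurd (Finset.mem_range.mpr h) hi)]
          simp [mul_assoc]
      · obtain ⟨c, hc, y, hy⟩ := ih (i - s) (by omega) (b * u)
        refine ⟨c, hc, y + ι (b * u) * γ ^ (i - s), ?_⟩
        -- Multiplying the definition of `t` by `u` replaces `γ ^ s` by `u` modulo `t`, which lowers
        -- the degree by `s`.
        have h1 : ι ε * γ ^ s = ι u + t * ι u := by
          rw [htc, ht, mul_sub, ← mul_assoc, ← map_mul, huv, ← map_mul, ← hcent, hεu]
          abel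
        have h2 : ι ε * (ι b * γ ^ i) = ι ε * (ι (b * u) * γ ^ (i - s)) +
            t * (ι (b * u) * γ ^ (i - s)) := by
          have h3 : γ ^ i = γ ^ s * γ ^ (i - s) := by rw [← pow_add]; congr 1; omega
          calc ι ε * (ι b * γ ^ i) = ι b * (ι ε * γ ^ s) * γ ^ (i - s) := by
                rw [h3, ← mul_assoc, ← mul_assoc, hεc (ι b)]; simp only [mul_assoc]
            _ = ι (b * u) * γ ^ (i - s) + t * (ι (b * u) * γ ^ (i - s)) := by
                rw [h1, mul_add, add_mul, ← map_mul, ← mul_assoc (ι b), ← htc, mul_assoc t,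
                  ← map_mul, mul_assoc t]
            _ = _ := by
                rw [← mul_assoc (ι ε), ← map_mul, ← mul_assoc ε, hcent b, mul_assoc b, hεu]
        rw [h2, hy, mul_add]
        abel
  have hred' : ∀ x, ∃ c : ℕ → B, (∀ j, ε * c j = c j) ∧
      ∃ y, ι ε * x = ∑ j ∈ Finset.range s, ι (c j) * γ ^ j + t * y := by
    intro x
    obtain ⟨b, hb⟩ := hA x
    choose c hc y hy using fun i => hred i (b i)
    refine ⟨fun j => ∑ i ∈ Finset.range (p ^ m), c i j, fun j => ?_,
      ∑ i ∈ Finset.range (p ^ m), y i, ?_⟩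
    · rw [Finset.mul_sum]; exact Finset.sum_congr rfl fun i _ => hc i j
    · rw [← hε1, hb, Finset.mul_sum, Finset.sum_congr rfl fun i _ => hy i,
        Finset.sum_add_distrib, Finset.mul_sum, Finset.sum_comm]
      congr 1
      refine Finset.sum_congr rfl fun j _ => ?_
      rw [map_sum, Finset.sum_mul]
  obtain ⟨op, D, hop, hD, hD0, hDl⟩ :=
    exists_separating_operator hσε hidem hcent hsimple hγ hsmin (s - 1) (by omega)
  -- The constants in `I'` form a two-sided ideal below `ε`, stable under `σ` because `γ` is
  -- invertible. It does not contain `ε`, so it vanishes.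
  let I₀ : Ideal B :=
    { carrier := {b | ε * b = b ∧ ι b ∈ I'}
      zero_mem' := ⟨mul_zero _, by rw [map_zero]; exact I'.zero_mem⟩
      add_mem' := fun ⟨h1, h2⟩ ⟨h1', h2'⟩ =>
        ⟨by rw [mul_add, h1, h1'], by rw [map_add]; exact I'.add_mem h2 h2'⟩
      smul_mem' := fun c b ⟨h1, h2⟩ =>
        ⟨by rw [smul_eq_mul, ← mul_assoc, hcent, mul_assoc, h1],
          by rw [smul_eq_mul, map_mul]; exact I'.mul_mem_left _ h2⟩ }
  have hγinv : γ ^ (p ^ m - 1) * γ = 1 := by rw [← pow_succ, Nat.sub_add_cancel hMpos, hγm]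
  have hγinv' : γ * γ ^ (p ^ m - 1) = 1 := by rw [← pow_succ', Nat.sub_add_cancel hMpos, hγm]
  have hI₀ : I₀ = ⊥ := by
    refine (hsimple I₀ ⟨fun {x} b hx => ⟨?_, ?_⟩⟩ (fun b hb => ⟨?_, ?_⟩) fun b hb => hb.1).resolve_right
      (fun h => hεI' h.2)
    · rw [← mul_assoc, hx.1]
    · rw [map_mul]; exact I'.mul_mem_right _ hx.2
    · rw [show ε * σ b = σ ε * σ b by rw [hσε], ← map_mul, hb.1]
    · have h1 : ι (σ b) = γ * ι b * γ ^ (p ^ m - 1) := by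
        rw [hγ, mul_assoc, hγinv', mul_one]
      rw [h1]
      exact I'.mul_mem_right _ (I'.mul_mem_left _ hb.2)
  -- The separating operator isolates the constant coefficient, which then lies in `I₀ = ⊥`. What
  -- remains is divisible by the invertible element `γ`, and the degree drops.
  have hzero : ∀ n, n ≤ s → ∀ c : ℕ → B, (∀ j, ε * c j = c j) →
      ∑ j ∈ Finset.range n, ι (c j) * γ ^ j ∈ I' → ∑ j ∈ Finset.range n, ι (c j) * γ ^ j = 0 := by
    intro n
    induction n with
    | zero => intro _ c _ _; simp
    | succ n ih =>
      intro hn c hc hmem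
      have h1 := hop I' hI'2 _ hmem
      rw [map_sum, Finset.sum_range_succ', Finset.sum_eq_zero (fun j hj => by
        rw [hD, hDl (j + 1) (by omega) (by have := Finset.mem_range.mp hj; omega), zero_mul,
          map_zero, zero_mul]), zero_add, hD, hD0, hc, pow_zero, mul_one] at h1
      have h2 : c 0 ∈ I₀ := ⟨hc 0, h1⟩
      rw [hI₀, Submodule.mem_bot] at h2
      rw [Finset.sum_range_succ', h2, map_zero, zero_mul, add_zero] at hmem ⊢
      have h3 : ∑ j ∈ Finset.range n, ι (c (j + 1)) * γ ^ (j + 1) =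
          γ * ∑ j ∈ Finset.range n, ι (σ.symm (c (j + 1))) * γ ^ j := by
        rw [Finset.mul_sum]
        refine Finset.sum_congr rfl fun j _ => ?_
        rw [← mul_assoc, hγ, RingEquiv.apply_symm_apply, mul_assoc, pow_succ']
      rw [h3] at hmem ⊢
      rw [ih (by omega) (fun j => σ.symm (c (j + 1))) (fun j => ?_) ?_, mul_zero]
      · have := I'.mul_mem_left (γ ^ (p ^ m - 1)) hmem
        rwa [← mul_assoc, hγinv, one_mul] at this
      · apply σ.injective
        rw [map_mul, hσε, RingEquiv.apply_symm_apply, hc]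
  obtain ⟨c, hc, y, hy⟩ := hred' x
  refine ⟨y, ?_⟩
  rw [hy, hzero s le_rfl c hc, zero_add]
  have h1 : ∑ j ∈ Finset.range s, ι (c j) * γ ^ j = ι ε * x - t * y := by rw [hy]; abel
  rw [h1]
  exact I'.sub_mem (I'.mul_mem_left _ (Submodule.mem_sup_left hx)) (htI' y)

/-- Let `B` be a finite semisimple ring of characteristic `p` normalized by an element `γ` of
`p`-power order. Then the radical of the ring generated by `B` and `γ` is generated by a central
element. -/
theorem exists_central_nilpotent_of_crossedProduct (hι : Function.Injective ι)
    (hσ : σ ^ p ^ m = 1) (hγm : γ ^ p ^ m = 1) (hγ : ∀ b, γ * ι b = ι (σ b) * γ)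
    (ha : ∀ x, ι 1 * x = x * ι 1)
    (hA : ∀ x : A, ∃ c : ℕ → B, ι 1 * x = ∑ i ∈ Finset.range (p ^ m), ι (c i) * γ ^ i) :
    ∃ t : A, (∀ x, t * x = x * t) ∧ ι 1 * t = t ∧ IsNilpotent t ∧
      ∀ I : Ideal A, I.IsTwoSided → (∀ x ∈ I, IsNilpotent x) → ∀ x ∈ I, ∃ y, ι 1 * x = t * y := by
  -- Induction on the size of `B ε`: a proper nonzero `σ`-stable ideal gives a `σ`-fixed central
  -- idempotent `f`, and the elements found for `f` and `ε - f` are added.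
  have key : ∀ n : ℕ, ∀ ε : B, σ ε = ε → ε * ε = ε → (∀ b, ε * b = b * ε) →
      Nat.card (Ideal.span {ε}) ≤ n →
      ∃ t : A, (∀ x, t * x = x * t) ∧ ι ε * t = t ∧ IsNilpotent t ∧
      ∀ I : Ideal A, I.IsTwoSided → (∀ x ∈ I, IsNilpotent x) →
        ∀ x ∈ I, ∃ y, ι ε * x = t * y := by
    intro n
    induction n using Nat.strong_induction_on with
    | _ n ih =>
    intro ε hσε hidem hcent hn
    by_cases hne : ε = 0
    · exact ⟨0, by simp, by simp, IsNilpotent.zero, fun I _ _ x _ => ⟨0, by simp [hne]⟩⟩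
    by_cases hsimple : ∀ I : Ideal B, I.IsTwoSided → (∀ b ∈ I, σ b ∈ I) → (∀ b ∈ I, ε * b = b) →
      I = ⊥ ∨ ε ∈ I
    · exact exists_central_nilpotent_of_simple hι hσ hγm hγ ha hA hσε hidem hcent hne hsimple
    push Not at hsimple
    obtain ⟨I, hI, hσI, hεI, hI0, hεn⟩ := hsimple
    obtain ⟨f, hf, hfr, hfl, hfc⟩ := exists_central_idempotent_of_isTwoSided I
    have hεf : ε * f = f := hεI f hf
    have hff : f * f = f := hfr f hf
    have hσf : σ f = f := by
      -- `σ f` is again an identity element of `I`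
      have hcard : ∀ w ∈ I, ∃ w' ∈ I, σ w' = w := by
        have : Function.Injective (fun w : I => (⟨σ w.1, hσI _ w.2⟩ : I)) := fun a b h =>
          Subtype.ext (σ.injective (congrArg Subtype.val h))
        intro w hw
        obtain ⟨w', h⟩ := Finite.surjective_of_injective this ⟨w, hw⟩
        exact ⟨w'.1, w'.2, congrArg Subtype.val h⟩
      obtain ⟨w, hw, hwf⟩ := hcard f hf
      calc σ f = σ f * f := (hfr _ (hσI f hf)).symm
        _ = σ (f * w) := by rw [← hwf, ← map_mul]
        _ = f := by rw [hfl w hw, hwf]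
    have hfε : f * ε = f := by rw [hfc, hεf]
    have hlt : ∀ g h : B, g * ε = g → h * ε = h → g + h = ε → g * h = 0 → h ≠ 0 → 
        (∀ b, h * b = b * h) →
        Nat.card (Ideal.span {g}) < Nat.card (Ideal.span {ε}) := by
      intro g h hg hh hgh hgh0 hh0 hhc
      have hsub : (Ideal.span {g} : Set B) ⊂ Ideal.span {ε} := by
        refine ⟨?_, fun hsub => ?_⟩
        · refine (Ideal.span_singleton_le_iff_mem _).mpr ?_
          exact Ideal.mem_span_singleton'.mpr ⟨g, hg⟩
        · obtain ⟨a, ha⟩ := Ideal.mem_span_singleton'.mp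
            (hsub (Ideal.mem_span_singleton'.mpr ⟨h, hh⟩ : h ∈ Ideal.span {ε}))
          apply hh0
          have h1 : h * h = 0 := by
            calc h * h = a * g * h := by rw [ha]
              _ = 0 := by rw [mul_assoc, hgh0, mul_zero]
          have h2 : h * (g + h) = h := by rw [hgh, hh]
          rw [← h2, mul_add, h1, hhc, hgh0, add_zero]
      exact Set.ncard_lt_ncard hsub (Set.toFinite _)
    have hfne : f ≠ 0 := by
      rintro rfl
      refine hI0 (eq_bot_iff.mpr fun w hw => ?_)
      rw [Submodule.mem_bot, ← hfr w hw, mul_zero]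
    have hεfne : ε - f ≠ 0 := fun h => hεn (by rw [sub_eq_zero.mp h]; exact hf)
    have hgc : ∀ b, (ε - f) * b = b * (ε - f) := fun b => by rw [sub_mul, mul_sub, hcent, hfc]
    have hg0 : f * (ε - f) = 0 := by rw [mul_sub, hfε, hff, sub_self]
    have hgε : (ε - f) * ε = ε - f := by rw [sub_mul, hidem, hfε]
    obtain ⟨t₁, h1, h2, h3, h4⟩ := ih _ (lt_of_lt_of_le (hlt f (ε - f) hfε hgε (by abel) hg0
      hεfne hgc) hn) f hσf hff hfc le_rfl
    obtain ⟨t₂, h1', h2', h3', h4'⟩ := ih _ (lt_of_lt_of_le (hlt (ε - f) f hgε hfε (by abel)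
      (by rw [hgc, hg0]) hfne hfc) hn) (ε - f) (by rw [map_sub, hσε, hσf])
      (by rw [mul_sub, hgε, hgc, hg0, sub_zero]) hgc le_rfl
    have hf2 : ι f * t₂ = 0 := by rw [← h2', ← mul_assoc, ← map_mul, hg0, map_zero, zero_mul]
    have hg1 : ι (ε - f) * t₁ = 0 := by
      rw [← h2, ← mul_assoc, ← map_mul, hgc, hg0, map_zero, zero_mul]
    have hsum : ι ε = ι f + ι (ε - f) := by rw [← map_add]; congr 1; abel
    refine ⟨t₁ + t₂, fun x => by rw [add_mul, mul_add, h1, h1'], ?_,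
      Commute.isNilpotent_add (h1 t₂) h3 h3', fun J hJ hnil x hx => ?_⟩
    · rw [hsum, add_mul, mul_add, mul_add, h2, hf2, hg1, h2']
      abel
    · obtain ⟨y, hy⟩ := h4 J hJ hnil x hx
      obtain ⟨y', hy'⟩ := h4' J hJ hnil x hx
      refine ⟨ι f * y + ι (ε - f) * y', ?_⟩
      have e1 : t₁ * (ι f * y) = t₁ * y := by rw [← mul_assoc, h1, h2]
      have e2 : t₂ * (ι (ε - f) * y') = t₂ * y' := by rw [← mul_assoc, h1', h2']
      have e3 : t₁ * (ι (ε - f) * y') = 0 := by rw [← mul_assoc, h1, hg1, zero_mul]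
      have e4 : t₂ * (ι f * y) = 0 := by rw [← mul_assoc, h1', hf2, zero_mul]
      rw [add_mul, mul_add, mul_add, e1, e2, e3, e4, hsum, add_mul, hy, hy']
      abel
  exact key _ 1 (map_one σ) (one_mul 1) (fun b => by simp) le_rfl

end CrossedProduct

/-! ### Lifting along surjections with centrally generated kernel -/

section Lifting

/-- A surjection `π : X → Q` whose kernel is generated by finitely many central elements `z i`, is
contained in the radical, is separated in a strong sense, and along which complete families of
orthogonal idempotents can be lifted. -/
structure IsLiftable {X Q : Type*} [Ring X] [Ring Q] {r : ℕ} (π : X →+* Q) (z : Fin r → X) :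
    Prop where
  surjective : Function.Surjective π
  commute : ∀ i x, z i * x = x * z i
  ker : ∀ x, π x = 0 ↔ ∃ y : Fin r → X, x = ∑ i, z i * y i
  isUnit : ∀ x, π x = 1 → IsUnit x
  separated : ∀ E : AddSubgroup X,
    (∀ x ∈ E, ∃ y : Fin r → X, (∀ i, y i ∈ E) ∧ x = ∑ i, z i * y i) → E = ⊥
  lift : ∀ (I : Type) [Fintype I] (e : I → Q), CompleteOrthogonalIdempotents e →
    ∃ e' : I → X, CompleteOrthogonalIdempotents e' ∧ ∀ i, π (e' i) = e i

variable {X Q : Type*} [Ring X] [Ring Q] {r : ℕ} {π : X →+* Q} {z : Fin r → X}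

lemma IsLiftable.eq_zero_of_idempotent (h : IsLiftable π z) {g : X} (hg : g * g = g)
    (h0 : π g = 0) : g = 0 := by
  have h1 : IsUnit (1 - g) := h.isUnit _ (by rw [map_sub, h0, map_one, sub_zero])
  refine (h1.mul_right_eq_zero (b := g)).mp ?_
  rw [sub_mul, one_mul, hg, sub_self]

/-- Elements of a Peirce component in the kernel. -/
lemma IsLiftable.exists_of_corner (h : IsLiftable π z) {f f' x : X} (hx : x = f * x * f')
    (h0 : π x = 0) : ∃ y : Fin r → X, x = ∑ i, z i * (f * y i * f') := by
  obtain ⟨y, hy⟩ := (h.ker x).mp h0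
  refine ⟨y, ?_⟩
  conv_lhs => rw [hx, hy]
  rw [Finset.mul_sum, Finset.sum_mul]
  refine Finset.sum_congr rfl fun i _ => ?_
  rw [← mul_assoc, ← h.commute, mul_assoc, mul_assoc, mul_assoc]

/-- Central generators can be moved inside the Peirce component, so the component equals the sum of
its multiples by the `z i`, and separatedness annihilates it. -/
lemma IsLiftable.corner_eq_zero (h : IsLiftable π z) {f f' : X} (hf : f * f = f)
    (hf' : f' * f' = f') (h0 : ∀ x, π (f * x * f') = 0) (x : X) : f * x * f' = 0 := by
  have hE : ∀ x, f * (f * x * f') * f' = f * x * f' := fun x => by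
    rw [← mul_assoc, ← mul_assoc, hf, mul_assoc, hf']
  let E : AddSubgroup X :=
    { carrier := {w | ∃ x, w = f * x * f'}
      zero_mem' := ⟨0, by simp⟩
      add_mem' := by
        rintro _ _ ⟨x, rfl⟩ ⟨y, rfl⟩
        exact ⟨x + y, by rw [mul_add, add_mul]⟩
      neg_mem' := by
        rintro _ ⟨x, rfl⟩
        exact ⟨-x, by rw [mul_neg, neg_mul]⟩ }
  have : E = ⊥ := h.separated E (by
    rintro _ ⟨x, rfl⟩
    obtain ⟨y, hy⟩ := h.exists_of_corner (hE x).symm (h0 x)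
    exact ⟨_, fun i => ⟨y i, rfl⟩, hy⟩)
  have hx : f * x * f' ∈ E := ⟨x, rfl⟩
  rwa [this] at hx

/-- Corner rings with a commutative residue field generated by one element are commutative. -/
lemma IsLiftable.corner_commute (h : IsLiftable π z) {f θ : X} (hf : f * f = f)
    (hθ : ∀ x, f * x * f = x → π x = 0 ∨ ∃ n : ℕ, π x = π (f * (f * θ * f) ^ n))
    {x y : X} (hx : f * x * f = x) (hy : f * y * f = y) : x * y = y * x := by
  set τ := f * θ * f with hτ
  have hfτ : Commute f τ := by
    have e1 : f * τ = τ := by rw [hτ, mul_assoc f θ f, ← mul_assoc f f, hf]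
    have e2 : τ * f = τ := by rw [hτ, mul_assoc _ f f, hf]
    exact e1.trans e2.symm
  have hfx : ∀ x, f * (f * x * f) * f = f * x * f := fun x => by
    rw [← mul_assoc, ← mul_assoc, hf, mul_assoc, hf]
  have hα : ∀ x, f * x * f = x → ∃ α, f * α * f = α ∧ (α = 0 ∨ ∃ n : ℕ, α = f * τ ^ n) ∧
      ∃ y : Fin r → X, x = α + ∑ i, z i * (f * y i * f) := by
    intro x hx
    rcases hθ x hx with h0 | ⟨n, hn⟩
    · obtain ⟨y, hy⟩ := h.exists_of_corner hx.symm h0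
      exact ⟨0, by simp, Or.inl rfl, y, by rw [zero_add, ← hy]⟩
    · have h1 : f * (f * τ ^ n) * f = f * τ ^ n := by
        rw [← mul_assoc, hf, mul_assoc, ← (hfτ.pow_right n).eq, ← mul_assoc, hf]
      obtain ⟨y, hy⟩ := h.exists_of_corner (f := f) (f' := f) (x := x - f * τ ^ n)
        (by rw [mul_sub, sub_mul, hx, h1]) (by rw [map_sub, hn, sub_self])
      exact ⟨f * τ ^ n, h1, Or.inr ⟨n, rfl⟩, y, by rw [← hy]; abel⟩
  -- Modulo the kernel each corner element is zero or some `f * τ ^ n`, and such elements commute.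
  -- Expanding one variable at a time writes a commutator as a combination of the `z i` with
  -- commutators as coefficients, so `E` is zero by separatedness.
  let E : AddSubgroup X := AddSubgroup.closure
    {w | ∃ x y, f * x * f = x ∧ f * y * f = y ∧ w = x * y - y * x}
  have hE : E = ⊥ := h.separated E (by
    intro w hw
    induction hw using AddSubgroup.closure_induction with
    | mem w hw =>
      obtain ⟨x, y, hx, hy, rfl⟩ := hw
      obtain ⟨α, hα1, hα2, a, ha⟩ := hα x hx
      obtain ⟨β, hβ1, hβ2, b, hb⟩ := hα y hy
      have hαβ : α * β = β * α := by
        rcases hα2 with rfl | ⟨n, rfl⟩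
        · simp
        rcases hβ2 with rfl | ⟨k, rfl⟩
        · simp
        have c1 : Commute f (f * τ ^ k) := (Commute.refl f).mul_right (hfτ.pow_right k)
        have c2 : Commute (τ ^ n) (f * τ ^ k) :=
          (hfτ.symm.pow_left n).mul_right ((Commute.refl τ).pow_pow n k)
        exact (c1.mul_left c2).eq
      refine ⟨fun i => ((f * a i * f) * y - y * (f * a i * f)) +
        (α * (f * b i * f) - (f * b i * f) * α), fun i => E.add_mem ?_ ?_, ?_⟩
      · exact AddSubgroup.subset_closure ⟨_, _, hfx _, hy, rfl⟩
      · exact AddSubgroup.subset_closure ⟨_, _, hα1, hfx _, rfl⟩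
      · have e1 : x * y - y * x = (∑ i, z i * (f * a i * f)) * y - y * (∑ i, z i * (f * a i * f)) +
            (α * (∑ i, z i * (f * b i * f)) - (∑ i, z i * (f * b i * f)) * α) := by
          have e0 : α * y - y * α =
              α * (∑ i, z i * (f * b i * f)) - (∑ i, z i * (f * b i * f)) * α := by
            conv_lhs => rw [hb]
            rw [mul_add, add_mul, hαβ]
            abel
          rw [← e0]
          conv_lhs => rw [ha]
          rw [add_mul, mul_add]
          abel
        rw [e1, Finset.sum_mul, Finset.mul_sum, Finset.mul_sum, Finset.sum_mul,
          ← Finset.sum_sub_distrib, ← Finset.sum_sub_distrib, ← Finset.sum_add_distrib]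
        refine Finset.sum_congr rfl fun i _ => ?_
        rw [mul_add, mul_sub, mul_sub, mul_assoc (z i) _ y, ← mul_assoc y, ← h.commute i y,
          mul_assoc (z i) y, ← mul_assoc α, ← h.commute i α, mul_assoc (z i) α, mul_assoc (z i) _ α]
    | zero => exact ⟨0, fun i => E.zero_mem, by simp⟩
    | add w w' _ _ hw hw' =>
      obtain ⟨a, ha, rfl⟩ := hw
      obtain ⟨b, hb, rfl⟩ := hw'
      exact ⟨a + b, fun i => E.add_mem (ha i) (hb i), by
        simp only [Pi.add_apply, mul_add, Finset.sum_add_distrib]⟩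
    | neg w _ hw =>
      obtain ⟨a, ha, rfl⟩ := hw
      exact ⟨-a, fun i => E.neg_mem (ha i), by
        simp only [Pi.neg_apply, mul_neg, Finset.sum_neg_distrib]⟩)
  have hxy : x * y - y * x ∈ E := AddSubgroup.subset_closure ⟨x, y, hx, hy, rfl⟩
  rw [hE, AddSubgroup.mem_bot, sub_eq_zero] at hxy
  exact hxy

/-- Equivalence of idempotents lifts. -/
lemma IsLiftable.exists_equivalence (h : IsLiftable π z) {f g : X} (hf : f * f = f)
    (hg : g * g = g) {α β : Q} (hα : π f * α * π g = α) (hβ : π g * β * π f = β)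
    (hαβ : α * β = π f) (hβα : β * α = π g) :
    ∃ a b : X, f * a = a ∧ a * g = a ∧ g * b = b ∧ b * f = b ∧ a * b = f ∧ b * a = g := by
  obtain ⟨a₀, rfl⟩ := h.surjective α
  obtain ⟨b₀, rfl⟩ := h.surjective β
  obtain ⟨a', ha'⟩ : ∃ a', a' = f * a₀ * g := ⟨_, rfl⟩
  obtain ⟨b', hb'⟩ : ∃ b', b' = g * b₀ * f := ⟨_, rfl⟩
  have hπa : π a' = π a₀ := by rw [ha', map_mul, map_mul, hα]
  have hπb : π b' = π b₀ := by rw [hb', map_mul, map_mul, hβ]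
  have hfa : f * a' = a' := by rw [ha', ← mul_assoc, ← mul_assoc, hf]
  have hag : a' * g = a' := by rw [ha', mul_assoc, hg]
  have hgb : g * b' = b' := by rw [hb', ← mul_assoc, ← mul_assoc, hg]
  have hbf : b' * f = b' := by rw [hb', mul_assoc, hf]
  -- On the corner of `f` this unit is `a' * b'`, and it commutes with `f`; multiplying `a'` by its
  -- inverse makes the product exactly `f`.
  have hu : π (1 - f + a' * b') = 1 := by
    rw [map_add, map_sub, map_mul, hπa, hπb, hαβ, map_one]; abel
  obtain ⟨c, hc⟩ := h.isUnit _ hu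
  have hfc : Commute f (c : X) := by
    rw [hc]
    refine Commute.add_right ((Commute.one_right f).sub_right (Commute.refl f)) ?_
    rw [Commute, SemiconjBy, ← mul_assoc, hfa, mul_assoc, hbf]
  have hfc' : Commute f ((c⁻¹ : Xˣ) : X) := hfc.units_inv_right
  have hfab : f * c = a' * b' := by
    rw [hc, mul_add, mul_sub, mul_one, hf, sub_self, zero_add, ← mul_assoc, hfa]
  have hab : f * ((c⁻¹ : Xˣ) : X) * a' * b' = f := by
    rw [mul_assoc, ← hfab, mul_assoc, ← mul_assoc _ f, ← hfc'.eq, mul_assoc f, Units.inv_mul,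
      mul_one, hf]
  refine ⟨f * ((c⁻¹ : Xˣ) : X) * a', b', ?_, ?_, hgb, hbf, hab, ?_⟩
  · rw [← mul_assoc, ← mul_assoc, hf]
  · rw [mul_assoc, hag]
  · obtain ⟨a, ha⟩ : ∃ a, a = f * ((c⁻¹ : Xˣ) : X) * a' := ⟨_, rfl⟩
    rw [← ha] at hab ⊢
    have h1 : π ((c⁻¹ : Xˣ) : X) = 1 := by
      have := congrArg π c.mul_inv
      rw [map_mul, hc, hu, one_mul, map_one] at this
      exact this
    have h2 : π a = π a₀ := by
      rw [ha, map_mul, map_mul, h1, mul_one, ← map_mul, hfa, hπa]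
    have hba : (b' * a) * (b' * a) = b' * a := by
      rw [mul_assoc, ← mul_assoc a, hab, ha, ← mul_assoc f, ← mul_assoc f, hf]
    have hag' : a * g = a := by rw [ha, mul_assoc, hag]
    -- The reverse product is only known to be an idempotent below `g` congruent to it, and an
    -- idempotent in the kernel vanishes.
    have h3 : g - b' * a = 0 := by
      refine h.eq_zero_of_idempotent ?_ ?_
      · rw [sub_mul, mul_sub, mul_sub, hg, hba, ← mul_assoc, hgb, mul_assoc, hag']; abel
      · rw [map_sub, map_mul, h2, hπb, hβα, sub_self]
    exact (sub_eq_zero.mp h3).symm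

end Lifting

/-! ### Products of matrix rings from matrix units -/

section MatrixUnits

variable {X : Type u} [Ring X]

/-- A ring with several systems of matrix units is a product of matrix rings over corners. -/
noncomputable def ringEquivOfMatrixUnits {k : ℕ} {d : Fin k → ℕ} (o : ∀ l, Fin (d l))
    {f : (Σ l, Fin (d l)) → X} (hf : CompleteOrthogonalIdempotents f)
    (hort : ∀ l l' i j x, l ≠ l' → f ⟨l, i⟩ * x * f ⟨l', j⟩ = 0)
    (a b : (Σ l, Fin (d l)) → X)
    (hfa : ∀ l i, f ⟨l, o l⟩ * a ⟨l, i⟩ = a ⟨l, i⟩) (haf : ∀ l i, a ⟨l, i⟩ * f ⟨l, i⟩ = a ⟨l, i⟩)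
    (hfb : ∀ l i, f ⟨l, i⟩ * b ⟨l, i⟩ = b ⟨l, i⟩) (hbf : ∀ l i, b ⟨l, i⟩ * f ⟨l, o l⟩ = b ⟨l, i⟩)
    (hab : ∀ l i, a ⟨l, i⟩ * b ⟨l, i⟩ = f ⟨l, o l⟩) (hba : ∀ l i, b ⟨l, i⟩ * a ⟨l, i⟩ = f ⟨l, i⟩) :
    X ≃+* ∀ l, Matrix (Fin (d l)) (Fin (d l)) (hf.idem ⟨l, o l⟩).Corner where
  toFun x l i j := ⟨a ⟨l, i⟩ * x * b ⟨l, j⟩, a ⟨l, i⟩ * x * b ⟨l, j⟩, by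
    change f ⟨l, o l⟩ * (a ⟨l, i⟩ * x * b ⟨l, j⟩) * f ⟨l, o l⟩ = a ⟨l, i⟩ * x * b ⟨l, j⟩
    rw [← mul_assoc, ← mul_assoc, hfa, mul_assoc, hbf]⟩
  invFun M := ∑ l, ∑ i, ∑ j, b ⟨l, i⟩ * (M l i j).1 * a ⟨l, j⟩
  left_inv x := by
    have h1 : ∀ l, ∑ i, ∑ j, b ⟨l, i⟩ * (a ⟨l, i⟩ * x * b ⟨l, j⟩) * a ⟨l, j⟩ =
        ∑ i, f ⟨l, i⟩ * x * ∑ j, f ⟨l, j⟩ := fun l => by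
      refine Finset.sum_congr rfl fun i _ => ?_
      rw [Finset.mul_sum]
      refine Finset.sum_congr rfl fun j _ => ?_
      rw [← hba l i, ← hba l j]; simp only [mul_assoc]
    have h2 : ∀ l, ∀ i, f ⟨l, i⟩ * x * ∑ j, f ⟨l, j⟩ = f ⟨l, i⟩ * x := fun l i => by
      have h3 : f ⟨l, i⟩ * x * ∑ s, f s = f ⟨l, i⟩ * x := by rw [hf.complete, mul_one]
      refine Eq.trans ?_ h3
      rw [Fintype.sum_sigma, Finset.mul_sum Finset.univ (fun l => ∑ j, f ⟨l, j⟩)]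
      symm
      refine Finset.sum_eq_single l ?_ (by simp)
      · intro l' _ hl'
        rw [Finset.mul_sum]
        exact Finset.sum_eq_zero fun j _ => hort l l' i j x hl'.symm
    change ∑ l, ∑ i, ∑ j, b ⟨l, i⟩ * (a ⟨l, i⟩ * x * b ⟨l, j⟩) * a ⟨l, j⟩ = x
    simp only [h1, h2]
    have h4 := Fintype.sum_sigma (fun s => f s * x)
    rw [← h4, ← Finset.sum_mul, hf.complete, one_mul]
  right_inv M := by
    funext l i j
    apply Subtype.ext
    change a ⟨l, i⟩ * (∑ l', ∑ i', ∑ j', b ⟨l', i'⟩ * (M l' i' j').1 * a ⟨l', j'⟩) * b ⟨l, j⟩ =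
      (M l i j).1
    have hab0 : ∀ l l' i i', (⟨l, i⟩ : Σ l, Fin (d l)) ≠ ⟨l', i'⟩ → a ⟨l, i⟩ * b ⟨l', i'⟩ = 0 := by
      intro l l' i i' hne
      rw [← haf, ← hfb, mul_assoc, ← mul_assoc (f _), hf.ortho hne, zero_mul, mul_zero]
    have hM : f ⟨l, o l⟩ * (M l i j).1 * f ⟨l, o l⟩ = (M l i j).1 := by
      obtain ⟨y, hy⟩ := (M l i j).2
      change f ⟨l, o l⟩ * y * f ⟨l, o l⟩ = _ at hy
      rw [← hy, ← mul_assoc, ← mul_assoc, (hf.idem _).eq, mul_assoc, (hf.idem _).eq]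
    rw [Finset.mul_sum, Finset.sum_mul, Finset.sum_eq_single l, Finset.mul_sum, Finset.sum_mul,
      Finset.sum_eq_single i, Finset.mul_sum, Finset.sum_mul, Finset.sum_eq_single j]
    · rw [← mul_assoc, ← mul_assoc, hab, mul_assoc, hab, hM]
    · intro j' _ hj'
      rw [mul_assoc, mul_assoc, hab0 _ _ _ _ (by simpa using hj'), mul_zero, mul_zero]
    · simp
    · intro i' _ hi'
      rw [Finset.mul_sum, Finset.sum_mul]
      refine Finset.sum_eq_zero fun j' _ => ?_
      rw [← mul_assoc, ← mul_assoc, hab0 _ _ _ _ (by simpa using hi'.symm), zero_mul, zero_mul,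
        zero_mul]
    · simp
    · intro l' _ hl'
      rw [Finset.mul_sum, Finset.sum_mul]
      refine Finset.sum_eq_zero fun i' _ => ?_
      rw [Finset.mul_sum, Finset.sum_mul]
      refine Finset.sum_eq_zero fun j' _ => ?_
      rw [← mul_assoc, ← mul_assoc, hab0 _ _ _ _ (fun h => hl' (congrArg Sigma.fst h).symm),
        zero_mul, zero_mul, zero_mul]
    · simp
  map_add' x y := by
    funext l i j
    apply Subtype.ext
    change a ⟨l, i⟩ * (x + y) * b ⟨l, j⟩ = a ⟨l, i⟩ * x * b ⟨l, j⟩ + a ⟨l, i⟩ * y * b ⟨l, j⟩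
    rw [mul_add, add_mul]
  map_mul' x y := by
    funext l i j
    apply Subtype.ext
    have hcoe : ∀ (s : Finset (Fin (d l))) (g : Fin (d l) → (hf.idem ⟨l, o l⟩).Corner),
        (∑ m ∈ s, g m).1 = ∑ m ∈ s, (g m).1 := fun s g =>
      map_sum (NonUnitalRing.corner (f ⟨l, o l⟩)).subtype g s
    have hmul : ∀ M M' : ∀ l, Matrix (Fin (d l)) (Fin (d l)) (hf.idem ⟨l, o l⟩).Corner,
        ((M * M') l i j).1 = ∑ m, (M l i m).1 * (M' l m j).1 := fun M M' => by
      rw [Pi.mul_apply, Matrix.mul_apply]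
      exact hcoe _ _
    refine Eq.trans ?_ (hmul _ _).symm
    change a ⟨l, i⟩ * (x * y) * b ⟨l, j⟩ =
      ∑ m, (a ⟨l, i⟩ * x * b ⟨l, m⟩) * (a ⟨l, m⟩ * y * b ⟨l, j⟩)
    have h1 : ∀ m, (a ⟨l, i⟩ * x * b ⟨l, m⟩) * (a ⟨l, m⟩ * y * b ⟨l, j⟩) =
        (a ⟨l, i⟩ * x) * f ⟨l, m⟩ * (y * b ⟨l, j⟩) := fun m => by
      rw [← hba l m]; simp only [mul_assoc]
    simp only [h1]
    rw [← Finset.sum_mul, ← Finset.mul_sum]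
    have h2 : a ⟨l, i⟩ * x * ∑ m, f ⟨l, m⟩ = a ⟨l, i⟩ * x := by
      have h3 : a ⟨l, i⟩ * x * ∑ s, f s = a ⟨l, i⟩ * x := by rw [hf.complete, mul_one]
      refine Eq.trans ?_ h3
      rw [Fintype.sum_sigma, Finset.mul_sum Finset.univ (fun l => ∑ j, f ⟨l, j⟩)]
      symm
      refine Finset.sum_eq_single l ?_ (by simp)
      · intro l' _ hl'
        rw [Finset.mul_sum]
        refine Finset.sum_eq_zero fun j _ => ?_
        rw [← haf, mul_assoc, mul_assoc, ← mul_assoc (f _), hort l l' i j x hl'.symm, mul_zero]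
    rw [h2]; simp only [mul_assoc]

end MatrixUnits

/-! ### Lifting the Wedderburn decomposition -/

section Structure

variable {X : Type u} {Q : Type v} [Ring X] [Ring Q] {r : ℕ} {π : X →+* Q} {z : Fin r → X}

/-- Lifting the Wedderburn decomposition along a liftable surjection to a finite semisimple
ring. -/
theorem IsLiftable.exists_matrix_decomposition [Finite Q] [IsSemisimpleRing Q]
    (h : IsLiftable π z) :
    ∃ (k : ℕ) (n : Fin k → ℕ) (f : Fin k → X) (hf : ∀ l, IsIdempotentElem (f l)),
      (∀ l, 0 < n l) ∧ (∀ l, π (f l) ≠ 0) ∧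
      (∀ l x y, f l * x * f l = x → f l * y * f l = y → x * y = y * x) ∧
      (∀ l x, f l * x * f l = x → π x = 0 ∨ ∃ y, f l * y * f l = y ∧ x * y = f l) ∧
      Nonempty (X ≃+* ∀ l, Matrix (Fin (n l)) (Fin (n l)) (hf l).Corner) := by
  classical
  obtain ⟨k, F, d, _, hd, ⟨e⟩⟩ := IsSemisimpleRing.exists_ringEquiv_pi_matrix_divisionRing Q
  have hF : ∀ l, Finite (F l) := fun l => by
    have := hd l
    exact Finite.of_surjective (fun b => e b l 0 0)
      (fun x => ⟨e.symm (Pi.single l (Matrix.scalar _ x)), by simp⟩)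
  let E : ∀ l, Fin (d l) → Fin (d l) → F l → Q := fun l i j c =>
    e.symm (Pi.single l (Matrix.single i j c))
  have hEE : ∀ l i j m c c', E l i j c * E l j m c' = E l i m (c * c') := fun l i j m c c' => by
    simp only [E]
    rw [← map_mul, ← Pi.single_mul, Matrix.single_mul_single_same]
  have hE0 : ∀ l i j i' j' c c', j ≠ i' → E l i j c * E l i' j' c' = 0 :=
    fun l i j i' j' c c' hne => by
      simp only [E]
      rw [← map_mul, ← Pi.single_mul, Matrix.single_mul_single_of_ne _ _ _ _ hne]
      simp
  have hEl : ∀ l l' i j i' j' c c' x, l ≠ l' → E l i j c * x * E l' i' j' c' = 0 :=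
    fun l l' i j i' j' c c' x hne => by
      apply e.injective
      rw [map_mul, map_mul, e.apply_symm_apply, e.apply_symm_apply, map_zero]
      funext m
      rcases eq_or_ne m l with rfl | hm
      · simp [hne]
      · simp [hm]
  have hEx : ∀ l i j x, E l i i 1 * x * E l j j 1 = E l i j (e x l i j) := fun l i j x => by
    apply e.injective
    simp only [E]
    rw [map_mul, map_mul, e.apply_symm_apply, e.apply_symm_apply, e.apply_symm_apply]
    funext m
    rcases eq_or_ne m l with rfl | hm
    · simp only [Pi.mul_apply, Pi.single_eq_same]
      rw [Matrix.single_mul_mul_single]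
      simp
    · simp [hm]
  have hEinj : ∀ l i j c, E l i j c = 0 → c = 0 := fun l i j c hc => by
    have := congrFun (congrFun (congrFun (congrArg e hc) l) i) j
    simpa [E] using this
  have hE1 : CompleteOrthogonalIdempotents (fun s : Σ l, Fin (d l) => E s.1 s.2 s.2 1) := by
    refine ⟨⟨fun s => ?_, fun s s' hne => ?_⟩, ?_⟩
    · rw [IsIdempotentElem, hEE, mul_one]
    · obtain ⟨l, i⟩ := s
      obtain ⟨l', i'⟩ := s'
      rcases eq_or_ne l l' with rfl | hl
      · exact hE0 _ _ _ _ _ _ _ (fun hi => hne (congrArg (Sigma.mk l) hi))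
      · have := hEl l l' i i i' i' 1 1 1 hl
        rwa [mul_one] at this
    · apply e.injective
      rw [map_sum, map_one, Fintype.sum_sigma]
      funext l
      simp only [E, RingEquiv.apply_symm_apply]
      rw [Finset.sum_apply, Finset.sum_eq_single l]
      · rw [Finset.sum_apply]
        simp only [Pi.single_eq_same]
        rw [Matrix.sum_single_one]
        rfl
      · intro l' _ hl'
        rw [Finset.sum_apply]
        exact Finset.sum_eq_zero fun i _ => Pi.single_eq_of_ne hl'.symm _
      · simp
  obtain ⟨f, hf, hπf⟩ := h.lift _ _ hE1
  let o : ∀ l, Fin (d l) := fun l => 0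
  have hπ : ∀ l i, π (f ⟨l, i⟩) = E l i i 1 := fun l i => hπf ⟨l, i⟩
  have hff : ∀ s, f s * f s = f s := fun s => (hf.idem s).eq
  -- Orthogonality between different blocks must hold for the whole Peirce component, not just for
  -- the idempotents; the component maps to zero in `Q`, hence is zero.
  have hort : ∀ l l' i j x, l ≠ l' → f ⟨l, i⟩ * x * f ⟨l', j⟩ = 0 := fun l l' i j x hne =>
    h.corner_eq_zero (hff _) (hff _) (fun x => by
      rw [map_mul, map_mul, hπ, hπ, hEl _ _ _ _ _ _ _ _ _ hne]) x
  have heq : ∀ s : Σ l, Fin (d l), ∃ a b : X, f ⟨s.1, o s.1⟩ * a = a ∧ a * f s = a ∧ f s * b = b ∧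
      b * f ⟨s.1, o s.1⟩ = b ∧ a * b = f ⟨s.1, o s.1⟩ ∧ b * a = f s := fun ⟨l, i⟩ => by
    refine h.exists_equivalence (hff _) (hff _) (α := E l (o l) i 1) (β := E l i (o l) 1) ?_ ?_ ?_ ?_
    all_goals simp only [hπ, hEE, mul_one]
  choose a b h1 h2 h3 h4 h5 h6 using heq
  have hres : ∀ l x, f ⟨l, o l⟩ * x * f ⟨l, o l⟩ = x → ∃ c, π x = E l (o l) (o l) c :=
    fun l x hx => ⟨_, by rw [← hEx l (o l) (o l) (π x), ← hπ, ← map_mul, ← map_mul, hx]⟩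
  have hcomm : ∀ l x y, f ⟨l, o l⟩ * x * f ⟨l, o l⟩ = x → f ⟨l, o l⟩ * y * f ⟨l, o l⟩ = y →
      x * y = y * x := by
    intro l x y hx hy
    let : Field (F l) := littleWedderburn (F l)
    -- The residue ring of the corner is a finite field with cyclic unit group, so the powers of one
    -- lifted generator represent all nonzero residues, as `corner_commute` requires.
    obtain ⟨θ₀, hθ₀⟩ := IsCyclic.exists_generator (α := (F l)ˣ)
    obtain ⟨θ, hθ⟩ := h.surjective (E l (o l) (o l) (θ₀ : F l))
    refine h.corner_commute (hff ⟨l, o l⟩) (θ := θ) (fun x hx => ?_) hx hy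
    obtain ⟨c, hc⟩ := hres l x hx
    by_cases hc0 : c = 0
    · left; rw [hc, hc0]; simp [E]
    right
    obtain ⟨n, hn⟩ := (mem_powers_iff_mem_zpowers (x := θ₀)).mpr (hθ₀ (Units.mk0 c hc0))
    have hn' : (θ₀ : F l) ^ n = c := by
      have := congrArg Units.val hn
      simpa using this
    refine ⟨n, ?_⟩
    have hpow : ∀ n : ℕ, E l (o l) (o l) 1 * E l (o l) (o l) (θ₀ : F l) ^ n =
        E l (o l) (o l) ((θ₀ : F l) ^ n) := fun n => by
      induction n with
      | zero => rw [pow_zero, pow_zero, mul_one]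
      | succ n ih => rw [pow_succ, ← mul_assoc, ih, hEE, pow_succ]
    rw [map_mul, map_pow, map_mul, map_mul, hπ, hθ, hEE, one_mul, hEE, mul_one, hpow, hn', hc]
  refine ⟨k, d, fun l => f ⟨l, o l⟩, fun l => hf.idem _, fun l => (hd l).pos, fun l h0 => ?_,
    hcomm, fun l x hx => ?_,
    ⟨ringEquivOfMatrixUnits o hf hort a b (fun l i => h1 ⟨l, i⟩) (fun l i => h2 ⟨l, i⟩)
      (fun l i => h3 ⟨l, i⟩) (fun l i => h4 ⟨l, i⟩) (fun l i => h5 ⟨l, i⟩) (fun l i => h6 ⟨l, i⟩)⟩⟩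
  · rw [hπ] at h0
    exact one_ne_zero (hEinj _ _ _ _ h0)
  · by_cases h0 : π x = 0
    · exact Or.inl h0
    right
    obtain ⟨c, hc⟩ := hres l x hx
    have hc0 : c ≠ 0 := by
      rintro rfl
      exact h0 (by rw [hc]; simp [E])
    obtain ⟨w, hw⟩ := h.surjective (E l (o l) (o l) c⁻¹)
    set g := f ⟨l, o l⟩ with hg
    have hgg : g * g = g := hff _
    have hgw : g * (g * w * g) * g = g * w * g := by
      rw [← mul_assoc, ← mul_assoc, hgg, mul_assoc, hgg]
    -- A lift of the residual inverse is an inverse up to the kernel; adding `1 - g` turns it into a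
    -- genuine unit of the whole ring.
    have hu : π (1 - g + x * (g * w * g)) = 1 := by
      rw [map_add, map_sub, map_mul, map_mul, map_mul, hg, hπ, hw, hc, hEE, hEE, hEE, map_one,
        mul_one, one_mul, mul_inv_cancel₀ hc0]
      abel
    obtain ⟨u, hu⟩ := h.isUnit _ hu
    have hgx : g * x = x := by rw [← hx, ← mul_assoc, ← mul_assoc, hgg]
    refine ⟨g * w * g * (u⁻¹ : Xˣ) * g, ?_, ?_⟩
    · simp only [← mul_assoc]
      rw [mul_assoc _ g g, hgg]
    · have e1 : g * u = x * (g * w * g) := by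
        rw [hu, mul_add, mul_sub, mul_one, hgg, sub_self, zero_add, ← mul_assoc, hgx]
      calc x * (g * w * g * (u⁻¹ : Xˣ) * g) = (x * (g * w * g)) * (u⁻¹ : Xˣ) * g := by
            simp only [mul_assoc]
        _ = g := by rw [← e1, mul_assoc g, Units.mul_inv, mul_one, hgg]

end Structure

/-! ### Liftability in compact rings -/

section Compact

/-- A separated directed family of closed two-sided ideals in a compact ring. -/
structure IsFundamental {Λ J : Type*} [Ring Λ] [TopologicalSpace Λ] (𝔞 : J → Ideal Λ) : Prop where
  isTwoSided : ∀ j, (𝔞 j).IsTwoSided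
  isClosed : ∀ j, IsClosed (𝔞 j : Set Λ)
  directed : Directed (· ≥ ·) 𝔞
  separated : ∀ x, (∀ j, x ∈ 𝔞 j) → x = 0

variable {Λ J : Type*} [Ring Λ] [TopologicalSpace Λ] [IsTopologicalRing Λ] [CompactSpace Λ]
  [T2Space Λ] [Nonempty J] {𝔞 : J → Ideal Λ}

/-- Membership in a finitely generated right ideal can be checked modulo each `𝔞 j`. -/
lemma IsFundamental.exists_eq_sum (h𝔞 : IsFundamental 𝔞) {ι : Type*} [Fintype ι] (z : ι → Λ)
    (x : Λ) (hx : ∀ j, ∃ y : ι → Λ, x - ∑ i, z i * y i ∈ 𝔞 j) : ∃ y : ι → Λ, x = ∑ i, z i * y i := by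
  have hcont : Continuous fun y : ι → Λ => x - ∑ i, z i * y i := by fun_prop
  have hcl : ∀ j, IsClosed {y : ι → Λ | x - ∑ i, z i * y i ∈ 𝔞 j} := fun j =>
    (h𝔞.isClosed j).preimage hcont
  -- The solution sets modulo the `𝔞 j` are nonempty compact and directed, so they have a common
  -- point.
  obtain ⟨y, hy⟩ := IsCompact.nonempty_iInter_of_directed_nonempty_isCompact_isClosed
    (fun j => {y : ι → Λ | x - ∑ i, z i * y i ∈ 𝔞 j})
    (fun j k => by
      obtain ⟨l, hl, hl'⟩ := h𝔞.directed j k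
      exact ⟨l, fun y hy => hl hy, fun y hy => hl' hy⟩)
    hx (fun j => (hcl j).isCompact) hcl
  refine ⟨y, sub_eq_zero.mp (h𝔞.separated _ fun j => ?_)⟩
  exact Set.mem_iInter.mp hy j

variable {r : ℕ} {z : Fin r → Λ}

/-- Powers of the ideal generated by the topologically nilpotent central elements `z i`. -/
lemma IsFundamental.exists_pow_le (h𝔞 : IsFundamental 𝔞) (zc : Fin r → Subring.center Λ)
    (hz : ∀ i j, ∃ s : ℕ, (zc i : Λ) ^ s ∈ 𝔞 j) (j : J) :
    ∃ s : ℕ, ∀ c ∈ Ideal.span (Set.range zc) ^ s, (c : Λ) ∈ 𝔞 j := by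
  have := h𝔞.isTwoSided j
  have hle : Ideal.span (Set.range zc) ≤ ((𝔞 j).comap (Subring.center Λ).subtype).radical := by
    rw [Ideal.span_le]
    rintro _ ⟨i, rfl⟩
    obtain ⟨s, hs⟩ := hz i j
    exact ⟨s, by rw [Ideal.mem_comap, map_pow]; exact hs⟩
  obtain ⟨s, hs⟩ := Ideal.exists_pow_le_of_le_radical_of_fg hle
    (Submodule.fg_span (Set.finite_range zc))
  exact ⟨s, fun c hc => hs hc⟩

lemma sum_mul_mem_smul_top (zc : Fin r → Subring.center Λ) (M : Submodule (Subring.center Λ) Λ)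
    (y : Fin r → Λ) (hy : ∀ i, y i ∈ M) :
    ∑ i, (zc i : Λ) * y i ∈ Ideal.span (Set.range zc) • M :=
  Submodule.sum_mem _ fun i _ =>
    Submodule.smul_mem_smul (Ideal.subset_span ⟨i, rfl⟩) (hy i)

lemma sum_mul_pow_mem (zc : Fin r → Subring.center Λ) (y : Fin r → Λ) (s : ℕ) :
    (∑ i, (zc i : Λ) * y i) ^ s ∈
      Ideal.span (Set.range zc) ^ s • (⊤ : Submodule (Subring.center Λ) Λ) := by
  induction s with
  | zero => rw [pow_zero, Ideal.one_eq_top, Submodule.top_smul]; trivial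
  | succ s ih =>
    set w := ∑ i, (zc i : Λ) * y i with hw
    rw [pow_succ' w, pow_succ' (Ideal.span _), mul_smul, hw, Finset.sum_mul]
    simp only [mul_assoc]
    rw [← hw]
    refine sum_mul_mem_smul_top zc _ _ fun i => ?_
    refine Submodule.smul_induction_on ih (fun c hc x _ => ?_) fun x x' hx hx' => ?_
    · have : y i * (c • x) = c • (y i * x) := by
        change y i * ((c : Λ) * x) = c * (y i * x)
        rw [← mul_assoc, ← mul_assoc, Subring.mem_center_iff.mp c.2]
      rw [this]
      exact Submodule.smul_mem_smul hc trivial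
    · rw [mul_add]
      exact add_mem hx hx'

lemma IsFundamental.smul_le (h𝔞 : IsFundamental 𝔞) {j : J} {I : Ideal (Subring.center Λ)}
    (hI : ∀ c ∈ I, (c : Λ) ∈ 𝔞 j) (M : Submodule (Subring.center Λ) Λ) {x : Λ} (hx : x ∈ I • M) :
    x ∈ 𝔞 j := by
  have := h𝔞.isTwoSided j
  refine Submodule.smul_induction_on hx (fun c hc x _ => ?_) fun x x' hx hx' => add_mem hx hx'
  exact Ideal.mul_mem_right _ _ (hI c hc)

/-- A surjection from a compact ring whose kernel is generated by topologically nilpotent central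
elements is liftable. -/
theorem IsFundamental.isLiftable (h𝔞 : IsFundamental 𝔞) (hcomm : ∀ i x, z i * x = x * z i)
    (hz : ∀ i j, ∃ s : ℕ, z i ^ s ∈ 𝔞 j) {Q : Type*} [Ring Q] {π : Λ →+* Q}
    (hπ : Function.Surjective π) (hker : ∀ x, π x = 0 ↔ ∃ y : Fin r → Λ, x = ∑ i, z i * y i) :
    IsLiftable π z := by
  let zc : Fin r → Subring.center Λ := fun i =>
    ⟨z i, Subring.mem_center_iff.mpr fun x => (hcomm i x).symm⟩
  have hpow := h𝔞.exists_pow_le zc hz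
  have hnil : ∀ x, π x = 0 → ∀ j, ∃ s : ℕ, x ^ s ∈ 𝔞 j := fun x hx j => by
    obtain ⟨y, rfl⟩ := (hker x).mp hx
    obtain ⟨s, hs⟩ := hpow j
    exact ⟨s, h𝔞.smul_le hs _ (sum_mul_pow_mem zc y s)⟩
  have hinv : ∀ x, π x = 1 → ∃ y, x * y = 1 := fun x hx => by
    obtain ⟨y, hy⟩ := h𝔞.exists_eq_sum (fun _ : Unit => x) 1 fun j => by
      obtain ⟨s, hs⟩ := hnil (1 - x) (by rw [map_sub, hx, map_one, sub_self]) j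
      refine ⟨fun _ => ∑ i ∈ Finset.range s, (1 - x) ^ i, ?_⟩
      have := mul_neg_geom_sum (1 - x) s
      rw [sub_sub_cancel] at this
      rw [Fintype.sum_unique, this, sub_sub_cancel]
      exact hs
    exact ⟨y (), by rw [hy, Fintype.sum_unique]⟩
  refine ⟨hπ, hcomm, hker, fun x hx => ?_, fun E hE => ?_, fun I _ e he => ?_⟩
  · obtain ⟨y, hy⟩ := hinv x hx
    obtain ⟨w, hw⟩ := hinv y (by
      have := congrArg π hy
      rwa [map_mul, hx, one_mul, map_one] at this)
    have : w = x := by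
      calc w = (x * y) * w := by rw [hy, one_mul]
        _ = x := by rw [mul_assoc, hw, mul_one]
    exact ⟨⟨x, y, hy, this ▸ hw⟩, rfl⟩
  -- Over the centre, `E` spans a module `M` contained in `𝔷 • M`, where `𝔷` is the ideal of the `z
  -- i`. Iterating, `M ≤ 𝔷 ^ s • M` for all `s`, and powers of `𝔷` enter each `𝔞 j`.
  · let M := Submodule.span (Subring.center Λ) (E : Set Λ)
    have hM : M ≤ Ideal.span (Set.range zc) • M := Submodule.span_le.mpr fun x hx => by
      obtain ⟨y, hy, rfl⟩ := hE x hx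
      exact sum_mul_mem_smul_top zc M y fun i => Submodule.subset_span (hy i)
    have hMs : ∀ s, M ≤ Ideal.span (Set.range zc) ^ s • M := fun s => by
      induction s with
      | zero => rw [pow_zero, Ideal.one_eq_top, Submodule.top_smul]
      | succ s ih =>
        rw [pow_succ', mul_smul]
        exact hM.trans (Submodule.smul_mono le_rfl ih)
    refine (AddSubgroup.eq_bot_iff_forall _).mpr fun x hx => h𝔞.separated x fun j => ?_
    obtain ⟨s, hs⟩ := hpow j
    exact h𝔞.smul_le hs M (hMs s (Submodule.subset_span hx))
  · classical
    choose c hc using fun i => hπ (e i)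
    let K : J → Ideal Λ := fun j => 𝔞 j ⊔ RingHom.ker π
    -- Families that are complete orthogonal idempotents modulo `𝔞 j` and lift `e` modulo `𝔞 j` and
    -- the kernel. These sets are closed and nonempty, and a common point is an exact lift.
    let C : J → Set (I → Λ) := fun j => {w | (∀ i, w i * w i - w i ∈ 𝔞 j) ∧
      (∀ i i', i ≠ i' → w i * w i' ∈ 𝔞 j) ∧ ∑ i, w i - 1 ∈ 𝔞 j ∧
      ∃ y : I → Fin r → Λ, ∀ i, w i - c i - ∑ k, z k * y i k ∈ 𝔞 j}
    have hCcl : ∀ j, IsClosed (C j) := fun j => by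
      have hcl := h𝔞.isClosed j
      have h4 : IsClosed {w : I → Λ | ∃ y : I → Fin r → Λ, ∀ i,
          w i - c i - ∑ k, z k * y i k ∈ 𝔞 j} := by
        have : {w : I → Λ | ∃ y : I → Fin r → Λ, ∀ i, w i - c i - ∑ k, z k * y i k ∈ 𝔞 j} =
            Prod.fst '' {q : (I → Λ) × (I → Fin r → Λ) | ∀ i,
              q.1 i - c i - ∑ k, z k * q.2 i k ∈ 𝔞 j} := by
          ext w; simp
        rw [this]
        refine IsCompact.isClosed (IsCompact.image (IsClosed.isCompact ?_) continuous_fst)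
        rw [Set.ofPred_forall]
        refine isClosed_iInter fun i => hcl.preimage ?_
        fun_prop
      have h1 : IsClosed {w : I → Λ | ∀ i, w i * w i - w i ∈ 𝔞 j} := by
        rw [Set.ofPred_forall]
        exact isClosed_iInter fun i => hcl.preimage (f := fun w : I → Λ => w i * w i - w i)
          (by fun_prop)
      have h2 : IsClosed {w : I → Λ | ∀ i i', i ≠ i' → w i * w i' ∈ 𝔞 j} := by
        simp only [Set.ofPred_forall]
        exact isClosed_iInter fun i => isClosed_iInter fun i' => isClosed_iInter fun _ =>
          hcl.preimage (f := fun w : I → Λ => w i * w i') (by fun_prop)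
      have h3 : IsClosed {w : I → Λ | ∑ i, w i - 1 ∈ 𝔞 j} :=
        hcl.preimage (f := fun w : I → Λ => ∑ i, w i - 1) (by fun_prop)
      exact h1.inter (h2.inter (h3.inter h4))
    have hCne : ∀ j, (C j).Nonempty := fun j => by
      have h2 := h𝔞.isTwoSided j
      have h3 : (K j).IsTwoSided := ⟨fun {a} b ha => by
        obtain ⟨y, hy, y', hy', rfl⟩ := Submodule.mem_sup.mp ha
        rw [add_mul]
        exact add_mem (Ideal.mem_sup_left (Ideal.mul_mem_right _ _ hy))
          (Ideal.mem_sup_right (Ideal.mul_mem_right _ _ hy'))⟩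
      have hfac : 𝔞 j ≤ K j := le_sup_left
      have hmem : ∀ x, π x = 0 → x ∈ K j := fun x hx => Ideal.mem_sup_right hx
      have hcK : CompleteOrthogonalIdempotents fun i => Ideal.Quotient.mk (K j) (c i) := by
        refine ⟨⟨fun i => ?_, fun i i' hii => ?_⟩, ?_⟩
        · change Ideal.Quotient.mk (K j) (c i) * Ideal.Quotient.mk (K j) (c i) = _
          rw [← map_mul, Ideal.Quotient.eq]
          exact hmem _ (by rw [map_sub, map_mul, hc, (he.idem i).eq, sub_self])
        · change Ideal.Quotient.mk (K j) (c i) * Ideal.Quotient.mk (K j) (c i') = _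
          rw [← map_mul, Ideal.Quotient.eq_zero_iff_mem]
          exact hmem _ (by rw [map_mul, hc, hc, he.ortho hii])
        · rw [← map_sum, ← map_one (Ideal.Quotient.mk (K j)), Ideal.Quotient.eq]
          refine hmem _ ?_
          rw [map_sub, map_sum, map_one]
          simp only [hc]
          rw [he.complete, sub_self]
      -- Modulo `𝔞 j` the kernel of `π` is nil, so classical idempotent lifting applies.
      obtain ⟨e', he', hee'⟩ := CompleteOrthogonalIdempotents.lift_of_isNilpotent_ker
        (Ideal.Quotient.factor hfac) (fun x hx => by
          obtain ⟨x, rfl⟩ := Ideal.Quotient.mk_surjective x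
          rw [RingHom.mem_ker, Ideal.Quotient.factor_mk, Ideal.Quotient.eq_zero_iff_mem] at hx
          obtain ⟨y, hy, y', hy', rfl⟩ := Submodule.mem_sup.mp hx
          obtain ⟨s, hs⟩ := hnil y' hy' j
          refine ⟨s, ?_⟩
          rw [map_add, Ideal.Quotient.eq_zero_iff_mem.mpr hy, zero_add, ← map_pow,
            Ideal.Quotient.eq_zero_iff_mem.mpr hs])
        hcK (fun i => ⟨Ideal.Quotient.mk _ (c i), rfl⟩)
      · choose w hw using fun i => Ideal.Quotient.mk_surjective (e' i)
        have hker' : ∀ i, ∃ y : Fin r → Λ, w i - c i - ∑ k, z k * y k ∈ 𝔞 j := fun i => by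
          have h5 := congrFun hee' i
          rw [Function.comp_apply, ← hw, Ideal.Quotient.factor_mk, Ideal.Quotient.eq] at h5
          obtain ⟨y, hy, y', hy', h6⟩ := Submodule.mem_sup.mp h5
          obtain ⟨b, rfl⟩ := (hker y').mp hy'
          exact ⟨b, by rw [← h6, add_sub_cancel_right]; exact hy⟩
        choose b hb using hker'
        refine ⟨w, fun i => ?_, fun i i' hii => ?_, ?_, b, hb⟩
        · rw [← Ideal.Quotient.eq, map_mul, hw, (he'.idem i).eq]
        · rw [← Ideal.Quotient.eq_zero_iff_mem, map_mul, hw, hw, he'.ortho hii]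
        · rw [← Ideal.Quotient.eq, map_sum, map_one]
          simp only [hw]
          exact he'.complete
    obtain ⟨w, hw⟩ := IsCompact.nonempty_iInter_of_directed_nonempty_isCompact_isClosed C
      (fun j k => by
        obtain ⟨l, hl, hl'⟩ := h𝔞.directed j k
        exact ⟨l, fun y hy => ⟨fun i => hl (hy.1 i), fun i i' h => hl (hy.2.1 i i' h), hl hy.2.2.1,
          hy.2.2.2.imp fun _ h i => hl (h i)⟩, fun y hy => ⟨fun i => hl' (hy.1 i),
          fun i i' h => hl' (hy.2.1 i i' h), hl' hy.2.2.1, hy.2.2.2.imp fun _ h i => hl' (h i)⟩⟩)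
      hCne (fun j => (hCcl j).isCompact) hCcl
    rw [Set.mem_iInter] at hw
    refine ⟨w, ⟨⟨fun i => ?_, fun i i' hii => ?_⟩, ?_⟩, fun i => ?_⟩
    · exact sub_eq_zero.mp (h𝔞.separated _ fun j => (hw j).1 i)
    · exact h𝔞.separated _ fun j => (hw j).2.1 i i' hii
    · exact sub_eq_zero.mp (h𝔞.separated _ fun j => (hw j).2.2.1)
    · obtain ⟨y, hy⟩ := h𝔞.exists_eq_sum z (w i - c i) fun j => by
        obtain ⟨y, hy⟩ := (hw j).2.2.2
        exact ⟨y i, hy i⟩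
      rw [← hc, ← sub_eq_zero, ← map_sub]
      exact (hker _).mpr ⟨y, hy⟩

end Compact

/-! ### Passing to the complement of a central idempotent -/

section Complement

variable {Λ X Q Q' : Type*} [Ring Λ] [Ring X] [Ring Q] [Ring Q'] {r : ℕ} {z : Fin r → Λ}

/-- Liftability passes to the complement of a central idempotent. -/
theorem IsLiftable.complement {π : Λ →+* Q} (h : IsLiftable π z) {e : Λ} (he : e * e = e)
    (hec : ∀ x, e * x = x * e) {q : Λ →+* X} (hq : Function.Surjective q)
    (hqe : ∀ x, q x = 0 ↔ e * x = x) {κ : Q →+* Q'} (hκ : Function.Surjective κ)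
    (hκe : ∀ x, κ x = 0 ↔ π e * x = x) {π' : X →+* Q'} (hπ' : ∀ x, π' (q x) = κ (π x)) :
    IsLiftable π' (fun i => q (z i)) := by
  have hqe1 : q e = 0 := (hqe e).mpr he
  have ha : (1 - e) * (1 - e) = 1 - e := by rw [mul_sub, mul_one, sub_mul, one_mul, he]; abel
  have hqa : ∀ x, q ((1 - e) * x) = q x := fun x => by
    rw [sub_mul, one_mul, map_sub, map_mul, hqe1, zero_mul, sub_zero]
  have hea : ∀ x, e * ((1 - e) * x) = 0 := fun x => by
    rw [← mul_assoc, mul_sub, mul_one, he, sub_self, zero_mul]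
  have hqinj : ∀ x, q ((1 - e) * x) = 0 → (1 - e) * x = 0 := fun x hx => by
    rw [hqe, hea] at hx
    exact hx.symm
  have hker : ∀ x, π' (q x) = 0 → ∃ y : Fin r → Λ, q x = ∑ i, q (z i) * q (y i) := fun x hx => by
    rw [hπ', hκe] at hx
    have h1 : π ((1 - e) * x) = 0 := by
      rw [sub_mul, one_mul, map_sub, map_mul, hx, sub_self]
    obtain ⟨y, hy⟩ := (h.ker _).mp h1
    refine ⟨y, ?_⟩
    rw [← hqa, hy, map_sum]
    simp only [map_mul]
  have hunit : ∀ x, π' x = 1 → IsUnit x := fun x hx => by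
    obtain ⟨x, rfl⟩ := hq x
    have h1 : κ (π x - 1) = 0 := by rw [map_sub, ← hπ', hx, map_one, sub_self]
    rw [hκe, mul_sub, mul_one] at h1
    have h2 : π ((1 - e) * x + e) = 1 := by
      rw [map_add, sub_mul, one_mul, map_sub, map_mul]
      rw [sub_add, h1, sub_sub_cancel]
    have h3 := (h.isUnit _ h2).map q
    rwa [map_add, hqa, hqe1, add_zero] at h3
  refine ⟨fun x => ?_, fun i x => ?_, fun x => ⟨fun hx => ?_, ?_⟩, hunit, fun E hE => ?_,
    fun I _ ε hε => ?_⟩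
  · obtain ⟨x, rfl⟩ := hκ x
    obtain ⟨x, rfl⟩ := h.surjective x
    exact ⟨q x, hπ' x⟩
  · obtain ⟨x, rfl⟩ := hq x
    rw [← map_mul, h.commute, map_mul]
  · obtain ⟨x, rfl⟩ := hq x
    obtain ⟨y, hy⟩ := hker x hx
    exact ⟨_, hy⟩
  · rintro ⟨y, rfl⟩
    choose y' hy' using fun i => hq (y i)
    have : ∑ i, q (z i) * y i = q (∑ i, z i * y' i) := by
      rw [map_sum]; simp only [map_mul, hy']
    rw [this, hπ', (h.ker _).mpr ⟨y', rfl⟩, map_zero]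
  -- Separatedness is transported through the copy of `X` inside `Λ` cut out by `1 - e`.
  · let E' : AddSubgroup Λ :=
      { carrier := {x | q x ∈ E ∧ (1 - e) * x = x}
        zero_mem' := ⟨by rw [map_zero]; exact E.zero_mem, mul_zero _⟩
        add_mem' := fun {x y} hx hy => ⟨by rw [map_add]; exact E.add_mem hx.1 hy.1, by
          rw [mul_add, hx.2, hy.2]⟩
        neg_mem' := fun {x} hx => ⟨by rw [map_neg]; exact E.neg_mem hx.1, by rw [mul_neg, hx.2]⟩ }
    have hE' : E' = ⊥ := h.separated E' fun x hx => by
      obtain ⟨y, hy, hxy⟩ := hE _ hx.1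
      choose y' hy' using fun i => hq (y i)
      refine ⟨fun i => (1 - e) * y' i, fun i => ⟨by rw [hqa, hy']; exact hy i, by
        rw [← mul_assoc, ha]⟩, ?_⟩
      have h1 : q ((1 - e) * (x - ∑ i, z i * y' i)) = 0 := by
        rw [hqa, map_sub, hxy, map_sum]
        simp only [map_mul, hy', sub_self]
      have h2 := hqinj _ h1
      rw [mul_sub, hx.2, sub_eq_zero, Finset.mul_sum] at h2
      rw [h2]
      refine Finset.sum_congr rfl fun i _ => ?_
      rw [← mul_assoc, ← mul_assoc, h.commute]
    refine (AddSubgroup.eq_bot_iff_forall _).mpr fun x hx => ?_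
    obtain ⟨x, rfl⟩ := hq x
    have h3 : (1 - e) * x ∈ E' := ⟨by rw [hqa]; exact hx, by rw [← mul_assoc, ha]⟩
    rw [hE', AddSubgroup.mem_bot] at h3
    rw [← hqa, h3, map_zero]
  · classical
    choose c hc using fun i => hκ (ε i)
    have hπee : π e * π e = π e := by rw [← map_mul, he]
    have hπec : ∀ x, π e * x = x * π e := fun x => by
      obtain ⟨x, rfl⟩ := h.surjective x
      rw [← map_mul, hec, map_mul]
    have hκ0 : ∀ x, κ x = 0 → (1 - π e) * x = 0 := fun x hx => by
      rw [hκe] at hx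
      rw [sub_mul, one_mul, hx, sub_self]
    have hπa : (1 - π e) * (1 - π e) = 1 - π e := by
      rw [← map_one π, ← map_sub, ← map_mul, ha]
    have hac : ∀ x, (1 - π e) * x = x * (1 - π e) := fun x => by
      rw [sub_mul, mul_sub, hπec, one_mul, mul_one]
    have hmul : ∀ x y, (1 - π e) * x * ((1 - π e) * y) = (1 - π e) * (x * y) := fun x y => by
      rw [← mul_assoc, mul_assoc _ x, ← hac x, ← mul_assoc, hπa, mul_assoc]
    -- The index `none` carries the image of `e`, which completes the family in `Q` before lifting.
    -- The lift of this member dies in `X`, being an idempotent there that `π'` kills.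
    have hcomp : CompleteOrthogonalIdempotents
        (fun o : Option I => o.elim (π e) fun i => (1 - π e) * c i) := by
      refine ⟨⟨fun o => ?_, fun o o' hoo => ?_⟩, ?_⟩
      · rcases o with _ | i
        · exact hπee
        · change (1 - π e) * c i * ((1 - π e) * c i) = (1 - π e) * c i
          rw [hmul, ← sub_eq_zero, ← mul_sub]
          exact hκ0 _ (by rw [map_sub, map_mul, hc, (hε.idem i).eq, sub_self])
      · rcases o with _ | i <;> rcases o' with _ | i'
        · exact absurd rfl hoo
        · change π e * ((1 - π e) * c i') = 0
          rw [← mul_assoc, mul_sub, mul_one, hπee, sub_self, zero_mul]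
        · change (1 - π e) * c i * π e = 0
          rw [← hπec, ← mul_assoc, mul_sub, mul_one, hπee, sub_self, zero_mul]
        · change (1 - π e) * c i * ((1 - π e) * c i') = 0
          rw [hmul]
          exact hκ0 _ (by rw [map_mul, hc, hc, hε.ortho fun h => hoo (congrArg _ h)])
      · rw [Fintype.sum_option]
        change π e + ∑ i, (1 - π e) * c i = 1
        have : (1 - π e) * (∑ i, c i - 1) = 0 := hκ0 _ (by
          rw [map_sub, map_sum, map_one]
          simp only [hc]
          rw [hε.complete, sub_self])
        rw [mul_sub, mul_one, sub_eq_zero] at this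
        rw [← Finset.mul_sum, this, add_sub_cancel]
    obtain ⟨f, hf, hπf⟩ := h.lift _ _ hcomp
    have hnone : q (f none) = 0 := by
      have h1 : IsUnit (1 - q (f none)) := hunit _ (by
        rw [map_sub, hπ', hπf, map_one]
        change 1 - κ (π e) = 1
        rw [← hπ', hqe1, map_zero, sub_zero])
      refine (h1.mul_right_eq_zero (b := q (f none))).mp ?_
      rw [sub_mul, one_mul, ← map_mul, (hf.idem none).eq, sub_self]
    refine ⟨fun i => q (f (some i)), ⟨⟨fun i => ?_, fun i i' hii => ?_⟩, ?_⟩, fun i => ?_⟩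
    · rw [IsIdempotentElem, ← map_mul, (hf.idem _).eq]
    · change q _ * q _ = 0
      rw [← map_mul, hf.ortho (fun h => hii (Option.some.inj h)), map_zero]
    · have := congrArg q hf.complete
      rwa [Fintype.sum_option, map_add, hnone, zero_add, map_sum, map_one] at this
    · rw [hπ', hπf]
      change κ ((1 - π e) * c i) = ε i
      rw [sub_mul, one_mul, map_sub, map_mul, ← hπ', hqe1, map_zero, zero_mul, sub_zero, hc]

end Complement

/-! ### The coefficientwise topology on `ℤ_p[M]` -/

section Topology

variable {p : ℕ} [Fact p.Prime] {M : Type*}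

noncomputable instance : TopologicalSpace (MonoidAlgebra ℤ_[p] M) :=
  TopologicalSpace.induced (fun x (m : M) => x.coeff m) inferInstance

lemma continuous_coeff (m : M) : Continuous fun x : MonoidAlgebra ℤ_[p] M => x.coeff m :=
  (continuous_apply m).comp continuous_induced_dom

lemma continuous_iff_coeff {Y : Type*} [TopologicalSpace Y] {f : Y → MonoidAlgebra ℤ_[p] M} :
    Continuous f ↔ ∀ m, Continuous fun y => (f y).coeff m :=
  continuous_induced_rng.trans continuous_pi_iff

instance : T2Space (MonoidAlgebra ℤ_[p] M) :=
  .of_injective_continuous (f := fun x (m : M) => x.coeff m)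
    (fun x y h => by ext m; exact congrFun h m) continuous_induced_dom

instance [Finite M] : CompactSpace (MonoidAlgebra ℤ_[p] M) := by
  have hc : Continuous fun f : M → ℤ_[p] =>
      (MonoidAlgebra.ofCoeff (Finsupp.equivFunOnFinite.symm f) : MonoidAlgebra ℤ_[p] M) :=
    continuous_iff_coeff.mpr fun m => continuous_apply m
  refine ⟨?_⟩
  have hs : Function.Surjective fun f : M → ℤ_[p] =>
      (MonoidAlgebra.ofCoeff (Finsupp.equivFunOnFinite.symm f) : MonoidAlgebra ℤ_[p] M) := fun x =>
    ⟨fun m => x.coeff m, by ext m; rfl⟩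
  rw [← hs.range_eq]
  exact isCompact_range hc

variable [Group M]

lemma coeff_mul_eq_sum {k : Type*} [CommRing k] [Fintype M] (x y : MonoidAlgebra k M) (m : M) :
    (x * y).coeff m = ∑ h : M, x.coeff h * y.coeff (h⁻¹ * m) := by
  classical
  induction x using MonoidAlgebra.induction_linear with
  | zero => simp
  | add a b ha hb => simp [add_mul, ha, hb, Finset.sum_add_distrib]
  | single h r =>
    rw [MonoidAlgebra.coeff_single_mul_apply, Finset.sum_eq_single h]
    · simp
    · intro b _ hb
      simp [hb.symm]
    · simp

instance [Finite M] : IsTopologicalRing (MonoidAlgebra ℤ_[p] M) where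
  continuous_add := continuous_iff_coeff.mpr fun m => by
    simp only [MonoidAlgebra.coeff_add, Finsupp.add_apply]
    exact ((continuous_coeff m).comp continuous_fst).add ((continuous_coeff m).comp continuous_snd)
  continuous_mul := continuous_iff_coeff.mpr fun m => by
    have := Fintype.ofFinite M
    simp only [coeff_mul_eq_sum]
    exact continuous_finsetSum _ fun h _ =>
      ((continuous_coeff h).comp continuous_fst).mul ((continuous_coeff _).comp continuous_snd)
  continuous_neg := continuous_iff_coeff.mpr fun m => by
    simp only [MonoidAlgebra.coeff_neg, Finsupp.neg_apply]
    exact (continuous_coeff m).neg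

lemma continuous_mapDomain {M' : Type*} [Finite M] (f : M → M') :
    Continuous (MonoidAlgebra.mapDomain f : MonoidAlgebra ℤ_[p] M → MonoidAlgebra ℤ_[p] M') := by
  classical
  have := Fintype.ofFinite M
  refine continuous_iff_coeff.mpr fun m' => ?_
  have : ∀ x : MonoidAlgebra ℤ_[p] M, (MonoidAlgebra.mapDomain f x).coeff m' =
      ∑ m, if f m = m' then x.coeff m else 0 := fun x => by
    induction x using MonoidAlgebra.induction_linear with
    | zero => simp
    | add a b ha hb =>
      rw [MonoidAlgebra.mapDomain_add, MonoidAlgebra.coeff_add, Finsupp.add_apply, ha, hb,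
        ← Finset.sum_add_distrib]
      refine Finset.sum_congr rfl fun m _ => ?_
      split_ifs <;> simp
    | single h r =>
      rw [MonoidAlgebra.mapDomain_single, Finset.sum_eq_single h]
      · simp [Finsupp.single_apply]
      · intro b _ hb
        simp [hb.symm]
      · simp
  simp only [this]
  refine continuous_finsetSum _ fun m _ => ?_
  split_ifs
  · exact continuous_coeff m
  · exact continuous_const

end Topology

/-! ### Finite levels of the Iwasawa algebra -/

section Projections

variable {p : ℕ} [Fact p.Prime] {G : Type u} [Group G] [TopologicalSpace G]

/-- The projection `Λ(G) → ℤ_p[G/U]`. -/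
noncomputable def proj (U : OpenNormalSubgroup G) :
    IwasawaAlgebra p G →+* MonoidAlgebra ℤ_[p] (G ⧸ U.toSubgroup) :=
  (Pi.evalRingHom _ U).comp (compatible p G).val.toRingHom

@[simp] lemma proj_ofGroup (U : OpenNormalSubgroup G) (g : G) :
    proj U (ofGroup p g) = MonoidAlgebra.single (g : G ⧸ U.toSubgroup) 1 := rfl

lemma proj_algebraMap (U : OpenNormalSubgroup G) (r : ℤ_[p]) :
    proj U (algebraMap ℤ_[p] (IwasawaAlgebra p G) r) = MonoidAlgebra.single 1 r := rfl

lemma proj_ext {x y : IwasawaAlgebra p G} (h : ∀ U, proj U x = proj U y) : x = y :=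
  Subtype.ext (funext h)

lemma mapDomain_proj {U V : OpenNormalSubgroup G} (h : U.toSubgroup ≤ V.toSubgroup)
    (x : IwasawaAlgebra p G) :
    MonoidAlgebra.mapDomain (QuotientGroup.map U.toSubgroup V.toSubgroup (MonoidHom.id G) h)
      (proj U x) = proj V x :=
  x.2 U V h

lemma proj_surjective (U : OpenNormalSubgroup G) : Function.Surjective (proj (p := p) U) := by
  intro x
  induction x using MonoidAlgebra.induction_linear with
  | zero => exact ⟨0, map_zero _⟩
  | add a b ha hb =>
    obtain ⟨a, rfl⟩ := ha
    obtain ⟨b, rfl⟩ := hb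
    exact ⟨a + b, map_add _ _ _⟩
  | single g r =>
    obtain ⟨g, rfl⟩ := QuotientGroup.mk_surjective g
    refine ⟨algebraMap _ _ r * ofGroup p g, ?_⟩
    rw [map_mul, proj_ofGroup, proj_algebraMap]
    simp [MonoidAlgebra.single_mul_single]

lemma commute_of_forall_ofGroup {x : IwasawaAlgebra p G} (h : ∀ g, Commute x (ofGroup p g))
    (y : IwasawaAlgebra p G) : Commute x y := by
  refine proj_ext fun U => ?_
  rw [map_mul, map_mul]
  refine (commute_of_forall_single p (fun g => ?_) (proj U y)).eq
  obtain ⟨g, rfl⟩ := QuotientGroup.mk_surjective g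
  have := congrArg (proj U) (h g).eq
  rwa [map_mul, map_mul, proj_ofGroup] at this

lemma dvd_coeff_pow_mul {M : Type*} [Group M] (n : ℕ) (y : MonoidAlgebra ℤ_[p] M) (m : M) :
    (p : ℤ_[p]) ^ n ∣ ((p : MonoidAlgebra ℤ_[p] M) ^ n * y).coeff m := by
  rw [← Nat.cast_pow, ← Nat.cast_pow, natCast_mul_eq_smul]
  exact ⟨y.coeff m, by simp⟩

/-- The projection `Λ(G) → 𝔽_p[G/U]`. -/
noncomputable def projModP (U : OpenNormalSubgroup G) :
    IwasawaAlgebra p G →+* MonoidAlgebra (ZMod p) (G ⧸ U.toSubgroup) :=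
  (modP p _).comp (proj U)

@[simp] lemma projModP_ofGroup (U : OpenNormalSubgroup G) (g : G) :
    projModP U (ofGroup p g) = MonoidAlgebra.single (g : G ⧸ U.toSubgroup) 1 := by
  simp [projModP]

lemma projModP_surjective (U : OpenNormalSubgroup G) :
    Function.Surjective (projModP (p := p) U) :=
  modP_surjective.comp (proj_surjective U)

lemma mapDomain_projModP {U V : OpenNormalSubgroup G} (h : U.toSubgroup ≤ V.toSubgroup)
    (x : IwasawaAlgebra p G) :
    MonoidAlgebra.mapDomain (QuotientGroup.map U.toSubgroup V.toSubgroup (MonoidHom.id G) h)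
      (projModP U x) = projModP V x := by
  have key : ∀ y : MonoidAlgebra ℤ_[p] (G ⧸ U.toSubgroup), MonoidAlgebra.mapDomain
      (QuotientGroup.map U.toSubgroup V.toSubgroup (MonoidHom.id G) h) (modP p _ y) =
      modP p _ (MonoidAlgebra.mapDomain
        (QuotientGroup.map U.toSubgroup V.toSubgroup (MonoidHom.id G) h) y) := fun y => by
    induction y using MonoidAlgebra.induction_linear with
    | zero => simp
    | add a b ha hb => rw [map_add, MonoidAlgebra.mapDomain_add, ha, hb, MonoidAlgebra.mapDomain_add,
        map_add]
    | single g r => simp [MonoidAlgebra.mapDomain_single]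
  change MonoidAlgebra.mapDomain _ (modP p _ (proj U x)) = modP p _ (proj V x)
  rw [key, mapDomain_proj]

lemma p_mul_cancel' {x y : IwasawaAlgebra p G} (h : (p : IwasawaAlgebra p G) * x = p * y) :
    x = y := by
  refine proj_ext fun U => p_mul_cancel ?_
  have := congrArg (proj U) h
  simpa only [map_mul, map_natCast] using this

variable [IsTopologicalGroup G] [CompactSpace G]

instance finite_quotient (U : OpenNormalSubgroup G) : Finite (G ⧸ U.toSubgroup) :=
  U.toSubgroup.quotient_finite_of_isOpen U.isOpen'

instance : T2Space (IwasawaAlgebra p G) := inferInstanceAs (T2Space (Subtype _))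

instance : IsTopologicalRing (IwasawaAlgebra p G) :=
  inferInstanceAs (IsTopologicalRing (compatible p G).toSubring)

lemma continuous_proj (U : OpenNormalSubgroup G) : Continuous (proj (p := p) U) :=
  (continuous_apply U).comp continuous_subtype_val

instance : CompactSpace (IwasawaAlgebra p G) := by
  refine isCompact_iff_compactSpace.mp (IsClosed.isCompact ?_)
  change IsClosed {x : ∀ U : OpenNormalSubgroup G, MonoidAlgebra ℤ_[p] (G ⧸ U.toSubgroup) |
    ∀ (U V : OpenNormalSubgroup G) (h : U.toSubgroup ≤ V.toSubgroup), MonoidAlgebra.mapDomain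
      (QuotientGroup.map U.toSubgroup V.toSubgroup (MonoidHom.id G) h) (x U) = x V}
  simp only [Set.ofPred_forall]
  exact isClosed_iInter fun U => isClosed_iInter fun V => isClosed_iInter fun h =>
    isClosed_eq ((continuous_mapDomain _).comp (continuous_apply U)) (continuous_apply V)

/-- The kernel of `Λ(G) → (ℤ/p^n)[G/U]`. -/
def levelIdeal (j : ℕ × OpenNormalSubgroup G) : Ideal (IwasawaAlgebra p G) where
  carrier := {x | ∃ y, proj j.2 x = (p : MonoidAlgebra ℤ_[p] _) ^ j.1 * y}
  zero_mem' := ⟨0, by simp⟩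
  add_mem' := by
    rintro _ _ ⟨y, hy⟩ ⟨y', hy'⟩
    exact ⟨y + y', by rw [map_add, hy, hy', mul_add]⟩
  smul_mem' := by
    rintro c x ⟨y, hy⟩
    refine ⟨proj j.2 c * y, ?_⟩
    rw [smul_eq_mul, map_mul, hy, ← mul_assoc, ← mul_assoc,
      ((Nat.cast_commute p (proj j.2 c)).pow_left _).eq]

lemma mem_levelIdeal {n : ℕ} {U : OpenNormalSubgroup G} {x : IwasawaAlgebra p G} :
    x ∈ levelIdeal (n, U) ↔ ∃ y, proj U x = (p : MonoidAlgebra ℤ_[p] _) ^ n * y := Iff.rfl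

/-- Closedness comes from compactness of the multiples of `p ^ n` at a finite level. Separatedness
combines the inverse limit with the vanishing of the intersection of the ideals `p ^ n ℤ_p`. -/
lemma levelIdeal_isFundamental :
    IsFundamental (levelIdeal : ℕ × OpenNormalSubgroup G → Ideal (IwasawaAlgebra p G)) where
  isTwoSided := fun ⟨n, U⟩ => ⟨fun {a} b ⟨y, hy⟩ => ⟨y * proj U b, by
    rw [map_mul, hy, mul_assoc]⟩⟩
  isClosed := fun ⟨n, U⟩ => by
    have : IsClosed (Set.range fun y : MonoidAlgebra ℤ_[p] (G ⧸ U.toSubgroup) =>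
        (p : MonoidAlgebra ℤ_[p] (G ⧸ U.toSubgroup)) ^ n * y) :=
      (isCompact_range (by fun_prop)).isClosed
    convert this.preimage (continuous_proj U) using 1
    ext x
    change (∃ y, _) ↔ ∃ y, _
    exact exists_congr fun y => eq_comm
  directed := by
    rintro ⟨n, U⟩ ⟨m, V⟩
    refine ⟨(n + m, U ⊓ V), ?_, ?_⟩
    · rintro x ⟨y, hy⟩
      have h : (U ⊓ V).toSubgroup ≤ U.toSubgroup := (inf_le_left : U ⊓ V ≤ U)
      refine ⟨p ^ m * MonoidAlgebra.mapDomainRingHom ℤ_[p] (QuotientGroup.map _ _ (.id G) h) y, ?_⟩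
      have := congrArg (MonoidAlgebra.mapDomainRingHom ℤ_[p] (QuotientGroup.map _ _ (.id G) h)) hy
      rw [map_mul, map_pow, map_natCast, pow_add, mul_assoc] at this
      exact (mapDomain_proj h x).symm.trans this
    · rintro x ⟨y, hy⟩
      have h : (U ⊓ V).toSubgroup ≤ V.toSubgroup := (inf_le_right : U ⊓ V ≤ V)
      refine ⟨p ^ n * MonoidAlgebra.mapDomainRingHom ℤ_[p] (QuotientGroup.map _ _ (.id G) h) y, ?_⟩
      have := congrArg (MonoidAlgebra.mapDomainRingHom ℤ_[p] (QuotientGroup.map _ _ (.id G) h)) hy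
      rw [map_mul, map_pow, map_natCast, add_comm, pow_add, mul_assoc] at this
      exact (mapDomain_proj h x).symm.trans this
  separated x hx := by
    refine proj_ext fun U => ?_
    rw [map_zero]
    ext m
    by_contra hne
    have h0 : (⨅ n : ℕ, Ideal.span {(p : ℤ_[p])} ^ n) = ⊥ := Ideal.iInf_pow_eq_bot_of_isDomain _ (by
      rw [← PadicInt.maximalIdeal_eq_span_p]
      exact Ideal.IsPrime.ne_top')
    have h1 : (proj U x).coeff m ∈ ⨅ n : ℕ, Ideal.span {(p : ℤ_[p])} ^ n := by
      refine Ideal.mem_iInf.mpr fun n => ?_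
      obtain ⟨y, hy⟩ := hx (n, U)
      rw [Ideal.span_singleton_pow, Ideal.mem_span_singleton, hy]
      exact dvd_coeff_pow_mul n y m
    rw [h0] at h1
    exact hne h1

@[simp] lemma projModP_p (U : OpenNormalSubgroup G) :
    projModP U (p : IwasawaAlgebra p G) = 0 := by
  refine modP_eq_zero_iff.mpr ⟨1, ?_⟩
  rw [map_natCast, mul_one]

/-- Nilpotence modulo `p` at level `U` means that some power is a multiple of `p` there; the `n`-th
power of that is a multiple of `p ^ n`. -/
lemma exists_pow_mem_levelIdeal {c : IwasawaAlgebra p G}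
    {U : OpenNormalSubgroup G} (h : IsNilpotent (projModP U c)) (n : ℕ) :
    ∃ s : ℕ, c ^ s ∈ levelIdeal (n, U) := by
  obtain ⟨s, hs⟩ := h
  rw [← map_pow] at hs
  obtain ⟨y, hy⟩ := modP_eq_zero_iff.mp hs
  refine ⟨s * n, mem_levelIdeal.mpr ⟨y ^ n, ?_⟩⟩
  rw [pow_mul, map_pow, hy, (Nat.cast_commute p y).mul_pow]

/-- An element lying in `pΛ_U` for all `U` lies in `pΛ`. -/
lemma exists_eq_p_mul {x : IwasawaAlgebra p G} (h : ∀ U, projModP U x = 0) : ∃ y, x = p * y := by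
  have hx : ∀ U, ∃ y, proj U x = p * y := fun U => modP_eq_zero_iff.mp (h U)
  choose y hy using hx
  refine ⟨⟨y, fun U V hUV => p_mul_cancel ?_⟩, proj_ext fun U => ?_⟩
  · rw [← hy V, ← mapDomain_proj hUV, hy U]
    change _ = MonoidAlgebra.mapDomainRingHom ℤ_[p] (QuotientGroup.map _ _ (.id G) hUV) _
    rw [map_mul, map_natCast]
    rfl
  · rw [map_mul, map_natCast]
    exact hy U

end Projections

/-! ### The group: one-parameter complement and equivariant sections -/

section Group

variable {p : ℕ} [Fact p.Prime] {G : Type u} [Group G] [TopologicalSpace G]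

/-- `P` is a continuous homomorphism from `ℤ_p` onto an open complement of `H`, and `P (p ^ m ℤ_p)`
is central. -/
structure IsSemidirect (H : Subgroup G) (P : ℤ_[p] → G) (m : ℕ) : Prop where
  map_add : ∀ x y, P (x + y) = P x * P y
  continuous : Continuous P
  isOpen : ∀ n : ℕ, IsOpen (Set.range fun x => P (p ^ n * x))
  central : ∀ x g, P (p ^ m * x) * g = g * P (p ^ m * x)
  disjoint : ∀ x, P x ∈ H → x = 0
  exists_eq : ∀ g, ∃ h ∈ H, ∃ x, g = h * P x

variable {H : Subgroup G} {P : ℤ_[p] → G} {m : ℕ}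

namespace IsSemidirect

variable (hP : IsSemidirect H P m)

include hP

lemma map_zero : P 0 = 1 := by
  have := hP.map_add 0 0
  rwa [add_zero, left_eq_mul] at this

lemma map_neg (x : ℤ_[p]) : P (-x) = (P x)⁻¹ := by
  rw [eq_inv_iff_mul_eq_one, ← hP.map_add, neg_add_cancel, hP.map_zero]

lemma map_natCast_mul (i : ℕ) (x : ℤ_[p]) : P (i * x) = P x ^ i := by
  induction i with
  | zero => rw [Nat.cast_zero, zero_mul, hP.map_zero, pow_zero]
  | succ i ih => rw [Nat.cast_succ, add_mul, one_mul, hP.map_add, ih, pow_succ]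

lemma map_pow_mul (n : ℕ) (x : ℤ_[p]) : P (p ^ n * x) = P x ^ p ^ n := by
  rw [← hP.map_natCast_mul, Nat.cast_pow]

lemma injective {x : ℤ_[p]} (h : P x = 1) : x = 0 := hP.disjoint x (h ▸ H.one_mem)

/-- The open central subgroup `P (p ^ (m + k) ℤ_p)`. -/
def level (hP : IsSemidirect H P m) (k : ℕ) : OpenNormalSubgroup G where
  carrier := Set.range fun x => P (p ^ (m + k) * x)
  mul_mem' := by
    rintro _ _ ⟨x, rfl⟩ ⟨y, rfl⟩
    exact ⟨x + y, by simp only; rw [mul_add, hP.map_add]⟩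
  one_mem' := ⟨0, by simp only; rw [mul_zero, hP.map_zero]⟩
  inv_mem' := by
    rintro _ ⟨x, rfl⟩
    exact ⟨-x, by simp only; rw [mul_neg, hP.map_neg]⟩
  isOpen' := hP.isOpen _
  isNormal' := ⟨by
    rintro _ ⟨x, rfl⟩ g
    refine ⟨x, ?_⟩
    simp only
    rw [pow_add, mul_assoc (_ ^ m), ← hP.central, mul_assoc, mul_inv_cancel, mul_one]⟩

lemma mem_level {k : ℕ} {g : G} : g ∈ (hP.level k).toSubgroup ↔ ∃ x, P (p ^ (m + k) * x) = g :=
  Iff.rfl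

lemma exists_pow_mem (U : OpenNormalSubgroup G) : ∃ k : ℕ, ∀ x, P (p ^ k * x) ∈ U.toSubgroup := by
  have h1 : P ⁻¹' (U.toSubgroup : Set G) ∈ nhds (0 : ℤ_[p]) :=
    (U.isOpen'.preimage hP.continuous).mem_nhds (by
      change P 0 ∈ U.toSubgroup
      rw [hP.map_zero]; exact one_mem _)
  obtain ⟨ε, hε, h⟩ := Metric.mem_nhds_iff.mp h1
  obtain ⟨k, hk⟩ := PadicInt.exists_pow_neg_lt p hε
  refine ⟨k, fun x => h ?_⟩
  rw [mem_ball_zero_iff]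
  refine lt_of_le_of_lt ?_ hk
  rw [PadicInt.norm_le_pow_iff_mem_span_pow]
  exact Ideal.mem_span_singleton.mpr (dvd_mul_right _ _)

/-- Natural numbers are dense in `ℤ_p`: the truncation of `x` modulo a large power of `p` has the
same image in the finite quotient. -/
lemma exists_natCast (U : OpenNormalSubgroup G) (n : ℕ) (x : ℤ_[p]) :
    ∃ i : ℕ, (P (p ^ n) ^ i)⁻¹ * P (p ^ n * x) ∈ U.toSubgroup := by
  obtain ⟨k, hk⟩ := hP.exists_pow_mem U
  obtain ⟨y, hy⟩ := Ideal.mem_span_singleton.mp (PadicInt.appr_spec k x)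
  refine ⟨x.appr k, ?_⟩
  rw [← hP.map_natCast_mul, ← hP.map_neg, ← hP.map_add]
  have : -((x.appr k : ℤ_[p]) * p ^ n) + p ^ n * x = p ^ k * (p ^ n * y) := by
    linear_combination (p : ℤ_[p]) ^ n * hy
  rw [this]
  exact hk _

lemma commutator_mem [H.Normal] (x y : G) : x * y * x⁻¹ * y⁻¹ ∈ H := by
  have hcomm : ∀ a b : ℤ_[p], P a * P b = P b * P a := fun a b => by
    rw [← hP.map_add, add_comm, hP.map_add]
  obtain ⟨h, hh, a, rfl⟩ := hP.exists_eq x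
  obtain ⟨h', hh', b, rfl⟩ := hP.exists_eq y
  rw [← QuotientGroup.eq_one_iff]
  have e1 : (h : G ⧸ H) = 1 := (QuotientGroup.eq_one_iff h).mpr hh
  have e2 : (h' : G ⧸ H) = 1 := (QuotientGroup.eq_one_iff h').mpr hh'
  simp only [QuotientGroup.mk_mul, QuotientGroup.mk_inv, e1, e2, one_mul]
  rw [← QuotientGroup.mk_mul, hcomm, QuotientGroup.mk_mul]
  group

lemma level_inf (k : ℕ) {g : G} (hg : g ∈ (hP.level k).toSubgroup) (hH : g ∈ H) : g = 1 := by
  obtain ⟨x, rfl⟩ := hP.mem_level.mp hg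
  rw [hP.disjoint _ hH, hP.map_zero]

end IsSemidirect

/-- If `V ⊓ H = 1` and `G ⧸ H` is commutative, then `G → G ⧸ V` has a section that is equivariant
for conjugation. -/
lemma exists_equivariant_section {G : Type*} [Group G] (H V : Subgroup G) [H.Normal] [V.Normal]
    (hHV : ∀ g ∈ V, g ∈ H → g = 1) (hH : ∀ x y, x * y * x⁻¹ * y⁻¹ ∈ H) :
    ∃ s : G ⧸ V → G, (∀ c, (s c : G ⧸ V) = c) ∧ ∀ (y : G) c, s ((y : G ⧸ V) * c * (y : G ⧸ V)⁻¹) = y * s c * y⁻¹ := by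
  -- The lift `s c` is normalised to be congruent modulo `H` to a representative depending only on
  -- the class in `G ⧸ L`. Conjugation preserves that class since commutators lie in `H`, and two
  -- such lifts of one element differ by an element of `V ⊓ H = 1`.
  let L := V ⊔ H
  have hL : L.Normal := inferInstance
  let r : G → G := fun x => (x : G ⧸ L).out
  have hr : ∀ x, x⁻¹ * r x ∈ L := fun x =>
    QuotientGroup.eq.mp (QuotientGroup.out_eq' (x : G ⧸ L)).symm
  have hs : ∀ c : G ⧸ V, ∃ x s : G, (x : G ⧸ V) = c ∧ (s : G ⧸ V) = c ∧ (r x)⁻¹ * s ∈ H := by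
    intro c
    obtain ⟨x, rfl⟩ := QuotientGroup.mk_surjective c
    have hx : x⁻¹ * r x ∈ ((V ⊔ H : Subgroup G) : Set G) := hr x
    rw [Subgroup.mul_normal] at hx
    obtain ⟨v, hv, h, hh, he⟩ := Set.mem_mul.mp hx
    refine ⟨x, x * v, rfl, ?_, ?_⟩
    · rw [QuotientGroup.mk_mul, (QuotientGroup.eq_one_iff v).mpr hv, mul_one]
    · have : (r x)⁻¹ * (x * v) = h⁻¹ := by
        have : r x = x * (v * h) := by rw [he, mul_inv_cancel_left]
        rw [this]; group
      rw [this]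
      exact H.inv_mem hh
  choose x s hx hs hrs using hs
  refine ⟨s, hs, fun y c => ?_⟩
  have hrr : ∀ a b : G, (a : G ⧸ L) = b → r a = r b := fun a b hab => by
    simp only [r, hab]
  have e1 : r (x ((y : G ⧸ V) * c * (y : G ⧸ V)⁻¹)) = r (x c) := by
    refine hrr _ _ ?_
    have h1 : ((x ((y : G ⧸ V) * c * (y : G ⧸ V)⁻¹) : G) : G ⧸ V) = ((y * x c * y⁻¹ : G) : G ⧸ V) := by
      rw [hx]
      simp only [QuotientGroup.mk_mul, QuotientGroup.mk_inv, hx]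
    have h2 := QuotientGroup.eq.mp h1
    rw [QuotientGroup.eq]
    have h3 : y * x c * y⁻¹ * (x c)⁻¹ ∈ L := (le_sup_right : H ≤ L) (hH y (x c))
    have h5 : (x ((y : G ⧸ V) * c * (y : G ⧸ V)⁻¹))⁻¹ * x c * ((x c)⁻¹ * (y * x c * y⁻¹)) ∈ L := by
      have : (x ((y : G ⧸ V) * c * (y : G ⧸ V)⁻¹))⁻¹ * x c * ((x c)⁻¹ * (y * x c * y⁻¹)) =
        (x ((y : G ⧸ V) * c * (y : G ⧸ V)⁻¹))⁻¹ * (y * x c * y⁻¹) := by group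
      rw [this]
      exact (le_sup_left : V ≤ L) h2
    have h6 : (x c)⁻¹ * (y * x c * y⁻¹) ∈ L := by
      have := hL.conj_mem _ h3 (x c)⁻¹
      have e : (x c)⁻¹ * (y * x c * y⁻¹ * (x c)⁻¹) * (x c)⁻¹⁻¹ = (x c)⁻¹ * (y * x c * y⁻¹) := by
        group
      rwa [e] at this
    exact (L.mul_mem_cancel_right h6).mp h5
  have h1 := hrs ((y : G ⧸ V) * c * (y : G ⧸ V)⁻¹)
  rw [e1] at h1
  have h2 : (r (x c))⁻¹ * (y * s c * y⁻¹) ∈ H := by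
    have h3 := H.mul_mem (hrs c) (‹H.Normal›.conj_mem _ (hH y (s c)) (s c)⁻¹)
    have e : (r (x c))⁻¹ * s c * ((s c)⁻¹ * (y * s c * y⁻¹ * (s c)⁻¹) * (s c)⁻¹⁻¹) =
        (r (x c))⁻¹ * (y * s c * y⁻¹) := by group
    rwa [e] at h3
  refine inv_mul_eq_one.mp (hHV _ ?_ ?_)
  · rw [← QuotientGroup.eq, hs]
    simp only [QuotientGroup.mk_mul, QuotientGroup.mk_inv, hs]
  · have h3 := H.mul_mem (H.inv_mem h1) h2
    have e : ((r (x c))⁻¹ * s ((y : G ⧸ V) * c * (y : G ⧸ V)⁻¹))⁻¹ * ((r (x c))⁻¹ * (y * s c * y⁻¹)) =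
        (s ((y : G ⧸ V) * c * (y : G ⧸ V)⁻¹))⁻¹ * (y * s c * y⁻¹) := by group
    rwa [e] at h3

/-- The kernel of the map of group algebras induced by a homomorphism whose fibres are the orbits
of an element. -/
lemma exists_eq_mul_single_sub_one {k : Type*} [CommRing k] {M M' : Type*} [Group M] [Group M']
    (q : M → M') (c : M) (hc : ∀ a b, q a = q b → ∃ i : ℕ, a = b * c ^ i) {x : MonoidAlgebra k M}
    (hx : MonoidAlgebra.mapDomain q x = 0) : ∃ y, x = y * (MonoidAlgebra.single c 1 - 1) := by
  have key : ∀ x : MonoidAlgebra k M, ∃ y,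
      x - MonoidAlgebra.mapDomain (Function.invFun q) (MonoidAlgebra.mapDomain q x) =
        y * (MonoidAlgebra.single c 1 - 1) := fun x => by
    induction x using MonoidAlgebra.induction_linear with
    | zero => exact ⟨0, by simp⟩
    | add a b ha hb =>
      obtain ⟨y, hy⟩ := ha
      obtain ⟨y', hy'⟩ := hb
      refine ⟨y + y', ?_⟩
      rw [MonoidAlgebra.mapDomain_add, MonoidAlgebra.mapDomain_add, add_mul, ← hy, ← hy']
      abel
    | single a r =>
      rw [MonoidAlgebra.mapDomain_single, MonoidAlgebra.mapDomain_single]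
      set b := Function.invFun q (q a)
      obtain ⟨i, hi⟩ := hc a b (Function.invFun_eq ⟨a, rfl⟩).symm
      refine ⟨MonoidAlgebra.single b r * ∑ j ∈ Finset.range i, MonoidAlgebra.single c 1 ^ j, ?_⟩
      rw [mul_assoc, geom_sum_mul, mul_sub, mul_one, MonoidAlgebra.single_pow,
        MonoidAlgebra.single_mul_single, ← hi, one_pow, mul_one]
  obtain ⟨y, hy⟩ := key x
  rw [hx, MonoidAlgebra.mapDomain_zero, sub_zero] at hy
  exact ⟨y, hy⟩

/-- The image of a `d`-invariant element vanishes if `d` maps to `1` and has order divisible by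
`p`. -/
lemma mapDomain_eq_zero_of_invariant {p : ℕ} {M M' : Type*} [Group M] [Finite M]
    [Group M'] (q : M →* M') (d : M) (hd : q d = 1) (hp : p ∣ orderOf d)
    {x : MonoidAlgebra (ZMod p) M} (hx : MonoidAlgebra.single d 1 * x = x) :
    MonoidAlgebra.mapDomain q x = 0 := by
  classical
  have := Fintype.ofFinite M
  ext m'
  have h1 : ∀ x : MonoidAlgebra (ZMod p) M, (MonoidAlgebra.mapDomain q x).coeff m' =
      ∑ m, if q m = m' then x.coeff m else 0 := fun x => by
    induction x using MonoidAlgebra.induction_linear with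
    | zero => simp
    | add a b ha hb =>
      rw [MonoidAlgebra.mapDomain_add, MonoidAlgebra.coeff_add, Finsupp.add_apply, ha, hb,
        ← Finset.sum_add_distrib]
      refine Finset.sum_congr rfl fun m _ => ?_
      split_ifs <;> simp
    | single h r =>
      rw [MonoidAlgebra.mapDomain_single, Finset.sum_eq_single h]
      · simp [Finsupp.single_apply]
      · intro b _ hb
        simp [hb.symm]
      · simp
  have hinv : ∀ i : ℕ, MonoidAlgebra.single (d ^ i) 1 * x = x := fun i => by
    induction i with
    | zero => rw [pow_zero, ← MonoidAlgebra.one_def, one_mul]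
    | succ i ih =>
      have : MonoidAlgebra.single (d ^ (i + 1)) (1 : ZMod p) =
          MonoidAlgebra.single (d ^ i) 1 * MonoidAlgebra.single d 1 := by
        rw [MonoidAlgebra.single_mul_single, ← pow_succ, mul_one]
      rw [this, mul_assoc, hx, ih]
  -- The coefficients of `x` are constant on the orbits of `d`, and these orbits lie in the fibres
  -- of `q`; each fibre sum is therefore a multiple of the order of `d`.
  obtain ⟨C, hC, -⟩ := exists_coset_representatives (Subgroup.zpowers d)
  rw [h1, sum_eq_sum_sum_cosets (Subgroup.zpowers d) C hC]
  have h2 : ∀ y : Subgroup.zpowers d, (∑ c ∈ C, if q (y * c) = m' then x.coeff (y * c) else 0) =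
      ∑ c ∈ C, if q c = m' then x.coeff c else 0 := fun ⟨y, hy⟩ => by
    obtain ⟨i, rfl⟩ := mem_powers_iff_mem_zpowers.mpr hy
    refine Finset.sum_congr rfl fun c _ => ?_
    simp only
    rw [map_mul, map_pow, hd, one_pow, one_mul]
    congr 1
    conv_lhs => rw [← hinv i]
    rw [MonoidAlgebra.coeff_single_mul_apply, one_mul, inv_mul_cancel_left]
  simp only [h2, Finset.sum_const, Finset.card_univ, Fintype.card_zpowers, nsmul_eq_mul]
  rw [(ZMod.natCast_eq_zero_iff _ _).mpr hp, zero_mul]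
  simp

end Group

/-! ### Kernels, regularity and central lifts in `Λ(G)` -/

section IwasawaAlgebra

instance {G : Type u} [Group G] [TopologicalSpace G] : Nonempty (OpenNormalSubgroup G) :=
  ⟨{ (⊤ : OpenSubgroup G) with isNormal' := Subgroup.normal_top }⟩

variable {p : ℕ} [Fact p.Prime] {G : Type u} [Group G] [TopologicalSpace G]
  [IsTopologicalGroup G] [CompactSpace G] {H : Subgroup G} {P : ℤ_[p] → G} {m : ℕ}

namespace IsSemidirect

variable (hP : IsSemidirect H P m)

include hP

omit [IsTopologicalGroup G] [CompactSpace G] in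
lemma ofGroup_central (x : ℤ_[p]) (w : IwasawaAlgebra p G) :
    ofGroup p (P (p ^ m * x)) * w = w * ofGroup p (P (p ^ m * x)) :=
  (commute_of_forall_ofGroup (fun g => by
    rw [Commute, SemiconjBy, ← map_mul, ← map_mul, hP.central]) w).eq

omit [IsTopologicalGroup G] [CompactSpace G] in
lemma ofGroup_sub_one_central (k : ℕ) (w : IwasawaAlgebra p G) :
    (ofGroup p (P (p ^ (m + k))) - 1) * w = w * (ofGroup p (P (p ^ (m + k))) - 1) := by
  rw [sub_mul, mul_sub, pow_add, hP.ofGroup_central, one_mul, mul_one]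

/-- The subgroup `hP.level k` is topologically generated by `P (p ^ (m + k))`, so at each deeper
finite level the kernel is generated by that element minus one; compactness combines the levels. -/
lemma exists_eq_add_of_projModP (k : ℕ) {x : IwasawaAlgebra p G}
    (hx : projModP (hP.level k) x = 0) :
    ∃ y y', x = p * y + (ofGroup p (P (p ^ (m + k))) - 1) * y' := by
  have hT := hP.ofGroup_sub_one_central k
  set c := P (p ^ (m + k)) with hc
  obtain ⟨y, hy⟩ := levelIdeal_isFundamental.exists_eq_sum
      ![(p : IwasawaAlgebra p G), ofGroup p c - 1] x fun ⟨n, U⟩ => by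
    let W := U ⊓ hP.level k
    have hWU : W.toSubgroup ≤ U.toSubgroup := (inf_le_left : U ⊓ hP.level k ≤ U)
    have hWV : W.toSubgroup ≤ (hP.level k).toSubgroup :=
      (inf_le_right : U ⊓ hP.level k ≤ hP.level k)
    have h0 := mapDomain_projModP hWV x
    rw [hx] at h0
    obtain ⟨y', hy'⟩ := exists_eq_mul_single_sub_one _ (c : G ⧸ W.toSubgroup) (fun a b hab => by
      obtain ⟨a, rfl⟩ := QuotientGroup.mk_surjective a
      obtain ⟨b, rfl⟩ := QuotientGroup.mk_surjective b
      have hab' : (b : G ⧸ (hP.level k).toSubgroup) = a := hab.symm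
      obtain ⟨z, hz⟩ := hP.mem_level.mp (QuotientGroup.eq.mp hab')
      obtain ⟨i, hi⟩ := hP.exists_natCast W (m + k) z
      refine ⟨i, ?_⟩
      rw [← QuotientGroup.mk_pow, ← QuotientGroup.mk_mul, eq_comm, QuotientGroup.eq]
      rw [hz] at hi
      have : (b * c ^ i)⁻¹ * a = (c ^ i)⁻¹ * (b⁻¹ * a) := by group
      rw [this]
      exact hi) h0
    obtain ⟨v, rfl⟩ := projModP_surjective W y'
    have h1 : projModP W (x - (ofGroup p c - 1) * v) = 0 := by
      rw [hT, map_sub, map_mul, map_sub, map_one, projModP_ofGroup, hy', sub_self]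
    obtain ⟨w, hw⟩ := modP_eq_zero_iff.mp h1
    obtain ⟨w, rfl⟩ := proj_surjective W w
    refine ⟨![w, v], mem_levelIdeal.mpr ⟨0, ?_⟩⟩
    have h2 : proj W (x - ((p : IwasawaAlgebra p G) * w + (ofGroup p c - 1) * v)) = 0 := by
      have : x - ((p : IwasawaAlgebra p G) * w + (ofGroup p c - 1) * v) =
          x - (ofGroup p c - 1) * v - p * w := by abel
      rw [this, map_sub, hw, map_mul, map_natCast, sub_self]
    rw [mul_zero, Fin.sum_univ_two]
    simp only [Matrix.cons_val_zero, Matrix.cons_val_one]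
    rw [← mapDomain_proj hWU, h2, MonoidAlgebra.mapDomain_zero]
  refine ⟨y 0, y 1, ?_⟩
  rw [hy, Fin.sum_univ_two]
  rfl

omit [IsTopologicalGroup G] [CompactSpace G] in
lemma single_pow_pow (U : OpenNormalSubgroup G) (x : ℤ_[p]) : ∃ k : ℕ,
    (MonoidAlgebra.single (P x : G ⧸ U.toSubgroup) (1 : ZMod p)) ^ p ^ k = 1 := by
  obtain ⟨k, hk⟩ := hP.exists_pow_mem U
  refine ⟨k, ?_⟩
  have := hk x
  rw [hP.map_pow_mul, ← QuotientGroup.eq_one_iff, QuotientGroup.mk_pow] at this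
  rw [MonoidAlgebra.single_pow, this, one_pow, MonoidAlgebra.one_def]

omit [IsTopologicalGroup G] [CompactSpace G] in
lemma isNilpotent_projModP_sub_one (U : OpenNormalSubgroup G) (x : ℤ_[p]) :
    IsNilpotent (projModP U (ofGroup p (P x) - 1)) := by
  obtain ⟨k, hk⟩ := hP.single_pow_pow U x
  refine ⟨p ^ k, ?_⟩
  have : CharP (MonoidAlgebra (ZMod p) (G ⧸ U.toSubgroup)) p :=
    charP_of_injective_algebraMap (algebraMap (ZMod p) _).injective p
  rw [map_sub, map_one, projModP_ofGroup, sub_pow_char_pow_of_commute _ _ (Commute.one_right _),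
    hk, one_pow, sub_self]

/-- One level decides all: a power of `t` lies in the ideal of `p` and `P (p ^ (m + k)) - 1`, and
the latter is central and nilpotent modulo `p` at every level. -/
lemma isNilpotent_projModP {k : ℕ} {t : IwasawaAlgebra p G}
    (ht : IsNilpotent (projModP (hP.level k) t)) (U : OpenNormalSubgroup G) :
    IsNilpotent (projModP U t) := by
  obtain ⟨s, hs⟩ := ht
  rw [← map_pow] at hs
  obtain ⟨y, y', hy⟩ := hP.exists_eq_add_of_projModP k hs
  obtain ⟨l, hl⟩ := hP.isNilpotent_projModP_sub_one U (p ^ (m + k))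
  have hc : Commute (projModP U (ofGroup p (P (p ^ (m + k))) - 1)) (projModP U y') := by
    rw [Commute, SemiconjBy, ← map_mul, ← map_mul, hP.ofGroup_sub_one_central]
  refine ⟨s * l, ?_⟩
  rw [pow_mul, ← map_pow, hy, _root_.map_add, map_mul, projModP_p, zero_mul, zero_add, map_mul,
    hc.mul_pow, hl, zero_mul]

/-- `P (p ^ m) - 1` is regular modulo `p`. -/
lemma exists_eq_p_mul_of_mul {w u : IwasawaAlgebra p G}
    (h : (ofGroup p (P (p ^ m)) - 1) * w = p * u) : ∃ w', w = p * w' := by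
  refine exists_eq_p_mul fun U => ?_
  obtain ⟨k, hk⟩ := hP.exists_pow_mem U
  have hd : P (p ^ (m + k)) ∈ U.toSubgroup := by
    rw [pow_add, mul_comm]
    exact hk _
  -- The element `P (p ^ (m + k))` lies in `U` but not in `hP.level (k + 1)`, so in `G ⧸ W` its
  -- order is a nontrivial power of `p`. As `w` is invariant under it modulo `p`, its image at level
  -- `U` vanishes.
  let W := U ⊓ hP.level (k + 1)
  have hWU : W.toSubgroup ≤ U.toSubgroup := (inf_le_left : U ⊓ hP.level (k + 1) ≤ U)
  have hWV : W.toSubgroup ≤ (hP.level (k + 1)).toSubgroup :=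
    (inf_le_right : U ⊓ hP.level (k + 1) ≤ hP.level (k + 1))
  rw [← mapDomain_projModP hWU w]
  refine mapDomain_eq_zero_of_invariant _ (P (p ^ (m + k)) : G ⧸ W.toSubgroup)
    ((QuotientGroup.eq_one_iff _).mpr hd) ?_ ?_
  · obtain ⟨l, hl⟩ := hP.exists_pow_mem W
    have h1 : (P (p ^ (m + k)) : G ⧸ W.toSubgroup) ^ p ^ l = 1 := by
      rw [← QuotientGroup.mk_pow, QuotientGroup.eq_one_iff, ← hP.map_pow_mul]
      exact hl _
    obtain ⟨i, -, hi⟩ := (Nat.dvd_prime_pow Fact.out).mp (orderOf_dvd_of_pow_eq_one h1)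
    rcases i with _ | i
    · exfalso
      rw [pow_zero, orderOf_eq_one_iff, QuotientGroup.eq_one_iff] at hi
      obtain ⟨x, hx⟩ := hP.mem_level.mp (hWV hi)
      have h2 : P (p ^ (m + (k + 1)) * x - p ^ (m + k)) = 1 := by
        rw [sub_eq_add_neg, hP.map_add, hP.map_neg, hx, mul_inv_cancel]
      have h3 := hP.injective h2
      have h4 : (p : ℤ_[p]) ^ (m + k) * (p * x - 1) = 0 := by
        rw [← h3]; ring
      have hp0 : (p : ℤ_[p]) ≠ 0 := Nat.cast_ne_zero.mpr (Fact.out : p.Prime).ne_zero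
      have h5 : (p : ℤ_[p]) * x = 1 :=
        sub_eq_zero.mp ((mul_eq_zero.mp h4).resolve_left (pow_ne_zero _ hp0))
      exact PadicInt.p_nonunit (IsUnit.of_mul_eq_one _ h5)
    · rw [hi]; exact dvd_pow_self _ (Nat.succ_ne_zero i)
  · have h1 : projModP W (ofGroup p (P (p ^ m))) * projModP W w = projModP W w := by
      have := congrArg (projModP W) h
      rwa [map_mul, map_mul, projModP_p, zero_mul, map_sub, map_one, sub_mul, one_mul,
        sub_eq_zero] at this
    have h2 : ∀ i : ℕ, projModP W (ofGroup p (P (p ^ m))) ^ i * projModP W w = projModP W w :=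
      fun i => by
        induction i with
        | zero => rw [pow_zero, one_mul]
        | succ i ih => rw [pow_succ, mul_assoc, h1, ih]
    have h3 := h2 (p ^ k)
    rwa [← map_pow, ← map_pow, ← hP.map_pow_mul, ← pow_add, add_comm, projModP_ofGroup] at h3

/-- Central elements lift to central elements. -/
lemma exists_central_lift [H.Normal] (k : ℕ)
    {x : MonoidAlgebra (ZMod p) (G ⧸ (hP.level k).toSubgroup)} (hx : ∀ y, x * y = y * x) :
    ∃ w : IwasawaAlgebra p G, (∀ y, w * y = y * w) ∧ projModP (hP.level k) w = x := by
  have := Fintype.ofFinite (G ⧸ (hP.level k).toSubgroup)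
  obtain ⟨s, hs, hsc⟩ := exists_equivariant_section H (hP.level k).toSubgroup
    (fun g hg hH => hP.level_inf k hg hH) hP.commutator_mem
  let a : ZMod p → IwasawaAlgebra p G := fun r => (r.val : IwasawaAlgebra p G)
  have hcl : ∀ (y : G) c, x.coeff ((y : G ⧸ (hP.level k).toSubgroup) * c *
      (y : G ⧸ (hP.level k).toSubgroup)⁻¹) = x.coeff c := fun y c => by
    have := congrArg (fun z => z.coeff ((y : G ⧸ (hP.level k).toSubgroup) * c))
      (hx (MonoidAlgebra.single (y : G ⧸ (hP.level k).toSubgroup) 1))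
    simpa [MonoidAlgebra.coeff_single_mul_apply, MonoidAlgebra.coeff_mul_single_apply] using this
  -- The coefficients of `x` form a class function and the section commutes with conjugation by `G`,
  -- so conjugating this sum only permutes its terms.
  refine ⟨∑ c, a (x.coeff c) * ofGroup p (s c), fun y => ?_, ?_⟩
  · refine (commute_of_forall_ofGroup (fun g => ?_) y).eq
    rw [Commute, SemiconjBy, Finset.sum_mul, Finset.mul_sum]
    symm
    refine Fintype.sum_equiv
      (MulAut.conj (g : G ⧸ (hP.level k).toSubgroup)).toEquiv _ _ fun c => ?_
    change _ = a (x.coeff ((g : G ⧸ (hP.level k).toSubgroup) * c *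
      (g : G ⧸ (hP.level k).toSubgroup)⁻¹)) * ofGroup p (s _) * ofGroup p g
    rw [hcl]
    change _ = a (x.coeff c) * ofGroup p (s ((g : G ⧸ (hP.level k).toSubgroup) * c *
      (g : G ⧸ (hP.level k).toSubgroup)⁻¹)) * ofGroup p g
    rw [hsc, mul_assoc, ← map_mul, inv_mul_cancel_right, map_mul, ← mul_assoc, ← mul_assoc,
      (Nat.cast_commute _ _).eq]
  · have ha : ∀ r, projModP (hP.level k) (a r) = algebraMap (ZMod p) _ r := fun r => by
      rw [map_natCast, ← map_natCast (algebraMap (ZMod p) _), ZMod.natCast_zmod_val]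
    rw [map_sum]
    simp only [map_mul, ha, projModP_ofGroup, hs]
    ext c
    rw [MonoidAlgebra.coeff_sum, Finsupp.finsetSum_apply, Finset.sum_eq_single c]
    · simp
    · intro b _ hb
      simp [hb]
    · simp

end IsSemidirect

lemma exists_eq_p_mul_of_forall_pow {t x : IwasawaAlgebra p G}
    (ht : ∀ U, IsNilpotent (projModP U t)) (hx : ∀ n : ℕ, ∃ y y', x = p * y + t ^ n * y') :
    ∃ y, x = p * y := by
  refine exists_eq_p_mul fun U => ?_
  obtain ⟨n, hn⟩ := ht U
  obtain ⟨y, y', rfl⟩ := hx n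
  rw [map_add, map_mul, projModP_p, zero_mul, zero_add, map_mul, map_pow, hn, zero_mul]

end IwasawaAlgebra

/-! ### The complement of `e_N` and the consequences of maximality -/

section Complement

variable {p : ℕ} [Fact p.Prime] {G : Type u} [Group G] [TopologicalSpace G]

lemma toFractions_injective {A : Type u} [Ring A] :
    Function.Injective (toFractions : A →+* TotalFractions A) :=
  OreLocalization.numeratorHom_inj fun _ hs => hs.2.1

lemma toFractions_commute {A : Type u} [Ring A] {a : A} (ha : ∀ b, a * b = b * a)
    (x : TotalFractions A) : toFractions a * x = x * toFractions a :=
  (fraction_commute (fun b => ha b) 1 x).eq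

section Corner

variable {A : Type u} [Ring A] {e : A} (he : IsIdempotentElem e) (hc : ∀ x, Commute e x)

lemma val_toCorner (x : A) : (toCorner he hc x).1 = e * x := by
  change e * x * e = e * x
  rw [mul_assoc, ← (hc x).eq, ← mul_assoc, he.eq]

lemma toCorner_commute {x : A} (hx : ∀ y, x * y = y * x) (y : he.Corner) :
    toCorner he hc x * y = y * toCorner he hc x := by
  apply Subtype.ext
  change (toCorner he hc x).1 * y.1 = y.1 * (toCorner he hc x).1
  rw [val_toCorner, mul_assoc, hx, ← mul_assoc, ← mul_assoc, (hc y.1).eq]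

end Corner

variable {N : Subgroup G} [Finite N]

lemma exists_idempotent
    (hmem : traceIdempotent p N ∈ (toFractions : IwasawaAlgebra p G →+* _).range) :
    ∃ e : IwasawaAlgebra p G, toFractions e = traceIdempotent p N ∧ e * e = e ∧
      Nat.card N * e = sumElement p N := by
  obtain ⟨e, he⟩ := hmem
  refine ⟨e, he, ?_, ?_⟩
  · apply toFractions_injective
    rw [map_mul, he, (traceIdempotent_idem p N).eq]
  · apply toFractions_injective
    rw [map_mul, he]
    exact (OreLocalization.mul_cancel (S := centralRegular (IwasawaAlgebra p G))
      (r := sumElement p N) (t := 1)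
      (s := ⟨_, natCast_mem_centralRegular p (Nat.card_pos (α := N)).ne'⟩))

variable [N.Normal]

lemma val_toComplement (x : IwasawaAlgebra p G) :
    (toComplement p N x).1 =
      (1 - traceIdempotent p N) * toFractions x :=
  val_toCorner (traceIdempotent_idem p N).one_sub
    (fun x => (Commute.one_left x).sub_left (traceIdempotent_commute p N x)) (toFractions x)

lemma idempotent_commute {e : IwasawaAlgebra p G} (he : toFractions e = traceIdempotent p N)
    (x : IwasawaAlgebra p G) : e * x = x * e := by
  apply toFractions_injective
  rw [map_mul, map_mul, he, (traceIdempotent_commute p N _).eq]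

lemma toComplement_eq_zero_iff {e : IwasawaAlgebra p G}
    (he : toFractions e = traceIdempotent p N) (x : IwasawaAlgebra p G) :
    toComplement p N x = 0 ↔ e * x = x := by
  have h0 : toComplement p N x = 0 ↔ (toComplement p N x).1 = 0 := Subtype.ext_iff
  rw [h0, val_toComplement, ← he, ← map_one toFractions, ← map_sub, ← map_mul,
    map_eq_zero_iff _ toFractions_injective, sub_mul, one_mul, sub_eq_zero, eq_comm]

lemma isUnit_toComplement {s : IwasawaAlgebra p G} (hs : s ∈ centralRegular (IwasawaAlgebra p G)) :
    IsUnit (toComplement p N s) := by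
  have h : IsUnit (toFractions s : TotalFractions (IwasawaAlgebra p G)) :=
    OreLocalization.numerator_isUnit (⟨s, hs⟩ : centralRegular (IwasawaAlgebra p G))
  exact h.map (toCorner (traceIdempotent_idem p N).one_sub
    fun x => (Commute.one_left x).sub_left (traceIdempotent_commute p N x))

lemma toComplement_commute {x : IwasawaAlgebra p G} (hx : ∀ y, x * y = y * x)
    (y : ComplementAlgebra p N) : toComplement p N x * y = y * toComplement p N x :=
  toCorner_commute (traceIdempotent_idem p N).one_sub
    (fun x => (Commute.one_left x).sub_left (traceIdempotent_commute p N x))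
    (toFractions_commute hx) y

lemma ofSubgroup_commute {Γ₀ : Subgroup G} (hc : Γ₀ ≤ Subgroup.center G)
    (r : IwasawaAlgebra p Γ₀) (x : IwasawaAlgebra p G) :
    ofSubgroup p Γ₀ r * x = x * ofSubgroup p Γ₀ r := by
  refine (commute_of_forall_ofGroup (fun g => proj_ext fun U => ?_) x).eq
  rw [map_mul, map_mul, proj_ofGroup]
  have hsub : Continuous Γ₀.subtype := continuous_subtype_val
  have key : ∀ y : MonoidAlgebra ℤ_[p] (Γ₀ ⧸ (comapOpenNormal Γ₀.subtype
      hsub U).toSubgroup),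
      Commute (MonoidAlgebra.mapDomain (QuotientGroup.map (comapOpenNormal Γ₀.subtype
        hsub U).toSubgroup U.toSubgroup Γ₀.subtype le_rfl) y)
        (MonoidAlgebra.single (g : G ⧸ U.toSubgroup) 1) := fun y => by
    induction y using MonoidAlgebra.induction_linear with
    | zero => rw [MonoidAlgebra.mapDomain_zero]; exact Commute.zero_left _
    | add a b ha hb => rw [MonoidAlgebra.mapDomain_add]; exact ha.add_left hb
    | single h s =>
      obtain ⟨h, rfl⟩ := QuotientGroup.mk_surjective h
      rw [MonoidAlgebra.mapDomain_single]
      change Commute (MonoidAlgebra.single ((h : G) : G ⧸ U.toSubgroup) s) _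
      rw [Commute, SemiconjBy,
        MonoidAlgebra.single_mul_single, MonoidAlgebra.single_mul_single, mul_one, one_mul,
        ← QuotientGroup.mk_mul, ← QuotientGroup.mk_mul]
      congr 2
      exact (Subgroup.mem_center_iff.mp (hc h.2) g).symm
  exact (key (r.1 (comapOpenNormal Γ₀.subtype hsub U))).eq

/-- A ring extension of `Λ(G)(1 - e_N)` that is finitely generated as a right module coincides with
it, if `Λ(G)(1 - e_N)` is a maximal order. -/
lemma eq_complementOrder {Γ₀ : Subgroup G} (hc : Γ₀ ≤ Subgroup.center G)
    (hmax : IsMaximalOrder (structureHom p N Γ₀) (complementOrder p N))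
    {L : Subring (ComplementAlgebra p N)} (hL : complementOrder p N ≤ L) {ι : Type*} [Fintype ι]
    (w : ι → ComplementAlgebra p N) (hw : ∀ i, w i ∈ L)
    (hspan : ∀ x ∈ L, ∃ y : ι → ComplementAlgebra p N, (∀ i, y i ∈ complementOrder p N) ∧
      x = ∑ i, w i * y i) : L = complementOrder p N := by
  classical
  refine hmax.eq_of_le L ⟨hmax.isOrder.range_le.trans hL, ?_, fun a => ?_⟩ hL
  · obtain ⟨s, hs⟩ := hmax.isOrder.finite
    have hsL : ∀ x ∈ s, x ∈ complementOrder p N := fun x hx => by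
      have : x ∈ (Submodule.span (structureHom p N Γ₀).range (s : Set (ComplementAlgebra p N)) :
        Set (ComplementAlgebra p N)) := Submodule.subset_span hx
      rwa [hs] at this
    -- Generators of the order over `Λ(Γ₀)` multiplied by the `w i` generate `L`; scalars pass
    -- through the `w i` because `Γ₀` is central.
    refine ⟨(Finset.univ ×ˢ s).image fun a => w a.1 * a.2, Set.Subset.antisymm ?_ fun x hx => ?_⟩
    · have hsmul : ∀ r ∈ (structureHom p N Γ₀).range, r ∈ L := fun r hr =>
        hL (hmax.isOrder.range_le hr)
      let LM : Submodule (structureHom p N Γ₀).range (ComplementAlgebra p N) :=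
        { L.toAddSubgroup with
          smul_mem' := fun r x hx => L.mul_mem (hsmul r.1 r.2) hx }
      refine (Submodule.span_le (p := LM)).mpr ?_
      intro x hx
      obtain ⟨a, ha, rfl⟩ := Finset.mem_image.mp (Finset.mem_coe.mp hx)
      exact L.mul_mem (hw _) (hL (hsL _ (Finset.mem_product.mp ha).2))
    · obtain ⟨y, hy, rfl⟩ := hspan x hx
      refine Submodule.sum_mem _ fun i _ => ?_
      have hyi : y i ∈ Submodule.span (structureHom p N Γ₀).range
          (s : Set (ComplementAlgebra p N)) := by
        rw [← SetLike.mem_coe, hs]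
        exact hy i
      refine Submodule.span_induction (p := fun z _ => w i * z ∈ Submodule.span
        (structureHom p N Γ₀).range _) (fun z hz => ?_) ?_ (fun z z' _ _ hz hz' => ?_)
        (fun r z _ hz => ?_) hyi
      · exact Submodule.subset_span (Finset.mem_coe.mpr (Finset.mem_image.mpr
          ⟨(i, z), Finset.mem_product.mpr ⟨Finset.mem_univ _, hz⟩, rfl⟩))
      · rw [mul_zero]; exact Submodule.zero_mem _
      · rw [mul_add]; exact Submodule.add_mem _ hz hz'
      · have : w i * (r • z) = r • (w i * z) := by
          obtain ⟨r, r, rfl⟩ := r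
          change w i * (structureHom p N Γ₀ r * z) = structureHom p N Γ₀ r * (w i * z)
          rw [← mul_assoc, ← mul_assoc]
          congr 1
          exact (toComplement_commute (ofSubgroup_commute hc r) (w i)).symm
        rw [this]
        exact Submodule.smul_mem _ _ hz
  · obtain ⟨r, hr, h⟩ := hmax.isOrder.full a
    exact ⟨r, hr, hL h⟩

/-- A subring without proper extensions that are finitely generated as right modules. -/
def IsFinitelyClosed {R : Type*} [Ring R] (X : Subring R) : Prop :=
  ∀ (L : Subring R) (d : ℕ) (w : Fin d → R), X ≤ L → (∀ i, w i ∈ L) →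
    (∀ x ∈ L, ∃ y : Fin d → R, (∀ i, y i ∈ X) ∧ x = ∑ i, w i * y i) → L = X

lemma IsMaximalOrder.isFinitelyClosed {Γ₀ : Subgroup G} (hc : Γ₀ ≤ Subgroup.center G)
    (hmax : IsMaximalOrder (structureHom p N Γ₀) (complementOrder p N)) :
    IsFinitelyClosed (complementOrder p N) :=
  fun _ _ w hL hw hspan => eq_complementOrder hc hmax hL w hw hspan

/-- An idealizer argument: a two-sided ideal `𝒴` with `𝒴² ⊆ p𝒴` and `p ∈ 𝒴` lies in the ideal
generated by `p` if the ring is finitely closed in an overring where `p` is invertible. -/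
lemma IsFinitelyClosed.exists_map_eq_p_mul {A R : Type*} [Ring A] [Ring R] {q : A →+* R}
    (hX : IsFinitelyClosed q.range) {p : ℕ} (hpu : IsUnit (p : R)) {r : ℕ}
    (y : Fin r → A) (hp : ∃ c : Fin r → A, (p : A) = ∑ i, y i * c i)
    (hy : ∀ c c' : Fin r → A, ∃ d : Fin r → A,
      (∑ i, y i * c i) * (∑ i, y i * c' i) = p * ∑ i, y i * d i) (i : Fin r) :
    ∃ x, q (y i) = q (p * x) := by
  obtain ⟨π, hπ⟩ := hpu
  have hpc : ∀ x : R, (p : R) * x = x * p := fun x =>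
    (Nat.cast_commute p x).eq
  have hcancel : ∀ x x' : R, (p : R) * x = p * x' → x = x' := fun x x' h => by
    rw [← hπ] at h
    exact (Units.mul_right_inj π).mp h
  -- `L` is `p⁻¹ 𝒴`: it is closed under products because `𝒴² ⊆ p 𝒴`, contains the image of `A`
  -- because `p ∈ 𝒴`, and is generated as a right module by the `p⁻¹ y i`. Finite closedness then
  -- identifies it with that image.
  let L : Subring R :=
    { carrier := {x | ∃ c : Fin r → A, p * x = q (∑ i, y i * c i)}
      mul_mem' := by
        rintro x x' ⟨c, h⟩ ⟨c', h'⟩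
        obtain ⟨d, hd⟩ := hy c c'
        refine ⟨d, hcancel _ _ ?_⟩
        have : (p : R) * (p * (x * x')) = (p * x) * (p * x') := by
          rw [mul_assoc _ x, ← mul_assoc x _ x', ← hpc x, mul_assoc _ x x']
        rw [this, h, h', ← map_mul, hd, map_mul, map_natCast]
      one_mem' := by
        obtain ⟨c, hc⟩ := hp
        exact ⟨c, by rw [← hc, map_natCast, mul_one]⟩
      add_mem' := by
        rintro x x' ⟨c, h⟩ ⟨c', h'⟩
        refine ⟨c + c', ?_⟩
        rw [mul_add, h, h', ← map_add, ← Finset.sum_add_distrib]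
        simp only [Pi.add_apply, mul_add]
      zero_mem' := ⟨0, by simp⟩
      neg_mem' := by
        rintro x ⟨c, h⟩
        refine ⟨-c, ?_⟩
        rw [mul_neg, h, ← map_neg, ← Finset.sum_neg_distrib]
        simp only [Pi.neg_apply, mul_neg] }
  have hLX : q.range ≤ L := by
    rintro _ ⟨x, rfl⟩
    obtain ⟨c, hc⟩ := hp
    refine ⟨fun i => c i * x, ?_⟩
    simp only [← mul_assoc]
    rw [← Finset.sum_mul, ← hc, map_mul, map_natCast]
  have hwy : ∀ i, (p : R) * ((π⁻¹ : Rˣ) * q (y i)) = q (y i) := fun i => by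
    rw [← hπ, Units.mul_inv_cancel_left]
  have hL := hX L r (fun i => (π⁻¹ : Rˣ) * q (y i)) hLX (fun i => by
      refine ⟨Pi.single i 1, ?_⟩
      rw [hwy, Finset.sum_eq_single i]
      · rw [Pi.single_eq_same, mul_one]
      · intro j _ hj
        rw [Pi.single_eq_of_ne hj, mul_zero]
      · simp)
    (fun x ⟨c, h⟩ => by
      refine ⟨fun i => q (c i), fun i => ⟨c i, rfl⟩, hcancel _ _ ?_⟩
      rw [h, map_sum, Finset.mul_sum]
      refine Finset.sum_congr rfl fun i _ => ?_
      rw [← mul_assoc, hwy, map_mul])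
  have hi : (π⁻¹ : Rˣ) * q (y i) ∈ L := by
    refine ⟨Pi.single i 1, ?_⟩
    rw [hwy, Finset.sum_eq_single i]
    · rw [Pi.single_eq_same, mul_one]
    · intro j _ hj
      rw [Pi.single_eq_of_ne hj, mul_zero]
    · simp
  rw [hL] at hi
  obtain ⟨x, hx⟩ := hi
  refine ⟨x, ?_⟩
  rw [map_mul, map_natCast, hx, hwy]

/-- The element `(1 - e) * b + e` agrees with `b` on the complement and is the identity on the part
of `e`, so centrality and regularity hold in all of `A`. This makes `q b` invertible in the ring of
fractions. -/
lemma exists_centralRegular_lift {A : Type u} {R : Type v} [Ring A] [Ring R] {q : A →+* R} {e : A}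
    (hee : e * e = e) (hec : ∀ x, e * x = x * e) (hqe : ∀ x, q x = 0 ↔ e * x = x) {b : A}
    (hb : ∀ x, q b * q x = q x * q b) (hb0 : ∀ x, q b * q x = 0 → q x = 0) :
    ∃ s ∈ centralRegular A, q s = q b := by
  have hqe1 : q e = 0 := (hqe e).mpr hee
  have hqinj : ∀ x, q x = 0 → (1 - e) * x = 0 := fun x hx => by
    rw [sub_mul, one_mul, (hqe x).mp hx, sub_self]
  have hsq : q ((1 - e) * b + e) = q b := by
    rw [map_add, map_mul, map_sub, map_one, hqe1, sub_zero, one_mul, add_zero]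
  have hcen : ∀ x, ((1 - e) * b + e) * x = x * ((1 - e) * b + e) := fun x => by
    have h1 : q (b * x - x * b) = 0 := by
      rw [map_sub, map_mul, map_mul, sub_eq_zero, hb]
    have h2 := hqinj _ h1
    rw [mul_sub, sub_eq_zero] at h2
    have h3 : (1 - e) * x = x * (1 - e) := by rw [sub_mul, mul_sub, hec, one_mul, mul_one]
    rw [add_mul, mul_add, hec, mul_assoc, h2, ← mul_assoc, ← mul_assoc, h3]
  have hreg : ∀ x, ((1 - e) * b + e) * x = 0 → x = 0 := fun x hx => by
    have h1 : q x = 0 := hb0 x (by rw [← hsq, ← map_mul, hx, map_zero])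
    have h3 := (hqe x).mp h1
    have h4 : e * (((1 - e) * b + e) * x) = e * x := by
      rw [← mul_assoc, mul_add, ← mul_assoc, mul_sub, mul_one, hee, sub_self, zero_mul, zero_add]
    rw [hx, mul_zero, h3] at h4
    exact h4.symm
  exact ⟨_, ⟨Submonoid.mem_center_iff.mpr fun x => (hcen x).symm, mem_nonZeroDivisors_iff.mpr
      ⟨hreg, fun x hx => hreg x (by rw [hcen, hx])⟩⟩, hsq⟩

/-- If a subring `X` has no proper finite ring extensions in `R`, then central elements of `X` are
divisible as soon as the quotient is integral. -/
lemma IsFinitelyClosed.exists_eq_mul_of_integral {R : Type v} [Ring R] {X : Subring R}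
    (hX : IsFinitelyClosed X) {a b : X} (ha : ∀ x, a * x = x * a) (hb : ∀ x : R, (b : R) * x = x * b) (hbu : IsUnit (b : R))
    {d : ℕ} (hd : 0 < d) (c : ℕ → X)
    (h : a ^ d = ∑ i ∈ Finset.range d, c i * a ^ i * b ^ (d - i)) : ∃ w, a = b * w := by
  obtain ⟨β, hβ⟩ := hbu
  have hβc : ∀ x : R, (β : R) * x = x * β := fun x => by rw [hβ, hb]
  obtain ⟨w, hw⟩ : ∃ w : R, w = (β⁻¹ : Rˣ) * a := ⟨_, rfl⟩
  have hβw : (β : R) * w = a := by rw [hw, Units.mul_inv_cancel_left]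
  have hwx : ∀ x ∈ X, w * x = x * w := fun x hx => by
    have h1 : (a : R) * x = x * a := congrArg Subtype.val (ha ⟨x, hx⟩)
    apply (Units.mul_right_inj β).mp
    rw [← mul_assoc, hβw, h1, ← mul_assoc, hβc, mul_assoc, hβw]
  have hpow : ∀ n : ℕ, (β : R) ^ n * w ^ n = (a : R) ^ n := fun n => by
    have : Commute (β : R) w := hβc w
    rw [← this.mul_pow, hβw]
  have hwd : w ^ d = ∑ i ∈ Finset.range d, w ^ i * (c i : R) := by
    apply (Units.mul_right_inj (β ^ d)).mp
    rw [Units.val_pow_eq_pow_val, hpow]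
    have h1 := congrArg Subtype.val h
    rw [Subring.coe_pow, AddSubmonoidClass.coe_finsetSum] at h1
    rw [h1, Finset.mul_sum]
    refine Finset.sum_congr rfl fun i hi => ?_
    rw [Subring.coe_mul, Subring.coe_mul, Subring.coe_pow, Subring.coe_pow, ← hpow i, ← hβ]
    have h2 : ∀ (n : ℕ) (x : R), (β : R) ^ n * x = x * (β : R) ^ n := fun n x =>
      (Commute.pow_left (hβc x : Commute (β : R) x) n).eq
    have h3 : ∀ n : ℕ, w ^ n * (c i : R) = c i * w ^ n := fun n =>
      (Commute.pow_left (hwx _ (c i).2 : Commute w (c i)) n).eq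
    rw [h3, mul_assoc, ← h2 (d - i), ← mul_assoc ((β : R) ^ (d - i)), ← pow_add,
      Nat.sub_add_cancel (Finset.mem_range.mp hi).le, ← mul_assoc, ← h2, mul_assoc]
  let C : AddSubgroup R :=
    { carrier := {x | ∃ f : Fin d → R, (∀ i, f i ∈ X) ∧ x = ∑ i : Fin d, w ^ (i : ℕ) * f i}
      add_mem' := by
        rintro _ _ ⟨f, hf, rfl⟩ ⟨f', hf', rfl⟩
        refine ⟨f + f', fun i => add_mem (hf i) (hf' i), ?_⟩
        simp only [Pi.add_apply, mul_add, Finset.sum_add_distrib]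
      zero_mem' := ⟨0, fun i => zero_mem _, by simp⟩
      neg_mem' := by
        rintro _ ⟨f, hf, rfl⟩
        exact ⟨-f, fun i => neg_mem (hf i), by simp⟩ }
  have hCi : ∀ i : Fin d, ∀ x ∈ X, w ^ (i : ℕ) * x ∈ C := fun i x hx => by
    refine ⟨Pi.single i x, fun j => ?_, ?_⟩
    · rcases eq_or_ne j i with rfl | hj
      · rwa [Pi.single_eq_same]
      · rw [Pi.single_eq_of_ne hj]; exact zero_mem _
    · rw [Finset.sum_eq_single i]
      · rw [Pi.single_eq_same]
      · intro j _ hj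
        rw [Pi.single_eq_of_ne hj, mul_zero]
      · simp
  have hCX : ∀ z ∈ C, ∀ x ∈ X, z * x ∈ C := by
    rintro _ ⟨f, hf, rfl⟩ x hx
    rw [Finset.sum_mul]
    refine C.sum_mem fun i _ => ?_
    rw [mul_assoc]
    exact hCi i _ (mul_mem (hf i) hx)
  have hCd : ∀ x ∈ X, w ^ d * x ∈ C := fun x hx => by
    rw [hwd, Finset.sum_mul]
    refine C.sum_mem fun i hi => ?_
    rw [mul_assoc]
    exact hCi ⟨i, Finset.mem_range.mp hi⟩ _ (mul_mem (c i).2 hx)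
  have hCw : ∀ z ∈ C, w * z ∈ C := by
    rintro _ ⟨f, hf, rfl⟩
    rw [Finset.mul_sum]
    refine C.sum_mem fun i _ => ?_
    rw [← mul_assoc, ← pow_succ']
    rcases Nat.lt_or_ge ((i : ℕ) + 1) d with hid | hid
    · exact hCi ⟨i + 1, hid⟩ _ (hf i)
    · have : (i : ℕ) + 1 = d := le_antisymm i.2 hid
      rw [this]
      exact hCd _ (hf i)
  have hCwn : ∀ n : ℕ, ∀ z ∈ C, w ^ n * z ∈ C := fun n z hz => by
    induction n with
    | zero => rwa [pow_zero, one_mul]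
    | succ n ih => rw [pow_succ', mul_assoc]; exact hCw _ ih
  have hXC : ∀ x ∈ X, x ∈ C := fun x hx => by
    have := hCi ⟨0, hd⟩ x hx
    rwa [pow_zero, one_mul] at this
  let L : Subring R :=
    { C with
      one_mem' := hXC 1 (one_mem _)
      mul_mem' := by
        rintro _ z ⟨f, hf, rfl⟩ hz
        change _ ∈ C
        rw [Finset.sum_mul]
        refine C.sum_mem fun i _ => ?_
        rw [mul_assoc]
        refine hCwn _ _ ?_
        obtain ⟨f', hf', rfl⟩ := hz
        rw [Finset.mul_sum]
        refine C.sum_mem fun j _ => ?_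
        have : Commute w (f i) := hwx _ (hf i)
        rw [← mul_assoc, ← (this.pow_left _).eq, mul_assoc]
        exact hCi j _ (mul_mem (hf i) (hf' j)) }
  have hL : L = X := hX L d (fun i : Fin d => w ^ (i : ℕ)) hXC (fun i => by
      have := hCi i 1 (one_mem _)
      rw [mul_one] at this
      exact this) (fun x hx => hx)
  have hwL : w ∈ L := by
    have := hCw _ (hXC 1 (one_mem _))
    rwa [mul_one] at this
  rw [hL] at hwL
  refine ⟨⟨w, hwL⟩, Subtype.ext ?_⟩
  rw [Subring.coe_mul, ← hβ, hβw]

/-- A maximal order is integrally closed in its total ring of fractions, with respect to central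
elements. -/
lemma IsHybrid.exists_eq_mul_of_integral {Γ₀ : Subgroup G} (hc : Γ₀ ≤ Subgroup.center G)
    (hybrid : IsHybrid p N Γ₀) {a b : complementOrder p N} (ha : ∀ x, a * x = x * a)
    (hb : ∀ x, b * x = x * b) (hb0 : ∀ x, b * x = 0 → x = 0) {d : ℕ} (hd : 0 < d)
    (c : ℕ → complementOrder p N) (h : a ^ d = ∑ i ∈ Finset.range d, c i * a ^ i * b ^ (d - i)) :
    ∃ w, a = b * w := by
  obtain ⟨e, he, hee, -⟩ := exists_idempotent hybrid.mem
  obtain ⟨b', hb'⟩ := b.2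
  obtain ⟨s, hs, hsb⟩ := exists_centralRegular_lift hee (idempotent_commute he)
    (toComplement_eq_zero_iff he) (b := b')
    (fun x => by
      rw [hb']
      exact congrArg Subtype.val (hb ⟨toComplement p N x, x, rfl⟩))
    (fun x hx => by
      rw [hb'] at hx
      exact congrArg Subtype.val (hb0 ⟨toComplement p N x, x, rfl⟩ (Subtype.ext hx)))
  refine (hybrid.isMaximalOrder.isFinitelyClosed hc).exists_eq_mul_of_integral
    ha (fun x => ?_) ?_ hd c h
  · rw [← hb', ← hsb]
    exact toComplement_commute (fun y => (Submonoid.mem_center_iff.mp hs.1 y).symm) x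
  · rw [← hb', ← hsb]
    exact isUnit_toComplement hs

end Complement

/-! ### Semisimplicity of the complement in `𝔽_p[H]` -/

section FiniteRing

instance {k M : Type*} [Semiring k] [Finite k] [Finite M] : Finite (MonoidAlgebra k M) :=
  Finite.of_injective (fun x (m : M) => x.coeff m) fun x y h => by
    ext m
    exact congrFun h m

lemma isNilpotent_of_mem_jacobson {R : Type*} [Ring R] [Finite R] {x : R}
    (hx : x ∈ Ring.jacobson R) : IsNilpotent x := by
  obtain ⟨n, hn⟩ := IsSemiprimaryRing.isNilpotent (R := R)
  have := Ideal.pow_mem_pow hx n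
  rw [hn] at this
  exact ⟨n, this⟩

end FiniteRing

section FiniteSubgroup

variable {p : ℕ} [Fact p.Prime] {G : Type u} [Group G] [TopologicalSpace G] {H : Subgroup G}

variable (p H) in
/-- The homomorphism `ℤ_p[H] → Λ(G)`. -/
noncomputable def ofGroupAlgebra : MonoidAlgebra ℤ_[p] H →ₐ[ℤ_[p]] IwasawaAlgebra p G :=
  MonoidAlgebra.lift ℤ_[p] (IwasawaAlgebra p G) H ((ofGroup p).comp H.subtype)

lemma ofGroupAlgebra_single (h : H) (r : ℤ_[p]) :
    ofGroupAlgebra p H (MonoidAlgebra.single h r) = algebraMap _ _ r * ofGroup p (h : G) := by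
  rw [ofGroupAlgebra, MonoidAlgebra.lift_single, Algebra.smul_def]
  rfl

/-- The homomorphism `k[H] → k[G/U]`. -/
noncomputable def levelHom (k : Type*) [CommRing k] (H : Subgroup G) (U : OpenNormalSubgroup G) :
    MonoidAlgebra k H →+* MonoidAlgebra k (G ⧸ U.toSubgroup) :=
  MonoidAlgebra.mapDomainRingHom k ((QuotientGroup.mk' U.toSubgroup).comp H.subtype)

lemma levelHom_single {k : Type*} [CommRing k] (U : OpenNormalSubgroup G) (h : H) (r : k) :
    levelHom k H U (MonoidAlgebra.single h r) =
      MonoidAlgebra.single ((h : G) : G ⧸ U.toSubgroup) r :=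
  MonoidAlgebra.mapDomain_single

lemma levelHom_injective {k : Type*} [CommRing k] {U : OpenNormalSubgroup G}
    (hU : ∀ g ∈ U.toSubgroup, g ∈ H → g = 1) : Function.Injective (levelHom k H U) := by
  refine MonoidAlgebra.mapDomain_injective ?_
  refine (injective_iff_map_eq_one ((QuotientGroup.mk' U.toSubgroup).comp H.subtype)).mpr ?_
  intro h hh
  exact Subtype.ext (hU _ ((QuotientGroup.eq_one_iff (h : G)).mp hh) h.2)

lemma proj_ofGroupAlgebra (U : OpenNormalSubgroup G) (x : MonoidAlgebra ℤ_[p] H) :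
    proj U (ofGroupAlgebra p H x) = levelHom ℤ_[p] H U x := by
  induction x using MonoidAlgebra.induction_linear with
  | zero => simp only [map_zero]
  | add a b ha hb => rw [map_add, map_add, map_add, ha, hb]
  | single h r =>
    rw [ofGroupAlgebra_single, map_mul, proj_ofGroup, proj_algebraMap, levelHom_single,
      MonoidAlgebra.single_mul_single, one_mul, mul_one]

lemma projModP_ofGroupAlgebra (U : OpenNormalSubgroup G) (x : MonoidAlgebra ℤ_[p] H) :
    projModP U (ofGroupAlgebra p H x) = levelHom (ZMod p) H U (modP p H x) := by
  rw [projModP, RingHom.comp_apply, proj_ofGroupAlgebra]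
  induction x using MonoidAlgebra.induction_linear with
  | zero => simp only [map_zero]
  | add a b ha hb => rw [map_add, map_add, map_add, map_add, ha, hb]
  | single h r => rw [levelHom_single, modP_single, modP_single, levelHom_single]

lemma ofGroupAlgebra_injective {U : OpenNormalSubgroup G}
    (hU : ∀ g ∈ U.toSubgroup, g ∈ H → g = 1) : Function.Injective (ofGroupAlgebra p H) :=
  fun x y h => levelHom_injective hU (by rw [← proj_ofGroupAlgebra, h, proj_ofGroupAlgebra])

variable [H.Normal]

/-- Conjugation by `g` on the group algebra of a normal subgroup. -/
noncomputable def conjAlgebra (k : Type*) [CommRing k] (H : Subgroup G) [H.Normal] (g : G) :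
    MonoidAlgebra k H ≃+* MonoidAlgebra k H :=
  MonoidAlgebra.mapDomainRingEquiv k (MulAut.conjNormal g)

lemma conjAlgebra_single {k : Type*} [CommRing k] (g : G) (h : H) (r : k) :
    conjAlgebra k H g (MonoidAlgebra.single h r) =
      MonoidAlgebra.single (MulAut.conjNormal g h) r := by
  simp [conjAlgebra]

lemma conjAlgebra_conjAlgebra_inv {k : Type*} [CommRing k] (g : G) (x : MonoidAlgebra k H) :
    conjAlgebra k H g (conjAlgebra k H g⁻¹ x) = x := by
  induction x using MonoidAlgebra.induction_linear with
  | zero => simp only [map_zero]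
  | add a b ha hb => rw [map_add, map_add, ha, hb]
  | single h r => rw [conjAlgebra_single, conjAlgebra_single, ← MulAut.mul_apply, ← map_mul,
      mul_inv_cancel, map_one, MulAut.one_apply]

lemma modP_conjAlgebra (g : G) (x : MonoidAlgebra ℤ_[p] H) :
    modP p H (conjAlgebra ℤ_[p] H g x) = conjAlgebra (ZMod p) H g (modP p H x) := by
  induction x using MonoidAlgebra.induction_linear with
  | zero => simp only [map_zero]
  | add a b ha hb => rw [map_add, map_add, map_add, map_add, ha, hb]
  | single h r => rw [conjAlgebra_single, modP_single, modP_single, conjAlgebra_single]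

lemma ofGroup_mul_ofGroupAlgebra (g : G) (x : MonoidAlgebra ℤ_[p] H) :
    ofGroup p g * ofGroupAlgebra p H x =
      ofGroupAlgebra p H (conjAlgebra ℤ_[p] H g x) * ofGroup p g := by
  induction x using MonoidAlgebra.induction_linear with
  | zero => simp only [map_zero, mul_zero, zero_mul]
  | add a b ha hb => rw [map_add, map_add, map_add, mul_add, add_mul, ha, hb]
  | single h r =>
    rw [conjAlgebra_single, ofGroupAlgebra_single, ofGroupAlgebra_single, ← mul_assoc,
      ← Algebra.commutes, mul_assoc, mul_assoc, ← map_mul, ← map_mul, MulAut.conjNormal_apply]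
    congr 2
    group

lemma single_mul_levelHom (U : OpenNormalSubgroup G) (g : G) (x : MonoidAlgebra (ZMod p) H) :
    MonoidAlgebra.single (g : G ⧸ U.toSubgroup) 1 * levelHom (ZMod p) H U x =
      levelHom (ZMod p) H U (conjAlgebra (ZMod p) H g x) *
        MonoidAlgebra.single (g : G ⧸ U.toSubgroup) 1 := by
  obtain ⟨x, rfl⟩ := modP_surjective (p := p) (H := H) x
  rw [← modP_conjAlgebra, ← projModP_ofGroupAlgebra, ← projModP_ofGroupAlgebra, ← projModP_ofGroup,
    ← map_mul, ← map_mul, ofGroup_mul_ofGroupAlgebra]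

variable [IsTopologicalGroup G] [CompactSpace G]

/-- Let `Y` be a `G`-stable ideal of `ℤ_p[H]` containing `p` with `Y² ⊆ pY`. If the image of
`Λ(G)` is finitely closed, then `Y` maps to multiples of `p`. -/
lemma exists_map_eq_p_mul_of_stable [Finite H] {R : Type*} [Ring R] {q : IwasawaAlgebra p G →+* R}
    (hX : IsFinitelyClosed q.range) (hpu : IsUnit (p : R))
    (Y : Submodule ℤ_[p] (MonoidAlgebra ℤ_[p] H))
    (hYp : (p : MonoidAlgebra ℤ_[p] H) ∈ Y) (hYg : ∀ g, ∀ y ∈ Y, conjAlgebra ℤ_[p] H g y ∈ Y)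
    (hYY : ∀ y ∈ Y, ∀ y' ∈ Y, ∃ z ∈ Y, y * y' = p * z) {y : MonoidAlgebra ℤ_[p] H} (hy : y ∈ Y) :
    ∃ x, q (ofGroupAlgebra p H y) = q (p * x) := by
  have hfin : Module.Finite ℤ_[p] (MonoidAlgebra ℤ_[p] H) := inferInstance
  obtain ⟨r, v, hv⟩ := Submodule.fg_iff_exists_fin_generating_family.mp (IsNoetherian.noetherian Y)
  have hvY : ∀ i, v i ∈ Y := fun i => hv ▸ Submodule.subset_span ⟨i, rfl⟩
  let w : Fin r → IwasawaAlgebra p G := fun i => ofGroupAlgebra p H (v i)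
  let W : AddSubmonoid (IwasawaAlgebra p G) :=
    { carrier := {x | ∃ c : Fin r → IwasawaAlgebra p G, x = ∑ i, w i * c i}
      zero_mem' := ⟨0, by simp⟩
      add_mem' := by
        rintro _ _ ⟨c, rfl⟩ ⟨c', rfl⟩
        refine ⟨c + c', ?_⟩
        simp only [Pi.add_apply, mul_add, Finset.sum_add_distrib] }
  have hWmul : ∀ x ∈ W, ∀ z, x * z ∈ W := by
    rintro _ ⟨c, rfl⟩ z
    refine ⟨fun i => c i * z, ?_⟩
    rw [Finset.sum_mul]
    simp only [mul_assoc]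
  have hexp : ∀ y ∈ Y, ∃ c : Fin r → IwasawaAlgebra p G, ofGroupAlgebra p H y = ∑ i, w i * c i :=
    fun y hy => by
      rw [← hv] at hy
      obtain ⟨c, rfl⟩ := (Submodule.mem_span_range_iff_exists_fun _).mp hy
      refine ⟨fun i => algebraMap _ _ (c i), ?_⟩
      rw [map_sum]
      refine Finset.sum_congr rfl fun i _ => ?_
      rw [map_smul, Algebra.smul_def, Algebra.commutes]
  have hYW : ∀ y ∈ Y, ofGroupAlgebra p H y ∈ W := hexp
  -- `W` is the right ideal generated by `Y`. Stability of `Y` under conjugation makes it stable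
  -- under left multiplication by group elements; a general `z` is matched exactly at each finite
  -- level and compactness concludes.
  have hleft : ∀ (i : Fin r) (z : IwasawaAlgebra p G), z * w i ∈ W := fun i z => by
    refine levelIdeal_isFundamental.exists_eq_sum w (z * w i) fun ⟨n, U⟩ => ?_
    have key : ∀ x : MonoidAlgebra ℤ_[p] (G ⧸ U.toSubgroup), ∃ z', proj U z' = x ∧
        z' * w i ∈ W := fun x => by
      induction x using MonoidAlgebra.induction_linear with
      | zero => exact ⟨0, map_zero _, by rw [zero_mul]; exact W.zero_mem⟩
      | add a b ha hb =>
        obtain ⟨a, rfl, ha⟩ := ha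
        obtain ⟨b, rfl, hb⟩ := hb
        exact ⟨a + b, map_add _ _ _, by rw [add_mul]; exact W.add_mem ha hb⟩
      | single g s =>
        obtain ⟨g, rfl⟩ := QuotientGroup.mk_surjective g
        refine ⟨algebraMap _ _ s * ofGroup p g, ?_, ?_⟩
        · rw [map_mul, proj_ofGroup, proj_algebraMap, MonoidAlgebra.single_mul_single, one_mul,
            mul_one]
        · rw [mul_assoc, ofGroup_mul_ofGroupAlgebra, Algebra.commutes]
          exact hWmul _ (hWmul _ (hYW _ (hYg g _ (hvY i))) _) _
    obtain ⟨z', hz', c, hc⟩ := key (proj U z)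
    refine ⟨c, mem_levelIdeal.mpr ⟨0, ?_⟩⟩
    rw [← hc, map_sub, map_mul, map_mul, hz', sub_self, mul_zero]
  -- `(Y Λ)(Y Λ) = Y (Λ Y) Λ ⊆ Y Y Λ ⊆ p Y Λ`, using that `Y Λ` is a two-sided ideal.
  have hpW : ∀ c c' : Fin r → IwasawaAlgebra p G, ∃ d : Fin r → IwasawaAlgebra p G,
      (∑ i, w i * c i) * (∑ i, w i * c' i) = p * ∑ i, w i * d i := fun c c' => by
    let S : AddSubmonoid (IwasawaAlgebra p G) := W.map (AddMonoidHom.mulLeft (p : IwasawaAlgebra p G))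
    have hSmul : ∀ x ∈ S, ∀ z, x * z ∈ S := by
      rintro _ ⟨x, hx, rfl⟩ z
      exact ⟨x * z, hWmul x hx z, (mul_assoc _ _ _).symm⟩
    have hS : (∑ i, w i * c i) * (∑ i, w i * c' i) ∈ S := by
      rw [Finset.mul_sum]
      refine S.sum_mem fun k _ => ?_
      rw [Finset.sum_mul]
      refine S.sum_mem fun i _ => ?_
      rw [mul_assoc, ← mul_assoc (c i)]
      obtain ⟨d, hd⟩ := hleft k (c i)
      rw [hd, ← mul_assoc]
      refine hSmul _ ?_ _
      rw [Finset.mul_sum]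
      refine S.sum_mem fun l _ => ?_
      rw [← mul_assoc]
      refine hSmul _ ?_ _
      obtain ⟨z, hz, hvz⟩ := hYY _ (hvY i) _ (hvY l)
      refine ⟨ofGroupAlgebra p H z, hYW z hz, ?_⟩
      change (p : IwasawaAlgebra p G) * ofGroupAlgebra p H z = ofGroupAlgebra p H (v i) *
        ofGroupAlgebra p H (v l)
      rw [← map_mul, hvz, map_mul, map_natCast]
    obtain ⟨x, ⟨d, rfl⟩, hx⟩ := hS
    exact ⟨d, hx.symm⟩
  have hgen := hX.exists_map_eq_p_mul hpu w (by
    obtain ⟨c, hc⟩ := hexp _ hYp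
    exact ⟨c, by rw [← hc, map_natCast]⟩) hpW
  choose x hx using hgen
  obtain ⟨c, hc⟩ := hexp y hy
  refine ⟨∑ i, x i * c i, ?_⟩
  rw [hc, Finset.mul_sum, map_sum, map_sum]
  refine Finset.sum_congr rfl fun i _ => ?_
  rw [← mul_assoc, map_mul, hx, ← map_mul]

/-- If the complement of a central idempotent `e` is finitely closed, then the Jacobson radical of
`𝔽_p[H]` is contained in the part cut out by `e`. -/
theorem modP_mul_eq_of_mem_jacobson [Finite H] {R : Type*} [Ring R] {q : IwasawaAlgebra p G →+* R}
    (hX : IsFinitelyClosed q.range) (hpu : IsUnit (p : R)) {U : OpenNormalSubgroup G}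
    (hU : ∀ g ∈ U.toSubgroup, g ∈ H → g = 1) {e : MonoidAlgebra ℤ_[p] H} (hee : e * e = e)
    (hec : ∀ x, ofGroupAlgebra p H e * x = x * ofGroupAlgebra p H e)
    (hqe : ∀ x, q x = 0 ↔ ofGroupAlgebra p H e * x = x) {w : MonoidAlgebra (ZMod p) H}
    (hw : w ∈ Ring.jacobson (MonoidAlgebra (ZMod p) H)) : modP p H e * w = w := by
  have := Fintype.ofFinite H
  have hecH : ∀ x, e * x = x * e := fun x => ofGroupAlgebra_injective hU (by
    rw [map_mul, map_mul, hec])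
  have heg : ∀ g, conjAlgebra ℤ_[p] H g e = e := fun g => ofGroupAlgebra_injective hU (by
    have h1 := ofGroup_mul_ofGroupAlgebra g e
    rw [← hec] at h1
    have h2 : ofGroup p g * ofGroup p g⁻¹ = 1 := by rw [← map_mul, mul_inv_cancel, map_one]
    have h3 := congrArg (· * ofGroup p g⁻¹) h1
    simp only [mul_assoc, h2, mul_one] at h3
    exact h3.symm)
  set a := 1 - modP p H e with ha
  have hac : ∀ x, a * x = x * a := fun x => by
    obtain ⟨x, rfl⟩ := modP_surjective x
    rw [ha, sub_mul, mul_sub, ← map_mul, hecH, map_mul, one_mul, mul_one]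
  have haa : a * a = a := by
    rw [ha, mul_sub, mul_one, sub_mul, one_mul, ← map_mul, hee, sub_self, sub_zero]
  have hag : ∀ g, conjAlgebra (ZMod p) H g a = a := fun g => by
    rw [ha, map_sub, map_one, ← modP_conjAlgebra, heg]
  -- This ideal is everything on the part of `e` and the radical on its complement.
  let J : Ideal (MonoidAlgebra (ZMod p) H) :=
    { carrier := {x | a * x ∈ Ring.jacobson (MonoidAlgebra (ZMod p) H)}
      zero_mem' := by
        change a * 0 ∈ Ring.jacobson (MonoidAlgebra (ZMod p) H)
        rw [mul_zero]; exact Ideal.zero_mem _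
      add_mem' := fun {x y} hx hy => by
        change a * (x + y) ∈ Ring.jacobson (MonoidAlgebra (ZMod p) H)
        rw [mul_add]; exact Ideal.add_mem _ hx hy
      smul_mem' := fun c x hx => by
        change a * (c * x) ∈ Ring.jacobson (MonoidAlgebra (ZMod p) H)
        rw [← mul_assoc, hac, mul_assoc]; exact Ideal.mul_mem_left _ _ hx }
  have hJdef : ∀ x, x ∈ J ↔ a * x ∈ Ring.jacobson (MonoidAlgebra (ZMod p) H) := fun x => Iff.rfl
  have hJ2 : J.IsTwoSided := ⟨fun {x} y hx => by
    rw [hJdef, ← mul_assoc]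
    exact Ideal.mul_mem_right _ _ hx⟩
  have hJg : ∀ g, ∀ x ∈ J, conjAlgebra (ZMod p) H g x ∈ J := fun g x hx => by
    rw [hJdef]
    have hsurj : RingHomSurjective (conjAlgebra (ZMod p) H g).toRingHom :=
      ⟨(conjAlgebra (ZMod p) H g).surjective⟩
    have h1 := Ring.le_comap_jacobson (f := (conjAlgebra (ZMod p) H g).toRingHom)
    have h2 : conjAlgebra (ZMod p) H g (a * x) ∈ Ring.jacobson (MonoidAlgebra (ZMod p) H) := h1 hx
    rwa [map_mul, hag] at h2
  -- `p⁻¹ Y` is the right order of the preimage of `J`. It is stable under conjugation since `J` is,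
  -- and being a ring it gives `Y² ⊆ p Y`.
  let Y : Submodule ℤ_[p] (MonoidAlgebra ℤ_[p] H) :=
    { carrier := {y | ∀ j, modP p H j ∈ J → ∃ j', modP p H j' ∈ J ∧ j * y = p * j'}
      zero_mem' := fun j _ => ⟨0, by rw [map_zero]; exact J.zero_mem, by rw [mul_zero, mul_zero]⟩
      add_mem' := fun {x y} hx hy j hj => by
        obtain ⟨j₁, h₁, e₁⟩ := hx j hj
        obtain ⟨j₂, h₂, e₂⟩ := hy j hj
        exact ⟨j₁ + j₂, by rw [map_add]; exact J.add_mem h₁ h₂, by rw [mul_add, mul_add, e₁, e₂]⟩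
      smul_mem' := fun c x hx j hj => by
        obtain ⟨j₁, h₁, e₁⟩ := hx j hj
        refine ⟨j₁ * algebraMap _ _ c, by rw [map_mul]; exact Ideal.mul_mem_right _ _ h₁, ?_⟩
        rw [← mul_assoc, ← e₁, Algebra.smul_def, Algebra.commutes, mul_assoc] }
  have hYdef : ∀ y, y ∈ Y ↔ ∀ j, modP p H j ∈ J → ∃ j', modP p H j' ∈ J ∧ j * y = p * j' :=
    fun y => Iff.rfl
  have hp0 : modP p H (p : MonoidAlgebra ℤ_[p] H) = 0 := modP_eq_zero_iff.mpr ⟨1, by rw [mul_one]⟩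
  have hYp : (p : MonoidAlgebra ℤ_[p] H) ∈ Y := fun j hj => ⟨j, hj, (Nat.cast_commute p j).eq.symm⟩
  have hYg : ∀ g, ∀ y ∈ Y, conjAlgebra ℤ_[p] H g y ∈ Y := fun g y hy j hj => by
    have hinv := conjAlgebra_conjAlgebra_inv g j
    obtain ⟨j', hj', h⟩ := hy (conjAlgebra ℤ_[p] H g⁻¹ j) (by
      rw [modP_conjAlgebra]; exact hJg _ _ hj)
    refine ⟨conjAlgebra ℤ_[p] H g j', by rw [modP_conjAlgebra]; exact hJg _ _ hj', ?_⟩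
    rw [← hinv, ← map_mul, h, map_mul, map_natCast]
  have hYY : ∀ y ∈ Y, ∀ y' ∈ Y, ∃ z ∈ Y, y * y' = p * z := fun y hy y' hy' => by
    obtain ⟨j₁, h₁, e₁⟩ := hy p (by rw [hp0]; exact J.zero_mem)
    obtain ⟨j₂, h₂, e₂⟩ := hy' j₁ h₁
    have hz : y * y' = p * j₂ := by
      apply p_mul_cancel
      rw [← mul_assoc, e₁, mul_assoc, e₂]
    refine ⟨j₂, fun j hj => ?_, hz⟩
    obtain ⟨k₁, g₁, f₁⟩ := hy j hj
    obtain ⟨k₂, g₂, f₂⟩ := hy' k₁ g₁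
    refine ⟨k₂, g₂, p_mul_cancel ?_⟩
    rw [← mul_assoc, (Nat.cast_commute p j).eq, mul_assoc, ← hz, ← mul_assoc, f₁, mul_assoc, f₂]
  -- Triviality of the right order: on the complement it follows from finite closedness, and on the
  -- part of `e` from the fact that `e` lies in the preimage of `J`.
  obtain ⟨f, hf, hfJ⟩ := exists_right_identity_of_order_eq J fun y hy => by
    have hyY : y ∈ Y := hy
    obtain ⟨x, hx⟩ := exists_map_eq_p_mul_of_stable hX hpu Y hYp hYg hYY hyY
    have h1 : a * modP p H y = 0 := by
      apply levelHom_injective (k := ZMod p) hU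
      rw [map_zero]
      have h2 : ofGroupAlgebra p H e * (ofGroupAlgebra p H y - p * x) =
          ofGroupAlgebra p H y - p * x := by
        rw [← hqe, map_sub, hx, sub_self]
      have h3 := congrArg (projModP U) h2
      rw [map_mul, map_sub, map_mul, projModP_p, zero_mul, sub_zero, ← map_mul, ← map_mul,
        projModP_ofGroupAlgebra, projModP_ofGroupAlgebra, map_mul] at h3
      rw [ha, sub_mul, one_mul, map_sub, h3, sub_self]
    have h2 : modP p H e * modP p H y = 0 := by
      obtain ⟨j', -, h⟩ := hy e (by
        rw [hJdef, ha, sub_mul, one_mul, ← map_mul, hee, sub_self]; exact Ideal.zero_mem _)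
      rw [← map_mul, h, map_mul, hp0, zero_mul]
    rw [ha, sub_mul, one_mul, h2, sub_zero] at h1
    exact h1
  -- `a * f` is an idempotent contained in the radical, which is nilpotent.
  have haf : a * f = 0 := by
    have h1 : a * f * (a * f) = a * f := by
      rw [← mul_assoc, mul_assoc a f a, ← hac f, ← mul_assoc, haa, mul_assoc, hfJ f hf]
    have h2 : ∀ n, (a * f) ^ (n + 1) = a * f := fun n => by
      induction n with
      | zero => rw [zero_add, pow_one]
      | succ n ih => rw [pow_succ, ih, h1]
    obtain ⟨n, hn⟩ := isNilpotent_of_mem_jacobson ((hJdef f).mp hf)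
    rw [← h2 n, pow_succ, hn, zero_mul]
  have hwJ : a * w ∈ J := by
    rw [hJdef, ← mul_assoc, haa]
    exact Ideal.mul_mem_left _ _ hw
  have h0 := hfJ _ hwJ
  rw [hac, mul_assoc, haf, mul_zero, ← hac, ha, sub_mul, one_mul, eq_comm, sub_eq_zero] at h0
  exact h0.symm

end FiniteSubgroup

/-! ### Corners and the radical of `𝔽_p[G/V]` -/

section CornerRing

variable {F : Type u} [Ring F] {a : F} (ha : IsIdempotentElem a) (hc : ∀ x, Commute a x)

lemma toCorner_surjective : Function.Surjective (toCorner ha hc) := by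
  rintro ⟨_, x, rfl⟩
  exact ⟨x, rfl⟩

include hc in
-- Since `a` kills the radical, the corner is a quotient of the semisimple ring `F ⧸ Ring.jacobson
-- F`.
lemma isSemisimpleRing_corner [Finite F] (hrad : ∀ w ∈ Ring.jacobson F, a * w = 0) :
    IsSemisimpleRing ha.Corner := by
  have hF : IsSemisimpleRing (F ⧸ Ring.jacobson F) := by
    have : Finite (F ⧸ Ring.jacobson F) := Finite.of_surjective _ Ideal.Quotient.mk_surjective
    exact IsArtinianRing.isSemisimpleRing_iff_jacobson.mpr (Ring.jacobson_quotient_jacobson F)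
  exact RingHom.isSemisimpleRing_of_surjective
    (Ideal.Quotient.lift (Ring.jacobson F) (toCorner ha hc) fun w hw =>
      Subtype.ext (by rw [val_toCorner, hrad w hw]; rfl))
    (Ideal.Quotient.lift_surjective_of_surjective _ _ (toCorner_surjective ha hc))

/-- The automorphism of a corner ring induced by an automorphism fixing the idempotent. -/
def cornerAut (σ : F ≃+* F) (hσ : σ a = a) : RingAut ha.Corner where
  toFun b := ⟨σ b.1, by
    obtain ⟨y, hy⟩ := b.2
    exact ⟨σ y, by
      change a * σ y * a = σ b.1
      rw [← hy]
      change _ = σ (a * y * a)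
      rw [map_mul, map_mul, hσ]⟩⟩
  invFun b := ⟨σ.symm b.1, by
    have hσ' : σ.symm a = a := by rw [RingEquiv.symm_apply_eq, hσ]
    obtain ⟨y, hy⟩ := b.2
    exact ⟨σ.symm y, by
      change a * σ.symm y * a = σ.symm b.1
      rw [← hy]
      change _ = σ.symm (a * y * a)
      rw [map_mul, map_mul, hσ']⟩⟩
  left_inv b := Subtype.ext (σ.symm_apply_apply _)
  right_inv b := Subtype.ext (σ.apply_symm_apply _)
  map_mul' b b' := Subtype.ext (map_mul σ b.1 b'.1)
  map_add' b b' := Subtype.ext (map_add σ b.1 b'.1)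

/-- A homomorphism restricted to a corner ring. -/
def cornerHom {A : Type v} [Ring A] (f : F →+* A) : ha.Corner →ₙ+* A where
  toFun b := f b.1
  map_mul' b b' := map_mul f b.1 b'.1
  map_zero' := map_zero f
  map_add' b b' := map_add f b.1 b'.1

/-- The radical of the part cut out by an idempotent `a` in the ring generated by a finite
ring `F` and an element `γ` of `p`-power order normalizing it, where `Fa` is semisimple. -/
theorem exists_central_nilpotent_of_corner {p : ℕ} [Fact p.Prime] {A : Type v} [Ring A] [Finite A]
    [CharP A p] [Finite F] [Algebra (ZMod p) F] (haa : IsIdempotentElem a)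
    (hac : ∀ x, Commute a x) (hrad : ∀ w ∈ Ring.jacobson F, a * w = 0) {f : F →+* A}
    (hf : Function.Injective f) {τ : F ≃+* F} (hτ : τ a = a) {γ : A} {M : ℕ}
    (hγM : γ ^ p ^ M = 1) (hγ : ∀ b, γ * f b = f (τ b) * γ) (hfa : ∀ x, f a * x = x * f a)
    (hA : ∀ x, ∃ c : ℕ → F, x = ∑ i ∈ Finset.range (p ^ M), f (c i) * γ ^ i) :
    ∃ t : A, (∀ x, t * x = x * t) ∧ f a * t = t ∧ IsNilpotent t ∧
      ∀ I : Ideal A, I.IsTwoSided → (∀ x ∈ I, IsNilpotent x) → ∀ x ∈ I, ∃ y, f a * x = t * y := by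
  have hss := isSemisimpleRing_corner haa hac hrad
  have hfin : Finite haa.Corner := Finite.of_surjective _ (toCorner_surjective haa hac)
  let alg : Algebra (ZMod p) haa.Corner :=
    ((toCorner haa hac).comp (algebraMap (ZMod p) F)).toAlgebra'
      fun c x => toCorner_commute haa hac (fun y => Algebra.commutes c y) x
  let ι : haa.Corner →ₙ+* A := cornerHom haa f
  have hι : Function.Injective ι := fun b b' h => Subtype.ext (hf h)
  let σ := cornerAut haa τ hτ
  have hγι : ∀ b, γ * ι b = ι (σ b) * γ := fun b => hγ b.1
  have hγn : ∀ (n : ℕ) b, γ ^ n * ι b = ι ((σ ^ n) b) * γ ^ n := fun n => by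
    induction n with
    | zero => intro b; rw [pow_zero, pow_zero, one_mul, mul_one]; rfl
    | succ n ih =>
      intro b
      rw [pow_succ, mul_assoc, hγι, ← mul_assoc, ih, mul_assoc, pow_succ]
      rfl
  have hσ : σ ^ p ^ M = 1 := by
    ext b : 1
    apply hι
    have := hγn (p ^ M) b
    rw [hγM, one_mul, mul_one] at this
    exact this.symm
  refine exists_central_nilpotent_of_crossedProduct hι hσ hγM hγι hfa fun x => ?_
  obtain ⟨c, rfl⟩ := hA x
  refine ⟨fun i => toCorner haa hac (c i), ?_⟩
  rw [Finset.mul_sum]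
  refine Finset.sum_congr rfl fun i _ => ?_
  change _ = f (toCorner haa hac (c i)).1 * _
  rw [val_toCorner, map_mul, mul_assoc]
  rfl

end CornerRing

section

variable {p : ℕ} [Fact p.Prime] {G : Type u} [Group G] [TopologicalSpace G]
  {H : Subgroup G} {P : ℤ_[p] → G} {m : ℕ} [H.Normal]

lemma commute_levelHom {a : MonoidAlgebra (ZMod p) H}
    (hag : ∀ g, conjAlgebra (ZMod p) H g a = a) (U : OpenNormalSubgroup G)
    (x : MonoidAlgebra (ZMod p) (G ⧸ U.toSubgroup)) :
    levelHom (ZMod p) H U a * x = x * levelHom (ZMod p) H U a := by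
  induction x using MonoidAlgebra.induction_on with
  | of g =>
    obtain ⟨g, rfl⟩ := QuotientGroup.mk_surjective g
    have := single_mul_levelHom U g a
    rw [hag] at this
    exact this.symm
  | add x y hx hy => rw [mul_add, add_mul, hx, hy]
  | smul r x hx => rw [mul_smul_comm, hx, smul_mul_assoc]

variable [IsTopologicalGroup G] [CompactSpace G] [Finite H]

/-- The structure of `𝔽_p[G/V]a`, where `a` cuts out a semisimple part of `𝔽_p[H]`. -/
theorem IsSemidirect.exists_central_nilpotent (hP : IsSemidirect H P m)
    {a : MonoidAlgebra (ZMod p) H} (haa : IsIdempotentElem a) (hac : ∀ x, Commute a x)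
    (hag : ∀ g, conjAlgebra (ZMod p) H g a = a)
    (hrad : ∀ w ∈ Ring.jacobson (MonoidAlgebra (ZMod p) H), a * w = 0) (k : ℕ) :
    ∃ t : MonoidAlgebra (ZMod p) (G ⧸ (hP.level k).toSubgroup), (∀ x, t * x = x * t) ∧
      levelHom (ZMod p) H (hP.level k) a * t = t ∧ IsNilpotent t ∧
      ∀ I : Ideal (MonoidAlgebra (ZMod p) (G ⧸ (hP.level k).toSubgroup)), I.IsTwoSided →
        (∀ x ∈ I, IsNilpotent x) → ∀ x ∈ I, ∃ y,
          levelHom (ZMod p) H (hP.level k) a * x = t * y := by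
  have hM : P 1 ^ p ^ (m + k) ∈ (hP.level k).toSubgroup := by
    rw [← hP.map_pow_mul]
    exact hP.mem_level.mpr ⟨1, rfl⟩
  have hUH : ∀ g ∈ (hP.level k).toSubgroup, g ∈ H → g = 1 := fun g hg hH => hP.level_inf k hg hH
  have hex : ∀ x, ∃ i : ℕ, (P 1 ^ i)⁻¹ * P x ∈ (hP.level k).toSubgroup := fun x => by
    simpa using hP.exists_natCast (hP.level k) 0 x
  generalize hP.level k = U at hM hUH hex ⊢
  have : CharP (MonoidAlgebra (ZMod p) (G ⧸ U.toSubgroup)) p :=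
    charP_of_injective_algebraMap (algebraMap (ZMod p) _).injective p
  have hP1 : (P 1 : G ⧸ U.toSubgroup) ^ p ^ (m + k) = 1 := by
    rw [← QuotientGroup.mk_pow, QuotientGroup.eq_one_iff]
    exact hM
  have hγm : (MonoidAlgebra.single (P 1 : G ⧸ U.toSubgroup) (1 : ZMod p)) ^ p ^ (m + k) = 1 := by
    rw [MonoidAlgebra.single_pow, hP1, one_pow, MonoidAlgebra.one_def]
  refine exists_central_nilpotent_of_corner haa hac hrad (levelHom_injective hUH)
    (hag (P 1)) hγm (fun b => single_mul_levelHom U (P 1) b)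
    (fun x => commute_levelHom hag U x) fun x => ?_
  induction x using MonoidAlgebra.induction_linear with
  | zero => exact ⟨0, by simp⟩
  | add x y hx hy =>
    obtain ⟨c, rfl⟩ := hx
    obtain ⟨c', rfl⟩ := hy
    refine ⟨c + c', ?_⟩
    rw [← Finset.sum_add_distrib]
    refine Finset.sum_congr rfl fun i _ => ?_
    rw [Pi.add_apply, _root_.map_add, add_mul]
  | single g r =>
    obtain ⟨g, rfl⟩ := QuotientGroup.mk_surjective g
    obtain ⟨h, hh, x, rfl⟩ := hP.exists_eq g
    obtain ⟨i, hi⟩ := hex x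
    have hpos : 0 < p ^ (m + k) := pow_pos (Fact.out : p.Prime).pos _
    -- The expansion allows only exponents below `p ^ (m + k)`, and `P 1` to that power is trivial
    -- in the quotient.
    let l := i % p ^ (m + k)
    have hxl : (P x : G ⧸ U.toSubgroup) = (P 1 : G ⧸ U.toSubgroup) ^ l := by
      rw [← QuotientGroup.eq, QuotientGroup.mk_pow] at hi
      rw [← hi]
      conv_lhs => rw [← Nat.mod_add_div i (p ^ (m + k)), pow_add, pow_mul, hP1, one_pow, mul_one]
    refine ⟨Pi.single l (MonoidAlgebra.single ⟨h, hh⟩ r), ?_⟩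
    rw [Finset.sum_eq_single l]
    · rw [Pi.single_eq_same, levelHom_single, MonoidAlgebra.single_pow,
        MonoidAlgebra.single_mul_single, QuotientGroup.mk_mul, hxl, one_pow, mul_one]
    · intro j _ hj
      rw [Pi.single_eq_of_ne hj, _root_.map_zero, zero_mul]
    · intro hl
      exact absurd (Finset.mem_range.mpr (Nat.mod_lt _ hpos)) hl

end

/-! ### The semisimple quotient and its generators -/

section Quotient

variable {Λ A X : Type u} [Ring Λ] [Ring A] [Ring X] {r : ℕ} {z : Fin r → Λ}
  {π₀ : Λ →+* A} {q : Λ →+* X} {e t : Λ}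

/-- If every nil ideal of a finite ring `A` lies in the ideal generated by a central idempotent `ε`
and a nilpotent central element `τ`, then the quotient of `A` by that ideal is semisimple. -/
lemma exists_isSemisimpleRing_quotient [Finite A] {ε τ : A} (hε : ε * ε = ε)
    (hεc : ∀ x, ε * x = x * ε) (hτc : ∀ x, τ * x = x * τ) (hτ : IsNilpotent τ)
    (hrad : ∀ I : Ideal A, I.IsTwoSided → (∀ x ∈ I, IsNilpotent x) →
      ∀ x ∈ I, ∃ y, (1 - ε) * x = τ * y) :
    ∃ (J J' : Ideal A) (_ : J.IsTwoSided) (_ : J'.IsTwoSided), (∀ x, x ∈ J ↔ ∃ y, x = τ * y) ∧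
      (∀ x, x ∈ J' ↔ ∃ y y', x = τ * y + ε * y') ∧ IsSemisimpleRing (A ⧸ J') := by
  let J : Ideal A :=
    { carrier := {x | ∃ y, x = τ * y}
      zero_mem' := ⟨0, by rw [mul_zero]⟩
      add_mem' := by
        rintro _ _ ⟨y, rfl⟩ ⟨y', rfl⟩
        exact ⟨y + y', by rw [mul_add]⟩
      smul_mem' := by
        rintro c _ ⟨y, rfl⟩
        exact ⟨c * y, by rw [smul_eq_mul, ← mul_assoc, ← mul_assoc, hτc]⟩ }
  let J' : Ideal A :=
    { carrier := {x | ∃ y y', x = τ * y + ε * y'}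
      zero_mem' := ⟨0, 0, by rw [mul_zero, mul_zero, add_zero]⟩
      add_mem' := by
        rintro _ _ ⟨y, u, rfl⟩ ⟨y', u', rfl⟩
        exact ⟨y + y', u + u', by rw [mul_add, mul_add, add_add_add_comm]⟩
      smul_mem' := by
        rintro c _ ⟨y, u, rfl⟩
        exact ⟨c * y, c * u, by
          rw [smul_eq_mul, mul_add, ← mul_assoc, ← mul_assoc, ← mul_assoc, ← mul_assoc, hτc, hεc]⟩ }
  have hJ : J.IsTwoSided := ⟨by
    rintro _ b ⟨y, rfl⟩
    exact ⟨y * b, mul_assoc _ _ _⟩⟩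
  have hJ' : J'.IsTwoSided := ⟨by
    rintro _ b ⟨y, u, rfl⟩
    exact ⟨y * b, u * b, by rw [add_mul, mul_assoc, mul_assoc]⟩⟩
  refine ⟨J, J', hJ, hJ', fun _ => Iff.rfl, fun _ => Iff.rfl, ?_⟩
  have hmem : ∀ x, x ∈ J' ↔ ∃ y y', x = τ * y + ε * y' := fun _ => Iff.rfl
  have hfin : Finite (A ⧸ J') := Finite.of_surjective _ Ideal.Quotient.mk_surjective
  rw [IsArtinianRing.isSemisimpleRing_iff_jacobson, eq_bot_iff]
  intro w hw
  obtain ⟨x, rfl⟩ := Ideal.Quotient.mk_surjective w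
  -- The preimage of the radical of the quotient, restricted to the part killed by `ε`. It is nil: a
  -- power of `x` lies in `J'`, a further factor `x` removes the `ε`-term, and a multiple of the
  -- nilpotent central `τ` remains.
  let I : Ideal A :=
    { carrier := {x | ε * x = 0 ∧ Ideal.Quotient.mk J' x ∈ Ring.jacobson (A ⧸ J')}
      zero_mem' := ⟨mul_zero _, by rw [map_zero]; exact Ideal.zero_mem _⟩
      add_mem' := fun {a b} ha hb => ⟨by rw [mul_add, ha.1, hb.1, add_zero], by
        rw [map_add]; exact Ideal.add_mem _ ha.2 hb.2⟩
      smul_mem' := fun c x hx => ⟨by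
        rw [smul_eq_mul, ← mul_assoc, hεc, mul_assoc, hx.1, mul_zero], by
        rw [smul_eq_mul, map_mul]; exact Ideal.mul_mem_left _ _ hx.2⟩ }
  have hI : I.IsTwoSided := ⟨fun {a} b ha => ⟨by rw [← mul_assoc, ha.1, zero_mul], by
    rw [map_mul]; exact Ideal.mul_mem_right _ _ ha.2⟩⟩
  have hnil : ∀ x ∈ I, IsNilpotent x := fun x hx => by
    obtain ⟨n, hn⟩ := isNilpotent_of_mem_jacobson hx.2
    rw [← map_pow, Ideal.Quotient.eq_zero_iff_mem, hmem] at hn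
    obtain ⟨y, y', hy⟩ := hn
    have h1 : x ^ (n + 1) = τ * (y * x) := by
      have h2 : x ^ (n + 1) = x ^ n * x := pow_succ x n
      rw [hy, add_mul, mul_assoc, hεc, mul_assoc y', hx.1, mul_zero, add_zero] at h2
      exact h2
    obtain ⟨s, hs⟩ := hτ
    refine ⟨(n + 1) * s, ?_⟩
    rw [pow_mul, h1, (show Commute τ (y * x) from hτc _).mul_pow, hs, zero_mul]
  obtain ⟨y, hy⟩ := hrad I hI hnil ((1 - ε) * x) ⟨by
    rw [← mul_assoc, mul_sub, mul_one, hε, sub_self, zero_mul], by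
    rw [map_mul]; exact Ideal.mul_mem_left _ _ hw⟩
  rw [Ideal.mem_bot, Ideal.Quotient.eq_zero_iff_mem, hmem]
  refine ⟨y, x, ?_⟩
  rw [← hy, ← mul_assoc, sub_mul, one_mul, mul_sub, mul_one, hε, sub_self, sub_zero, sub_mul,
    one_mul, sub_add_cancel]

/-- The complement of a central idempotent `e` is liftable over the semisimple quotient attached
to a central element `t` generating the radical of `A`. -/
lemma exists_isLiftable_complement [Finite A] (hπ₀ : Function.Surjective π₀)
    (hlift : ∀ (Q : Type u) [Ring Q] (π : Λ →+* Q), Function.Surjective π →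
      (∀ x, π x = 0 ↔ ∃ y : Fin r → Λ, x = ∑ i, z i * y i) → IsLiftable π z)
    (hker : ∀ x, (∃ y : Fin r → Λ, x = ∑ i, z i * y i) ↔ ∃ y, π₀ (x - t * y) = 0)
    (htc : ∀ x, t * x = x * t)
    (he : e * e = e) (hec : ∀ x, e * x = x * e) (het : π₀ (e * t) = 0) (ht : IsNilpotent (π₀ t))
    (hrad : ∀ I : Ideal A, I.IsTwoSided → (∀ x ∈ I, IsNilpotent x) →
      ∀ x ∈ I, ∃ y, (1 - π₀ e) * x = π₀ t * y)
    (hq : Function.Surjective q) (hqe : ∀ x, q x = 0 ↔ e * x = x) :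
    ∃ (J : Ideal A) (_ : J.IsTwoSided) (π : X →+* A ⧸ J), IsSemisimpleRing (A ⧸ J) ∧
      IsLiftable π (fun i => q (z i)) ∧
      ∀ x, (∃ y, (1 - π₀ e) * π₀ x = π₀ t * y) → π (q x) = 0 := by
  have hτc : ∀ x, π₀ t * x = x * π₀ t := fun x => by
    obtain ⟨x, rfl⟩ := hπ₀ x
    rw [← map_mul, htc, map_mul]
  have hεc : ∀ x, π₀ e * x = x * π₀ e := fun x => by
    obtain ⟨x, rfl⟩ := hπ₀ x
    rw [← map_mul, hec, map_mul]
  have hε : π₀ e * π₀ e = π₀ e := by rw [← map_mul, he]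
  obtain ⟨J, J', hJ, hJ', hJm, hJm', hss⟩ := exists_isSemisimpleRing_quotient hε hεc hτc ht hrad
  have hJJ : J ≤ J' := fun x hx => by
    obtain ⟨y, rfl⟩ := (hJm x).mp hx
    exact (hJm' _).mpr ⟨y, 0, by rw [mul_zero, add_zero]⟩
  -- The kernel of `π₁` is generated by the `z i`; dividing also by the image of `e` gives a map
  -- that factors through the complement `X`.
  let π₁ : Λ →+* A ⧸ J := (Ideal.Quotient.mk J).comp π₀
  let κ : A ⧸ J →+* A ⧸ J' := Ideal.Quotient.factor hJJ
  have hκmk : ∀ x, κ (Ideal.Quotient.mk J x) = Ideal.Quotient.mk J' x := fun x => rfl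
  have hq0 : ∀ x, q x = 0 → (κ.comp π₁) x = 0 := fun x hx => by
    rw [hqe] at hx
    change Ideal.Quotient.mk J' (π₀ x) = 0
    rw [Ideal.Quotient.eq_zero_iff_mem, hJm', ← hx, map_mul]
    exact ⟨0, π₀ x, by rw [mul_zero, zero_add]⟩
  let π : X →+* A ⧸ J' := (RingHom.liftOfSurjective q hq) ⟨κ.comp π₁, fun x hx => hq0 x hx⟩
  have hπq : ∀ x, π (q x) = κ (π₁ x) := fun x =>
    RingHom.liftOfRightInverse_comp_apply q _ (Function.rightInverse_surjInv hq) _ x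
  refine ⟨J', hJ', π, hss, ?_, fun x hx => ?_⟩
  · refine (hlift _ π₁ (Ideal.Quotient.mk_surjective.comp hπ₀) fun x => ?_).complement he hec
      hq hqe (Ideal.Quotient.factor_surjective hJJ) (fun x => ?_) hπq
    · change Ideal.Quotient.mk J (π₀ x) = 0 ↔ _
      rw [hker, Ideal.Quotient.eq_zero_iff_mem, hJm, hπ₀.exists]
      refine exists_congr fun y => ?_
      rw [map_sub, map_mul, sub_eq_zero]
    · obtain ⟨x, rfl⟩ := Ideal.Quotient.mk_surjective x
      change Ideal.Quotient.mk J' x = 0 ↔ Ideal.Quotient.mk J (π₀ e) * Ideal.Quotient.mk J x = _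
      rw [← map_mul, Ideal.Quotient.eq_zero_iff_mem, hJm', Ideal.Quotient.eq, hJm]
      constructor
      · rintro ⟨y, y', rfl⟩
        refine ⟨-y, ?_⟩
        rw [mul_add, ← mul_assoc, ← mul_assoc, hε, ← map_mul, het, zero_mul, zero_add, mul_neg]
        abel
      · rintro ⟨y, hy⟩
        exact ⟨-y, x, by rw [mul_neg, ← hy]; abel⟩
  · obtain ⟨y, hy⟩ := hx
    rw [hπq]
    change Ideal.Quotient.mk J' (π₀ x) = 0
    rw [Ideal.Quotient.eq_zero_iff_mem, hJm']
    exact ⟨y, π₀ x, by rw [← hy, sub_mul, one_mul, sub_add_cancel]⟩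

end Quotient

/-- A generator `C ≡ T ^ p` modulo `p` is redundant if `T` lies in the kernel. -/
lemma IsLiftable.eliminate {X Q : Type*} [Ring X] [Ring Q] {π : X →+* Q} {p : ℕ} (hp : 1 < p)
    {C T t r : X} (h : IsLiftable π ![(p : X), C, t]) (hC : C = T ^ p + p * r) (hT : π T = 0)
    (hTp : ∀ w u : X, T * w = p * u → ∃ w', w = p * w') (hTc : ∀ x, T * x = x * T) :
    IsLiftable π ![(p : X), t] ∧ ∀ w u : X, t * w = p * u → ∃ w', w = p * w' := by
  have hpc : ∀ x : X, (p : X) * x = x * p := fun x => (Nat.cast_commute p x).eq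
  have htc : ∀ x, t * x = x * t := h.commute 2
  have hp1 : p - 1 + 1 = p := Nat.sub_add_cancel hp.le
  -- Writing `T` in the three generators and substituting for `C` gives `T * (1 - T ^ (p - 1) * y₁)`
  -- in the ideal of `p` and `t`. The bracket is a unit because `p - 1 > 0` and `T` is in the
  -- kernel.
  obtain ⟨y, y', hTt⟩ : ∃ y y', T = p * y + t * y' := by
    obtain ⟨y, hy⟩ := (h.ker T).mp hT
    rw [Fin.sum_univ_three] at hy
    change T = p * y 0 + C * y 1 + t * y 2 at hy
    have hu : IsUnit (1 - T ^ (p - 1) * y 1) := h.isUnit _ (by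
      rw [map_sub, map_one, map_mul, map_pow, hT, zero_pow (by omega), zero_mul, sub_zero])
    obtain ⟨v, hv⟩ := hu.exists_right_inv
    refine ⟨(y 0 + r * y 1) * v, y 2 * v, ?_⟩
    have h1 : T * (1 - T ^ (p - 1) * y 1) = p * (y 0 + r * y 1) + t * y 2 := by
      rw [mul_sub, mul_one, ← mul_assoc, ← pow_succ', hp1, mul_add, sub_eq_iff_eq_add]
      conv_lhs => rw [hy, hC, add_mul, mul_assoc]
      abel
    rw [← mul_assoc, ← mul_assoc, ← add_mul, ← h1, mul_assoc, hv, mul_one]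
  have hCmem : ∀ x, ∃ y y', C * x = p * y + t * y' := fun x => by
    refine ⟨y * (T ^ (p - 1) * x) + r * x, y' * (T ^ (p - 1) * x), ?_⟩
    have h1 : T ^ p * x = T * (T ^ (p - 1) * x) := by rw [← mul_assoc, ← pow_succ', hp1]
    rw [hC, add_mul, h1]
    generalize T ^ (p - 1) * x = u
    rw [hTt, add_mul, mul_assoc, mul_assoc, mul_assoc, mul_add]
    abel
  refine ⟨⟨h.surjective, fun i => ?_, fun x => ?_,
    h.isUnit, fun E hE => h.separated E fun x hx => ?_, h.lift⟩, fun w u hw => ?_⟩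
  · fin_cases i
    · exact hpc
    · exact htc
  · rw [h.ker]
    constructor
    · rintro ⟨y, rfl⟩
      obtain ⟨u, u', hu⟩ := hCmem (y 1)
      refine ⟨![y 0 + u, u' + y 2], ?_⟩
      rw [Fin.sum_univ_three, Fin.sum_univ_two]
      change p * y 0 + C * y 1 + t * y 2 = p * (y 0 + u) + t * (u' + y 2)
      rw [hu, mul_add, mul_add]
      abel
    · rintro ⟨y, rfl⟩
      refine ⟨![y 0, 0, y 1], ?_⟩
      rw [Fin.sum_univ_three, Fin.sum_univ_two]
      change p * y 0 + t * y 1 = p * y 0 + C * 0 + t * y 1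
      rw [mul_zero, add_zero]
  · obtain ⟨y, hy, hx⟩ := hE x hx
    refine ⟨![y 0, 0, y 1], fun i => ?_, ?_⟩
    · fin_cases i
      · exact hy 0
      · exact E.zero_mem
      · exact hy 1
    · rw [hx, Fin.sum_univ_three, Fin.sum_univ_two]
      change p * y 0 + t * y 1 = p * y 0 + C * 0 + t * y 1
      rw [mul_zero, add_zero]
  -- As `T` lies in the ideal of `p` and `t`, divisibility of `t * w` by `p` implies that of `T *
  -- w`.
  · refine hTp w (w * y + u * y') ?_
    rw [hTc, hTt, mul_add, mul_add, ← mul_assoc, ← mul_assoc, ← htc, hw, ← hpc, mul_assoc, mul_assoc]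

/-- The distinguished representative `(1 - e) * y` of an element of the complement of `e`. -/
lemma exists_lift_complement {Λ X : Type*} [Ring Λ] [Ring X] {q : Λ →+* X}
    (hq : Function.Surjective q) {e : Λ} (hee : e * e = e) (hqe : ∀ x, q x = 0 ↔ e * x = x) (x : X) :
    ∃ w, q w = x ∧ e * w = 0 ∧ ∀ y, q y = x → w = (1 - e) * y := by
  obtain ⟨w, rfl⟩ := hq x
  have hqe1 : q e = 0 := (hqe e).mpr hee
  refine ⟨(1 - e) * w, ?_, ?_, fun y hy => ?_⟩
  · rw [map_mul, map_sub, hqe1, map_one, sub_zero, one_mul]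
  · rw [← mul_assoc, mul_sub, mul_one, hee, sub_self, zero_mul]
  · have h1 : e * (w - y) = w - y := by rw [← hqe, map_sub, hy, sub_self]
    have h2 : (1 - e) * (w - y) = 0 := by rw [sub_mul, one_mul, h1, sub_self]
    rwa [mul_sub, sub_eq_zero] at h2

/-- A central nilpotent element generates a nil two-sided ideal, to which the hypothesis on nil
ideals applies. -/
lemma exists_eq_mul_of_isNilpotent {A : Type*} [Ring A] {ε τ T : A} (hT : ∀ x, T * x = x * T)
    (hn : IsNilpotent T) (hrad : ∀ I : Ideal A, I.IsTwoSided → (∀ x ∈ I, IsNilpotent x) →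
      ∀ x ∈ I, ∃ y, ε * x = τ * y) : ∃ y, ε * T = τ * y := by
  refine hrad (Ideal.span {T}) ⟨fun {x} y hx => ?_⟩ (fun x hx => ?_) _
    (Ideal.mem_span_singleton_self _)
  · obtain ⟨c, rfl⟩ := Ideal.mem_span_singleton'.mp hx
    refine Ideal.mem_span_singleton'.mpr ⟨c * y, ?_⟩
    rw [mul_assoc, mul_assoc, hT]
  · obtain ⟨c, rfl⟩ := Ideal.mem_span_singleton'.mp hx
    obtain ⟨s, hs⟩ := hn
    exact ⟨s, by rw [← hT, (show Commute T c from hT c).mul_pow, hs, zero_mul]⟩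

/-! ### The complement over its semisimple quotient -/

section

variable {p : ℕ} [Fact p.Prime] {G : Type u} [Group G] [TopologicalSpace G]
  {H : Subgroup G} {P : ℤ_[p] → G} {m : ℕ}

/-- An element of finite order has trivial `ℤ_p`-component because `ℤ_p` is torsion-free. -/
lemma IsSemidirect.le_of_finite [H.Normal] (hP : IsSemidirect H P m) (N : Subgroup G) [Finite N] :
    N ≤ H := by
  intro σ hσ
  obtain ⟨h, hh, x, rfl⟩ := hP.exists_eq σ
  obtain ⟨n, hn, hn1⟩ := isOfFinOrder_iff_pow_eq_one.mp (isOfFinOrder_of_finite (⟨h * P x, hσ⟩ : N))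
  have h1 : (h * P x) ^ n = 1 := congrArg Subtype.val hn1
  have h2 : P (n * x) ∈ H := by
    rw [hP.map_natCast_mul, ← QuotientGroup.eq_one_iff, QuotientGroup.mk_pow]
    have h3 := congrArg (fun g : G => (g : G ⧸ H)) h1
    simpa only [QuotientGroup.mk_pow, QuotientGroup.mk_mul, (QuotientGroup.eq_one_iff h).mpr hh,
      one_mul, QuotientGroup.mk_one] using h3
  have h3 := hP.disjoint _ h2
  rw [mul_eq_zero, Nat.cast_eq_zero] at h3
  rw [h3.resolve_left hn.ne', hP.map_zero, mul_one]
  exact hh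

variable [IsTopologicalGroup G] [CompactSpace G]

omit [IsTopologicalGroup G] [CompactSpace G] in
-- Comparing coefficients at `1` in `|N| e = ∑ σ` at level `0`, where `N` embeds, shows that `|N|`
-- is a unit of `ℤ_p`; so `e` has coefficients in `ℤ_p` and is supported on `N ≤ H`.
lemma IsSemidirect.exists_ofGroupAlgebra_eq [H.Normal] (hP : IsSemidirect H P m) {N : Subgroup G}
    [Finite N] {e : IwasawaAlgebra p G} (he : Nat.card N * e = sumElement p N) :
    ∃ ε, ofGroupAlgebra p H ε = e := by
  classical
  have := Fintype.ofFinite N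
  have hNH := hP.le_of_finite N
  have hsum : sumElement p N = ∑ σ : N, ofGroup p (σ : G) := finsum_eq_sum_of_fintype _
  have hunit : IsUnit (Nat.card N : ℤ_[p]) := by
    have h1 := congrArg (fun x => (proj (hP.level 0) x).coeff 1) he
    simp only [hsum, _root_.map_mul, map_natCast, map_sum, proj_ofGroup] at h1
    rw [← nsmul_eq_mul, MonoidAlgebra.coeff_smul, MonoidAlgebra.coeff_sum, Finsupp.smul_apply,
      Finsupp.finsetSum_apply, Finset.sum_eq_single 1] at h1
    · rw [OneMemClass.coe_one, QuotientGroup.mk_one, MonoidAlgebra.coeff_single,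
        Finsupp.single_eq_same, nsmul_eq_mul] at h1
      exact IsUnit.of_mul_eq_one _ h1
    · intro σ _ hσ
      rw [MonoidAlgebra.coeff_single, Finsupp.single_eq_of_ne]
      intro h
      exact hσ (Subtype.ext (hP.level_inf 0 ((QuotientGroup.eq_one_iff _).mp h.symm) (hNH σ.2)))
    · exact fun h => absurd (Finset.mem_univ _) h
  obtain ⟨r, hr⟩ := hunit.exists_left_inv
  refine ⟨∑ σ : N, MonoidAlgebra.single ⟨σ, hNH σ.2⟩ r, ?_⟩
  rw [map_sum]
  simp only [ofGroupAlgebra_single]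
  rw [← Finset.mul_sum, ← hsum, ← he, ← mul_assoc, ← map_natCast (algebraMap ℤ_[p] _),
    ← _root_.map_mul, hr, _root_.map_one, one_mul]

section Level

variable [H.Normal] (hP : IsSemidirect H P m) {t : IwasawaAlgebra p G}

include hP in
omit [H.Normal] [IsTopologicalGroup G] [CompactSpace G] in
lemma exists_ofGroup_sub_one_eq (k : ℕ) : ∃ r, ofGroup p (P (p ^ (k + 1))) - 1 =
    (ofGroup p (P (p ^ k)) - 1) ^ p + (p : IwasawaAlgebra p G) * r := by
  obtain ⟨r, hr⟩ := (Commute.one_right (ofGroup p (P (p ^ k)) - 1 :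
    IwasawaAlgebra p G)).exists_add_pow_prime_eq (Fact.out : p.Prime)
  refine ⟨(ofGroup p (P (p ^ k)) - 1) * r, ?_⟩
  rw [sub_add_cancel, one_pow, mul_one, ← map_pow, ← hP.map_natCast_mul, ← pow_succ'] at hr
  rw [hr, add_right_comm, add_sub_cancel_right, mul_assoc]

omit [H.Normal] [IsTopologicalGroup G] [CompactSpace G] in
lemma projModP_ofGroup_sub_one (k : ℕ) :
    projModP (hP.level k) (ofGroup p (P (p ^ (m + k))) - 1) = 0 := by
  rw [map_sub, map_one, projModP_ofGroup,
    (QuotientGroup.eq_one_iff _).mpr (hP.mem_level.mpr ⟨1, by rw [mul_one]⟩),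
    MonoidAlgebra.one_def, sub_self]

omit [H.Normal] in
lemma exists_sum_iff_projModP (k : ℕ) (x : IwasawaAlgebra p G) :
    (∃ y : Fin 3 → IwasawaAlgebra p G, x = ∑ i, ![(p : IwasawaAlgebra p G),
      ofGroup p (P (p ^ (m + k))) - 1, t] i * y i) ↔
      ∃ y, projModP (hP.level k) (x - t * y) = 0 := by
  constructor
  · rintro ⟨y, rfl⟩
    refine ⟨y 2, ?_⟩
    have hs : ∑ i, ![(p : IwasawaAlgebra p G), ofGroup p (P (p ^ (m + k))) - 1, t] i * y i =
        (p : IwasawaAlgebra p G) * y 0 + (ofGroup p (P (p ^ (m + k))) - 1) * y 1 + t * y 2 :=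
      Fin.sum_univ_three _
    rw [hs, add_sub_cancel_right, map_add, map_mul, map_mul, projModP_p,
      projModP_ofGroup_sub_one, zero_mul, zero_mul, add_zero]
  · rintro ⟨y, hy⟩
    obtain ⟨y₀, y₁, h⟩ := hP.exists_eq_add_of_projModP k hy
    refine ⟨![y₀, y₁, y], ?_⟩
    rw [Fin.sum_univ_three]
    exact sub_eq_iff_eq_add.mp h

include hP in
omit [H.Normal] in
lemma isLiftable_of_isNilpotent (k : ℕ) (htc : ∀ x, t * x = x * t)
    (hnil : ∀ U, IsNilpotent (projModP U t)) {Q : Type*} [Ring Q] {π : IwasawaAlgebra p G →+* Q}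
    (hπ : Function.Surjective π) (hker : ∀ x, π x = 0 ↔ ∃ y : Fin 3 → IwasawaAlgebra p G,
      x = ∑ i, ![(p : IwasawaAlgebra p G), ofGroup p (P (p ^ (m + k))) - 1, t] i * y i) :
    IsLiftable π ![(p : IwasawaAlgebra p G), ofGroup p (P (p ^ (m + k))) - 1, t] := by
  refine levelIdeal_isFundamental.isLiftable (fun i => ?_) (fun i ⟨n, U⟩ => ?_) hπ hker
  · match i with
    | 0 => exact fun x => (Nat.cast_commute p x).eq
    | 1 => exact hP.ofGroup_sub_one_central k
    | 2 => exact htc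
  · match i with
    | 0 => exact exists_pow_mem_levelIdeal (by
        change IsNilpotent (projModP U (p : IwasawaAlgebra p G))
        rw [projModP_p]; exact IsNilpotent.zero) n
    | 1 => exact exists_pow_mem_levelIdeal (hP.isNilpotent_projModP_sub_one U _) n
    | 2 => exact exists_pow_mem_levelIdeal (hnil U) n

end Level

/-- The complement of a central idempotent of `ℤ_p[H]` that kills the radical of `𝔽_p[H]` is
liftable over a finite semisimple quotient whose kernel is generated by `p` and an element that is
regular modulo `p`. -/
theorem IsSemidirect.exists_isLiftable [H.Normal] [Finite H] (hP : IsSemidirect H P m)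
    {X : Type u} [Ring X] {q : IwasawaAlgebra p G →+* X} (hq : Function.Surjective q)
    {ε : MonoidAlgebra ℤ_[p] H} (hee : ofGroupAlgebra p H ε * ofGroupAlgebra p H ε =
      ofGroupAlgebra p H ε)
    (hec : ∀ x, ofGroupAlgebra p H ε * x = x * ofGroupAlgebra p H ε)
    (hqe : ∀ x, q x = 0 ↔ ofGroupAlgebra p H ε * x = x)
    (hrad : ∀ w ∈ Ring.jacobson (MonoidAlgebra (ZMod p) H), modP p H ε * w = w) :
    ∃ (Q : Type u) (_ : Ring Q) (_ : Finite Q) (_ : IsSemisimpleRing Q) (π : X →+* Q) (t : X),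
      IsLiftable π ![(p : X), t] ∧ (∀ x : X, p * x = 0 → x = 0) ∧
      (∀ w u : X, t * w = p * u → ∃ w', w = p * w') ∧
      ∀ x : X, (∀ n : ℕ, ∃ y y', x = p * y + t ^ n * y') → ∃ y, x = p * y := by
  have hU : ∀ g ∈ (hP.level 1).toSubgroup, g ∈ H → g = 1 := fun g hg hH => hP.level_inf 1 hg hH
  have hεcH : ∀ x, ε * x = x * ε := fun x => ofGroupAlgebra_injective hU (by
    rw [_root_.map_mul, _root_.map_mul, hec])
  have hεε : ε * ε = ε := ofGroupAlgebra_injective hU (by rw [_root_.map_mul, hee])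
  have hεg : ∀ g, conjAlgebra ℤ_[p] H g ε = ε := fun g => ofGroupAlgebra_injective hU (by
    have h1 := ofGroup_mul_ofGroupAlgebra g ε
    rw [← hec] at h1
    have h2 : ofGroup p g * ofGroup p g⁻¹ = 1 := by
      rw [← _root_.map_mul, mul_inv_cancel, _root_.map_one]
    have h3 := congrArg (· * ofGroup p g⁻¹) h1
    simp only [mul_assoc, h2, mul_one] at h3
    exact h3.symm)
  -- Level `1` rather than `0`: its generator `P (p ^ (m + 1)) - 1` is a `p`-th power of `P (p ^ m)
  -- - 1` modulo `p`, which allows its later elimination.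
  obtain ⟨τ, hτc, haτ, hτn, hτrad⟩ := hP.exists_central_nilpotent (a := 1 - modP p H ε)
    (by
      rw [IsIdempotentElem, mul_sub, mul_one, sub_mul, one_mul, ← _root_.map_mul, hεε, sub_self,
        sub_zero])
    (fun x => by
      obtain ⟨x, rfl⟩ := modP_surjective x
      rw [Commute, SemiconjBy, sub_mul, mul_sub, ← _root_.map_mul, hεcH, _root_.map_mul, one_mul,
        mul_one])
    (fun g => by rw [_root_.map_sub, _root_.map_one, ← modP_conjAlgebra, hεg])
    (fun w hw => by rw [sub_mul, one_mul, hrad w hw, sub_self]) 1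
  rw [_root_.map_sub, _root_.map_one, ← projModP_ofGroupAlgebra] at haτ hτrad
  generalize ofGroupAlgebra p H ε = e at *
  obtain ⟨t, htc, htτ⟩ := hP.exists_central_lift 1 hτc
  have hTc := hP.ofGroup_sub_one_central 0
  rw [add_zero] at hTc
  have hnil : ∀ U, IsNilpotent (projModP U t) := fun U =>
    hP.isNilpotent_projModP (by rw [htτ]; exact hτn) U
  have het : projModP (hP.level 1) (e * t) = 0 := by
    rw [_root_.map_mul, htτ]
    rw [sub_mul, one_mul, sub_eq_self] at haτ
    exact haτ
  rw [← htτ] at hτn hτrad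
  have hlevel : ∀ (Q : Type u) [Ring Q] (π : IwasawaAlgebra p G →+* Q), Function.Surjective π →
      (∀ x, π x = 0 ↔ ∃ y : Fin 3 → IwasawaAlgebra p G, x = ∑ i, ![(p : IwasawaAlgebra p G),
        ofGroup p (P (p ^ (m + 1))) - 1, t] i * y i) →
      IsLiftable π ![(p : IwasawaAlgebra p G), ofGroup p (P (p ^ (m + 1))) - 1, t] :=
    fun Q _ π hπ hker => isLiftable_of_isNilpotent hP 1 htc hnil hπ hker
  have hsum := exists_sum_iff_projModP hP (t := t) 1
  have hcomp := exists_isLiftable_complement (q := q) (e := e) (t := t)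
    (π₀ := projModP (hP.level 1)) (projModP_surjective (hP.level 1)) hlevel hsum htc hee hec het
    hτn hτrad hq hqe
  obtain ⟨J, hJ, π, hss, hlift, hπ⟩ := hcomp
  have hfin : Finite (MonoidAlgebra (ZMod p) (G ⧸ (hP.level 1).toSubgroup) ⧸ J) :=
    Finite.of_surjective _ Ideal.Quotient.mk_surjective
  have hπT := hπ (ofGroup p (P (p ^ m)) - 1) (by
    exact exists_eq_mul_of_isNilpotent (fun x => by
      obtain ⟨x, rfl⟩ := projModP_surjective _ x
      rw [← _root_.map_mul, hTc, _root_.map_mul])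
      (hP.isNilpotent_projModP_sub_one (hP.level 1) (p ^ m)) hτrad)
  have hz : (fun i => q ((![(p : IwasawaAlgebra p G), ofGroup p (P (p ^ (m + 1))) - 1, t]) i)) =
      ![(p : X), q (ofGroup p (P (p ^ (m + 1))) - 1), q t] := by
    funext i
    match i with
    | 0 => exact map_natCast q p
    | 1 => rfl
    | 2 => rfl
  rw [hz] at hlift
  obtain ⟨r, hr⟩ := exists_ofGroup_sub_one_eq hP m
  have hpc : ∀ x : IwasawaAlgebra p G, (p : IwasawaAlgebra p G) * x = x * p := fun x =>
    (Nat.cast_commute p x).eq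
  have hrep := exists_lift_complement hq hee hqe
  have hqTc : ∀ x, q (ofGroup p (P (p ^ m)) - 1) * x = x * q (ofGroup p (P (p ^ m)) - 1) :=
    fun x => by
      obtain ⟨x, rfl⟩ := hq x
      rw [← _root_.map_mul, hTc, _root_.map_mul]
  obtain ⟨hlift', htreg⟩ := hlift.eliminate (Fact.out : p.Prime).one_lt
    (T := q (ofGroup p (P (p ^ m)) - 1)) (r := q r)
    (by rw [hr, _root_.map_add, _root_.map_pow, _root_.map_mul, map_natCast]) hπT
    -- Regularity of `T` modulo `p` passes from `Λ(G)` to the complement by comparing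
    -- representatives fixed by `1 - e`.
    (fun w u h => by
      obtain ⟨w, rfl, hw, -⟩ := hrep w
      obtain ⟨v, hv, -, hvu⟩ := hrep (q (ofGroup p (P (p ^ m)) - 1) * q w)
      obtain ⟨u, rfl⟩ := hq u
      have h1 := hvu ((ofGroup p (P (p ^ m)) - 1) * w) (_root_.map_mul _ _ _)
      rw [hvu (p * u) (by rw [_root_.map_mul, map_natCast, h]), ← mul_assoc, ← hpc, mul_assoc,
        ← mul_assoc (1 - e), ← hTc, mul_assoc, sub_mul _ _ w, one_mul, hw, sub_zero] at h1
      obtain ⟨w', rfl⟩ := hP.exists_eq_p_mul_of_mul h1.symm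
      exact ⟨q w', by rw [_root_.map_mul, map_natCast]⟩) hqTc
  refine ⟨_, inferInstance, hfin, hss, π, q t, hlift', fun x hx => ?_, htreg, fun x hx => ?_⟩
  · obtain ⟨w, rfl, hw, -⟩ := hrep x
    have h1 : e * (p * w) = p * w := by rw [← hqe, _root_.map_mul, map_natCast, hx]
    rw [← mul_assoc, ← hpc, mul_assoc, hw, mul_zero, ← mul_zero (p : IwasawaAlgebra p G)] at h1
    rw [← p_mul_cancel' h1, _root_.map_zero]
  · obtain ⟨w, rfl, hw, hwu⟩ := hrep x
    obtain ⟨w', rfl⟩ := exists_eq_p_mul_of_forall_pow (x := w) hnil fun n => by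
      obtain ⟨u, u', h⟩ := hx n
      obtain ⟨u, rfl⟩ := hq u
      obtain ⟨u', rfl⟩ := hq u'
      refine ⟨(1 - e) * u, (1 - e) * u', ?_⟩
      have htn : t ^ n * (1 - e) = (1 - e) * t ^ n := (show Commute t (1 - e) from htc _).pow_left n
      rw [hwu (p * u + t ^ n * u') (by
        rw [h, _root_.map_add, _root_.map_mul, _root_.map_mul, _root_.map_pow, map_natCast]),
        mul_add, ← mul_assoc, ← mul_assoc, ← hpc, ← htn, mul_assoc, mul_assoc]
    exact ⟨q w', by rw [_root_.map_mul, map_natCast]⟩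

end

/-! ### Integral closedness through the centre -/

section Integral

/-- In `X`, every central element that is integral over `X` after division by a central regular
element is already a multiple of it. -/
def IsCentrallyIntegrallyClosed (X : Type*) [Ring X] : Prop :=
  ∀ a b : X, (∀ x, a * x = x * a) → (∀ x, b * x = x * b) → (∀ x, b * x = 0 → x = 0) →
    ∀ (d : ℕ), 0 < d → ∀ c : ℕ → X,
      a ^ d = ∑ i ∈ Finset.range d, c i * a ^ i * b ^ (d - i) → ∃ w, a = b * w

lemma IsCentrallyIntegrallyClosed.of_ringEquiv {X Y : Type*} [Ring X] [Ring Y]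
    (h : IsCentrallyIntegrallyClosed X) (φ : X ≃+* Y) : IsCentrallyIntegrallyClosed Y := by
  intro a b ha hb hb0 d hd c hc
  have hcent : ∀ a : Y, (∀ x, a * x = x * a) → ∀ x, φ.symm a * x = x * φ.symm a := fun a ha x => by
    obtain ⟨x, rfl⟩ := φ.symm.surjective x
    rw [← map_mul, ha, map_mul]
  obtain ⟨w, hw⟩ := h (φ.symm a) (φ.symm b) (hcent a ha) (hcent b hb) (fun x hx => by
    obtain ⟨x, rfl⟩ := φ.symm.surjective x
    rw [← map_mul, map_eq_zero_iff _ φ.symm.injective] at hx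
    rw [hb0 x hx, map_zero]) d hd (fun i => φ.symm (c i)) (by
      rw [← map_pow, hc, map_sum]
      simp only [map_mul, map_pow])
  refine ⟨φ w, φ.symm.injective ?_⟩
  rw [map_mul, φ.symm_apply_apply, hw]

/-- The hypothesis is the monic equation of a fraction `a / b` after clearing denominators. -/
lemma isIntegrallyClosed_of_forall_homogeneous {D : Type*} [CommRing D] [IsDomain D]
    (h : ∀ a b : D, b ≠ 0 → ∀ (d : ℕ), 0 < d → ∀ c : ℕ → D,
      a ^ d = ∑ i ∈ Finset.range d, c i * a ^ i * b ^ (d - i) → ∃ w, a = b * w) :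
    IsIntegrallyClosed D := by
  rw [isIntegrallyClosed_iff (FractionRing D)]
  intro x ⟨P, hP, hPx⟩
  obtain ⟨a, b, hb, rfl⟩ := IsFractionRing.div_surjective (A := D) x
  have hb0 : b ≠ 0 := nonZeroDivisors.ne_zero hb
  have hbK : algebraMap D (FractionRing D) b ≠ 0 := by
    rwa [Ne, map_eq_zero_iff _ (IsFractionRing.injective D (FractionRing D))]
  rw [Polynomial.eval₂_eq_sum_range, Finset.sum_range_succ, hP.coeff_natDegree, map_one,
    one_mul] at hPx
  have hd : 0 < P.natDegree := by
    rw [Nat.pos_iff_ne_zero]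
    intro h0
    rw [h0, Finset.sum_range_zero, pow_zero, zero_add] at hPx
    exact one_ne_zero hPx
  obtain ⟨w, hw⟩ := h a b hb0 P.natDegree hd (fun i => -P.coeff i) (by
    apply IsFractionRing.injective D (FractionRing D)
    rw [map_pow, map_sum]
    have h1 := congrArg (· * algebraMap D (FractionRing D) b ^ P.natDegree) hPx
    simp only [zero_mul, add_mul, Finset.sum_mul, div_pow] at h1
    rw [div_mul_cancel₀ _ (pow_ne_zero _ hbK)] at h1
    rw [eq_neg_of_add_eq_zero_right h1, ← Finset.sum_neg_distrib]
    refine Finset.sum_congr rfl fun i hi => ?_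
    have hi' : i ≤ P.natDegree := (Finset.mem_range.mp hi).le
    rw [map_mul, map_mul, map_neg, map_pow, map_pow]
    conv_lhs => rw [← Nat.sub_add_cancel hi', pow_add]
    field_simp)
  exact ⟨w, by rw [hw, map_mul, mul_div_cancel_left₀ _ hbK]⟩

/-- Elements of the centre of one factor are tested as scalar matrices. The numerator is extended by
zero, but the denominator by `1`, so that it remains regular in the product. -/
lemma IsCentrallyIntegrallyClosed.isIntegrallyClosed {I : Type*} {n : I → ℕ} {S : I → Type*}
    [∀ i, CommRing (S i)] [∀ i, IsDomain (S i)]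
    (h : IsCentrallyIntegrallyClosed (∀ i, Matrix (Fin (n i)) (Fin (n i)) (S i))) (l : I)
    (hl : 0 < n l) : IsIntegrallyClosed (S l) := by
  classical
  refine isIntegrallyClosed_of_forall_homogeneous fun a b hb d hd c hc => ?_
  let s : S l → ∀ i, Matrix (Fin (n i)) (Fin (n i)) (S i) := fun r => Pi.single l (Matrix.scalar _ r)
  let u : ∀ i, Matrix (Fin (n i)) (Fin (n i)) (S i) := Function.update 1 l (Matrix.scalar _ b)
  have hsl : ∀ r, s r l = Matrix.scalar _ r := fun r => Pi.single_eq_same _ _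
  have hsi : ∀ r i, i ≠ l → s r i = 0 := fun r i hi => Pi.single_eq_of_ne hi _
  have hul : u l = Matrix.scalar _ b := Function.update_self _ _ _
  have hui : ∀ i, i ≠ l → u i = 1 := fun i hi => Function.update_of_ne hi _ _
  have hscal : ∀ (r : S l) (M : Matrix (Fin (n l)) (Fin (n l)) (S l)),
      Matrix.scalar _ r * M = M * Matrix.scalar _ r := fun r M =>
    (Matrix.scalar_commute r (fun r' => mul_comm r r') M).eq
  have key : ∃ w, s a = u * w := by
    refine h (s a) u (fun x => funext fun i => ?_) (fun x => funext fun i => ?_)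
      (fun x hx => funext fun i => ?_) d hd (fun i => s (c i)) (funext fun i => ?_)
    · rw [Pi.mul_apply, Pi.mul_apply]
      by_cases hi : i = l
      · subst hi; rw [hsl, hscal]
      · rw [hsi _ _ hi, zero_mul, mul_zero]
    · rw [Pi.mul_apply, Pi.mul_apply]
      by_cases hi : i = l
      · subst hi; rw [hul, hscal]
      · rw [hui _ hi, one_mul, mul_one]
    · have h1 := congrFun hx i
      rw [Pi.mul_apply, Pi.zero_apply] at h1
      by_cases hi : i = l
      · subst hi
        rw [hul] at h1
        ext k k'
        have h2 := congrArg (fun M => M k k') h1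
        simpa [Matrix.scalar_apply, Matrix.diagonal_mul, hb] using h2
      · rwa [hui _ hi, one_mul] at h1
    · rw [Pi.pow_apply, Finset.sum_apply]
      by_cases hi : i = l
      · subst hi
        rw [hsl, ← map_pow, hc, map_sum]
        refine Finset.sum_congr rfl fun j _ => ?_
        rw [Pi.mul_apply, Pi.mul_apply, Pi.pow_apply, Pi.pow_apply, hsl, hsl, hul, map_mul, map_mul,
          map_pow, map_pow]
      · rw [hsi _ _ hi, zero_pow hd.ne']
        refine (Finset.sum_eq_zero fun j _ => ?_).symm
        rw [Pi.mul_apply, Pi.mul_apply, hsi _ _ hi, zero_mul, zero_mul]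
  obtain ⟨w, hw⟩ := key
  refine ⟨w l ⟨0, hl⟩ ⟨0, hl⟩, ?_⟩
  have h1 := congrFun hw l
  rw [Pi.mul_apply, hsl, hul] at h1
  have h2 := congrArg (fun M => M ⟨0, hl⟩ ⟨0, hl⟩) h1
  simpa [Matrix.scalar_apply, Matrix.diagonal_mul] using h2

end Integral

/-! ### Corners are local domains -/

section Corner

variable {X Q : Type*} [Ring X] [Ring Q] {π : X →+* Q} {p : ℕ} {t : X}

/-- Because `p` is regular, the infinitely `p`-divisible elements form a group equal to `p` times
itself, and separatedness applies with zero coefficient at the other generator. -/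
lemma IsLiftable.eq_zero_of_forall_pow {z : Fin 2 → X} (h : IsLiftable π z) (hz : z 0 = p)
    (hp : ∀ x : X, p * x = 0 → x = 0) {x : X} (hx : ∀ n : ℕ, ∃ y, x = (p : X) ^ n * y) : x = 0 := by
  let E : AddSubgroup X :=
    { carrier := {x | ∀ n : ℕ, ∃ y, x = (p : X) ^ n * y}
      zero_mem' := fun n => ⟨0, by rw [mul_zero]⟩
      add_mem' := fun {a b} ha hb n => by
        obtain ⟨y, rfl⟩ := ha n
        obtain ⟨y', h'⟩ := hb n
        exact ⟨y + y', by rw [h', mul_add]⟩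
      neg_mem' := fun {a} ha n => by
        obtain ⟨y, rfl⟩ := ha n
        exact ⟨-y, by rw [mul_neg]⟩ }
  have hE : E = ⊥ := h.separated E fun x hx => by
    obtain ⟨y, hy⟩ := hx 1
    rw [pow_one] at hy
    refine ⟨![y, 0], fun i => ?_, ?_⟩
    · match i with
      | 0 =>
        intro n
        obtain ⟨y', hy'⟩ := hx (n + 1)
        refine ⟨y', sub_eq_zero.mp (hp _ ?_)⟩
        change p * (y - p ^ n * y') = 0
        rw [mul_sub, ← hy, hy', pow_succ', mul_assoc, sub_self]
      | 1 => exact E.zero_mem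
    · rw [Fin.sum_univ_two, hz]
      change x = p * y + z 1 * 0
      rw [mul_zero, add_zero, hy]
  have : x ∈ E := hx
  rwa [hE] at this

variable (h : IsLiftable π ![(p : X), t])
  (htp : ∀ w u : X, t * w = p * u → ∃ w', w = p * w')
  (hK : ∀ x : X, (∀ n : ℕ, ∃ y y', x = p * y + t ^ n * y') → ∃ y, x = p * y)
  {f : X} (hf : IsIdempotentElem f) (hf0 : π f ≠ 0)
  (hunit : ∀ x, f * x * f = x → π x = 0 ∨ ∃ y, f * y * f = y ∧ x * y = f)

include h hK hf hunit in
-- Modulo `p` the corner resembles a discrete valuation ring with uniformiser `t`. For the largest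
-- `n` with `x` in the ideal of `p` and `t ^ n`, the cofactor is a unit of the corner; otherwise it
-- lies in the ideal of `p` and `t`, and `n + 1` would do.
lemma exists_eq_pow_mul_of_corner {x : X} (hx : f * x * f = x) (hxp : ¬ ∃ y, x = p * y) :
    ∃ n : ℕ, ∃ y u v, x = p * y + t ^ n * u ∧ f * u * f = u ∧ f * v * f = v ∧ u * v = f := by
  classical
  have hpc : ∀ x : X, (p : X) * x = x * p := fun x => (Nat.cast_commute p x).eq
  have htc : ∀ x, t * x = x * t := h.commute 1
  have htn : ∀ (n : ℕ) x, t ^ n * x = x * t ^ n := fun n x =>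
    ((show Commute t x from htc x).pow_left n).eq
  have hff : ∀ y, f * (f * y * f) * f = f * y * f := fun y => by
    rw [mul_assoc, mul_assoc (f * y), hf.eq, ← mul_assoc, ← mul_assoc, hf.eq]
  have hex : ∃ n : ℕ, ¬ ∃ y y', x = p * y + t ^ n * y' := by
    by_contra hcon
    push Not at hcon
    exact hxp (hK x hcon)
  have hn := Nat.find_spec hex
  obtain ⟨n, hn'⟩ : ∃ n, Nat.find hex = n + 1 := by
    refine Nat.exists_eq_succ_of_ne_zero fun h0 => ?_
    rw [h0] at hn
    exact hn ⟨0, x, by rw [mul_zero, pow_zero, one_mul, zero_add]⟩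
  have hlt := Nat.find_min hex (m := n) (by omega)
  rw [not_not] at hlt
  obtain ⟨y, u, hyu⟩ := hlt
  have hx' : x = p * (f * y * f) + t ^ n * (f * u * f) := by
    conv_lhs => rw [← hx, hyu, mul_add, add_mul, ← mul_assoc, ← mul_assoc, ← hpc, ← htn]
    simp only [mul_assoc]
  rcases hunit (f * u * f) (hff u) with h0 | ⟨v, hv, huv⟩
  · obtain ⟨w, hw⟩ := (h.ker _).mp h0
    rw [Fin.sum_univ_two] at hw
    change f * u * f = p * w 0 + t * w 1 at hw
    rw [hn'] at hn
    refine absurd ⟨f * y * f + t ^ n * w 0, w 1, ?_⟩ hn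
    conv_lhs => rw [hx', hw, mul_add, ← mul_assoc (t ^ n), ← mul_assoc (t ^ n), ← hpc, ← pow_succ]
    rw [mul_add, mul_assoc (p : X), add_assoc]
  · exact ⟨n, f * y * f, f * u * f, v, hx', hff u, hv, huv⟩

include htp in
omit [Ring Q] in
lemma exists_eq_p_mul_of_pow_mul {w : X} (n : ℕ) (hw : ∃ u, t ^ n * w = p * u) :
    ∃ u, w = p * u := by
  induction n with
  | zero => simpa using hw
  | succ n ih =>
    obtain ⟨u, hu⟩ := hw
    rw [pow_succ', mul_assoc] at hu
    exact ih (htp _ _ hu)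

include h htp hK hf hunit hf0 in
-- Modulo `p` the product is a unit times a power of `t`. If it vanished, regularity of `t` would
-- make `f` a multiple of `p`, contradicting `π f ≠ 0`.
lemma not_exists_eq_p_mul_of_corner {x y : X} (hx : f * x * f = x) (hy : f * y * f = y)
    (hxp : ¬ ∃ w, x = p * w) (hyp : ¬ ∃ w, y = p * w) : ¬ ∃ w, x * y = p * w := by
  rintro ⟨w, hw⟩
  have hpc : ∀ x : X, (p : X) * x = x * p := fun x => (Nat.cast_commute p x).eq
  have htc : ∀ x, t * x = x * t := h.commute 1
  have htn : ∀ (n : ℕ) x, t ^ n * x = x * t ^ n := fun n x =>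
    ((show Commute t x from htc x).pow_left n).eq
  obtain ⟨n, y₁, u, v, hxu, hu, hv, huv⟩ := exists_eq_pow_mul_of_corner h hK hf hunit hx hxp
  obtain ⟨m, y₂, u', v', hyu, hu', hv', huv'⟩ := exists_eq_pow_mul_of_corner h hK hf hunit hy hyp
  have h1 : t ^ (n + m) * (u * u') = p * (w - y₁ * y - t ^ n * u * y₂) := by
    have h2 : t ^ (n + m) * (u * u') = t ^ n * u * (t ^ m * u') := by
      rw [pow_add, mul_assoc, mul_assoc (t ^ n), ← mul_assoc u, ← htn m u, mul_assoc]
    have h3 : t ^ m * u' = y - p * y₂ := by rw [hyu, add_sub_cancel_left]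
    have h4 : t ^ n * u = x - p * y₁ := by rw [hxu, add_sub_cancel_left]
    rw [h2, h3, mul_sub, ← mul_assoc _ (p : X), ← hpc, mul_assoc _ _ y₂, h4,
      sub_mul, hw, mul_sub, mul_sub, mul_assoc (p : X)]
  have hfu : u * f = u := by rw [← hu, mul_assoc, hf.eq]
  have h5 : t ^ (n + m) * f = p * ((w - y₁ * y - t ^ n * u * y₂) * v' * v) := by
    have h6 : u * u' * v' * v = f := by
      rw [mul_assoc u, huv', hfu, huv]
    rw [← mul_assoc (p : X), ← mul_assoc (p : X), ← h1, mul_assoc _ _ v', mul_assoc _ _ v, h6]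
  obtain ⟨u₀, hu₀⟩ := exists_eq_p_mul_of_pow_mul htp (n + m) ⟨_, h5⟩
  refine hf0 ((h.ker f).mpr ⟨![u₀, 0], ?_⟩)
  rw [Fin.sum_univ_two]
  change f = p * u₀ + t * 0
  rw [mul_zero, add_zero, hu₀]

end Corner

section Corner

variable {X : Type u} {Q : Type v} [Ring X] [Ring Q] {π : X →+* Q} {p : ℕ} {t f : X}

lemma mul_val_mul_of_isIdempotentElem (hf : IsIdempotentElem f) (x : hf.Corner) :
    f * x.1 * f = x.1 := by
  obtain ⟨y, hy⟩ := x.2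
  change f * y * f = x.1 at hy
  rw [← hy, mul_assoc, mul_assoc (f * y), hf.eq, ← mul_assoc, ← mul_assoc, hf.eq]

/-- The commutative ring structure on a corner ring with commuting elements. -/
abbrev cornerCommRing (hf : IsIdempotentElem f)
    (hcomm : ∀ x y, f * x * f = x → f * y * f = y → x * y = y * x) : CommRing hf.Corner :=
  { (inferInstance : Ring hf.Corner) with
    mul_comm := fun x y => Subtype.ext (hcomm x.1 y.1 (mul_val_mul_of_isIdempotentElem hf x)
      (mul_val_mul_of_isIdempotentElem hf y)) }

/-- Elements outside the kernel of `π` are units, and `x` and `f - x` cannot both be in it. -/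
lemma isLocalRing_corner (hf : IsIdempotentElem f) (hf0 : π f ≠ 0)
    (hcomm : ∀ x y, f * x * f = x → f * y * f = y → x * y = y * x)
    (hunit : ∀ x, f * x * f = x → π x = 0 ∨ ∃ y, f * y * f = y ∧ x * y = f) :
    letI := cornerCommRing hf hcomm
    IsLocalRing hf.Corner := by
  let _ := cornerCommRing hf hcomm
  have hu : ∀ x : hf.Corner, π x.1 ≠ 0 → IsUnit x := fun x hx => by
    obtain ⟨y, hy, hxy⟩ := (hunit x.1 (mul_val_mul_of_isIdempotentElem hf x)).resolve_left hx
    exact IsUnit.of_mul_eq_one (⟨y, y, hy⟩ : hf.Corner) (Subtype.ext hxy)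
  have : Nontrivial hf.Corner := ⟨1, 0, fun h10 => hf0 (by
    have : f = 0 := congrArg Subtype.val h10
    rw [this, map_zero])⟩
  refine IsLocalRing.of_isUnit_or_isUnit_one_sub_self fun x => ?_
  by_cases hx : π x.1 = 0
  · refine Or.inr (hu _ ?_)
    change π (f - x.1) ≠ 0
    rwa [map_sub, hx, sub_zero]
  · exact Or.inl (hu x hx)

/-- Each nonzero element is a power of `p` times one not divisible by `p`; products of the latter
are not divisible by `p`, and `p` is regular. -/
lemma isDomain_corner (h : IsLiftable π ![(p : X), t]) (hp : ∀ x : X, p * x = 0 → x = 0)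
    (htp : ∀ w u : X, t * w = p * u → ∃ w', w = p * w')
    (hK : ∀ x : X, (∀ n : ℕ, ∃ y y', x = p * y + t ^ n * y') → ∃ y, x = p * y)
    (hf : IsIdempotentElem f) (hf0 : π f ≠ 0)
    (hcomm : ∀ x y, f * x * f = x → f * y * f = y → x * y = y * x)
    (hunit : ∀ x, f * x * f = x → π x = 0 ∨ ∃ y, f * y * f = y ∧ x * y = f) :
    letI := cornerCommRing hf hcomm
    IsDomain hf.Corner := by
  let _ := cornerCommRing hf hcomm
  have hpc : ∀ (n : ℕ) (x : X), (p : X) ^ n * x = x * p ^ n := fun n x =>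
    ((Nat.cast_commute p x).pow_left n).eq
  have hpn : ∀ (n : ℕ) (x : X), (p : X) ^ n * x = 0 → x = 0 := fun n => by
    induction n with
    | zero => intro x hx; rwa [pow_zero, one_mul] at hx
    | succ n ih =>
      intro x hx
      rw [pow_succ', mul_assoc] at hx
      exact ih x (hp _ hx)
  have hdiv : ∀ x, f * x * f = x → x ≠ 0 → ∃ (n : ℕ) (y : X), x = p ^ n * y ∧ f * y * f = y ∧
      ¬ ∃ w, y = p * w := fun x hx hx0 => by
    classical
    have hex : ∃ n : ℕ, ¬ ∃ y, x = (p : X) ^ n * y := by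
      by_contra hcon
      push Not at hcon
      exact hx0 (h.eq_zero_of_forall_pow rfl hp hcon)
    have hn := Nat.find_spec hex
    obtain ⟨n, hn'⟩ : ∃ n, Nat.find hex = n + 1 := by
      refine Nat.exists_eq_succ_of_ne_zero fun h0 => ?_
      rw [h0] at hn
      exact hn ⟨x, by rw [pow_zero, one_mul]⟩
    have hlt := Nat.find_min hex (m := n) (by omega)
    rw [not_not] at hlt
    obtain ⟨y, rfl⟩ := hlt
    refine ⟨n, y, rfl, ?_, ?_⟩
    · rw [← sub_eq_zero]
      apply hpn n
      rw [mul_sub, ← mul_assoc, ← mul_assoc, hpc n f, mul_assoc f, hx, sub_self]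
    · rintro ⟨w, rfl⟩
      rw [hn'] at hn
      exact hn ⟨w, by rw [pow_succ, mul_assoc]⟩
  have : Nontrivial hf.Corner := ⟨1, 0, fun h10 => hf0 (by
    have : f = 0 := congrArg Subtype.val h10
    rw [this, map_zero])⟩
  have : NoZeroDivisors hf.Corner := ⟨fun {a b} hab => by
    by_contra hcon
    push Not at hcon
    obtain ⟨n, x, hx, hfx, hxp⟩ := hdiv a.1 (mul_val_mul_of_isIdempotentElem hf a)
      fun h0 => hcon.1 (Subtype.ext h0)
    obtain ⟨n', y, hy, hfy, hyp⟩ := hdiv b.1 (mul_val_mul_of_isIdempotentElem hf b)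
      fun h0 => hcon.2 (Subtype.ext h0)
    have hab' : a.1 * b.1 = 0 := congrArg Subtype.val hab
    rw [hx, hy, mul_assoc, ← mul_assoc x, ← hpc n' x, mul_assoc] at hab'
    refine not_exists_eq_p_mul_of_corner h htp hK hf hf0 hunit hfx hfy hxp hyp ⟨0, ?_⟩
    rw [mul_zero]
    exact hpn _ _ (hpn _ _ hab')⟩
  exact NoZeroDivisors.to_isDomain _

end Corner

/-- The structure of a liftable ring whose radical is generated by `p` and `t`. -/
theorem exists_ringEquiv_pi_matrix {X : Type u} {Q : Type v} [Ring X] [Ring Q] [Finite Q]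
    [IsSemisimpleRing Q] {π : X →+* Q} {p : ℕ} {t : X} (h : IsLiftable π ![(p : X), t])
    (hp : ∀ x : X, p * x = 0 → x = 0) (htp : ∀ w u : X, t * w = p * u → ∃ w', w = p * w')
    (hK : ∀ x : X, (∀ n : ℕ, ∃ y y', x = p * y + t ^ n * y') → ∃ y, x = p * y)
    (hX : IsCentrallyIntegrallyClosed X) :
    ∃ (k : ℕ) (n : Fin k → ℕ) (S : Fin k → Type u) (_ : ∀ i, CommRing (S i)),
      (∀ i, 0 < n i ∧ IsDomain (S i) ∧ IsLocalRing (S i) ∧ IsIntegrallyClosed (S i)) ∧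
      Nonempty (X ≃+* ((i : Fin k) → Matrix (Fin (n i)) (Fin (n i)) (S i))) := by
  obtain ⟨k, n, f, hf, hn, hf0, hcomm, hunit, ⟨φ⟩⟩ := h.exists_matrix_decomposition
  let inst : ∀ i, CommRing (hf i).Corner := fun i => cornerCommRing (hf i) (hcomm i)
  have hdom : ∀ i, IsDomain (hf i).Corner := fun i =>
    isDomain_corner h hp htp hK (hf i) (hf0 i) (hcomm i) (hunit i)
  let ψ : X ≃+* ((i : Fin k) → Matrix (Fin (n i)) (Fin (n i)) (hf i).Corner) := φ
  exact ⟨k, n, fun i => (hf i).Corner, inst, fun i => ⟨hn i, hdom i,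
    isLocalRing_corner (hf i) (hf0 i) (hcomm i) (hunit i),
    (hX.of_ringEquiv ψ).isIntegrallyClosed i (hn i)⟩, ⟨ψ⟩⟩

/-! ### Assembly for hybrid Iwasawa algebras -/

section Hybrid

variable {p : ℕ} [Fact p.Prime] {G : Type u} [Group G] [TopologicalSpace G] [IsTopologicalGroup G]
  [CompactSpace G] {H : Subgroup G} [H.Normal] [Finite H] {P : ℤ_[p] → G} {m : ℕ}

/-- Both uses of maximality meet here: finite closedness yields the semisimple part of `𝔽_p[H]`, and
with it the liftable structure, while closedness under central integral fractions yields normality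
of the corners. -/
theorem IsHybrid.exists_ringEquiv_pi_matrix (hP : IsSemidirect H P m) {N : Subgroup G} [N.Normal]
    [Finite N] {Γ₀ : Subgroup G} (hc : Γ₀ ≤ Subgroup.center G) (hybrid : IsHybrid p N Γ₀) :
    ∃ (k : ℕ) (n : Fin k → ℕ) (S : Fin k → Type u) (_ : ∀ i, CommRing (S i)),
      (∀ i, 0 < n i ∧ IsDomain (S i) ∧ IsLocalRing (S i) ∧ IsIntegrallyClosed (S i)) ∧
      Nonempty (complementOrder p N ≃+*
        ((i : Fin k) → Matrix (Fin (n i)) (Fin (n i)) (S i))) := by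
  obtain ⟨e, he, hee, hNe⟩ := exists_idempotent hybrid.mem
  obtain ⟨ε, rfl⟩ := hP.exists_ofGroupAlgebra_eq hNe
  have hec := idempotent_commute he
  have hqe := toComplement_eq_zero_iff he
  have hpu : IsUnit (p : ComplementAlgebra p N) := by
    have := isUnit_toComplement (N := N) (natCast_mem_centralRegular p (G := G)
      (Fact.out : p.Prime).ne_zero)
    rwa [map_natCast] at this
  have hU : ∀ g ∈ (hP.level 0).toSubgroup, g ∈ H → g = 1 := fun g hg hH => hP.level_inf 0 hg hH
  have hrad : ∀ w ∈ Ring.jacobson (MonoidAlgebra (ZMod p) H), modP p H ε * w = w :=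
    fun w hw => modP_mul_eq_of_mem_jacobson (hybrid.isMaximalOrder.isFinitelyClosed hc) hpu
      hU (ofGroupAlgebra_injective hU (by rw [map_mul, hee])) hec hqe hw
  let q : IwasawaAlgebra p G →+* complementOrder p N := (toComplement p N).rangeRestrict
  have hqe' : ∀ x, q x = 0 ↔ ofGroupAlgebra p H ε * x = x := fun x =>
    Subtype.ext_iff.trans (hqe x)
  obtain ⟨Q, _, _, _, π, t, h, hp, htp, hK⟩ :=
    hP.exists_isLiftable (toComplement p N).rangeRestrict_surjective (q := q) hee hec hqe' hrad
  exact Iwasawa.exists_ringEquiv_pi_matrix h hp htp hK fun a b ha hb hb0 d hd c hcd =>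
    hybrid.exists_eq_mul_of_integral hc ha hb hb0 hd c hcd

end Hybrid

/-- The internal semidirect product of `H` and `Γ ≃ ℤ_p` in terms of the parametrization of `Γ`. -/
theorem exists_isSemidirect {p : ℕ} [Fact p.Prime] {G : Type u} [Group G] [TopologicalSpace G]
    [IsTopologicalGroup G] {H Γ : Subgroup G} (hHΓ : H.IsComplement' Γ)
    (hΓ : Nonempty (Γ ≃ₜ* Multiplicative ℤ_[p])) {Γ₀ : Subgroup G} (hΓ₀ : Γ₀ ≤ Γ)
    (hopen : IsOpen (Γ₀ : Set G)) (hc : Γ₀ ≤ Subgroup.center G) :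
    ∃ (P : ℤ_[p] → G) (m : ℕ), IsSemidirect H P m := by
  obtain ⟨φ⟩ := hΓ
  let P : ℤ_[p] → G := fun x => (φ.symm (Multiplicative.ofAdd x) : G)
  have hPc : Continuous P :=
    continuous_subtype_val.comp (φ.symm.continuous.comp continuous_ofAdd)
  have hP0 : P 0 = 1 := by
    change ((φ.symm 1 : Γ) : G) = 1
    rw [map_one]; rfl
  have hΓopen : IsOpen (Γ : Set G) := Subgroup.isOpen_mono hΓ₀ hopen
  have hPopen : IsOpenMap P :=
    hΓopen.isOpenMap_subtype_val.comp (φ.symm.toHomeomorph.isOpenMap.comp isOpenMap_ofAdd)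
  -- The ideal `p ^ n ℤ_p` is a ball, hence open, and `P` is an open map because `Γ` contains the
  -- open subgroup `Γ₀`.
  have hpn : ∀ n : ℕ, IsOpen (Set.range fun x : ℤ_[p] => (p : ℤ_[p]) ^ n * x) := fun n => by
    have h1 : (Set.range fun x : ℤ_[p] => (p : ℤ_[p]) ^ n * x) =
        Metric.ball 0 ((p : ℝ) ^ (-(n : ℤ) + 1)) := by
      ext x
      rw [mem_ball_zero_iff, ← PadicInt.norm_le_pow_iff_norm_lt_pow_add_one,
        PadicInt.norm_le_pow_iff_mem_span_pow, Ideal.mem_span_singleton']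
      simp only [Set.mem_range, mul_comm]
    rw [h1]
    exact Metric.isOpen_ball
  obtain ⟨m, hm⟩ : ∃ m : ℕ, ∀ x, P (p ^ m * x) ∈ Γ₀ := by
    have h1 : P ⁻¹' (Γ₀ : Set G) ∈ nhds (0 : ℤ_[p]) := (hopen.preimage hPc).mem_nhds (by
      change P 0 ∈ Γ₀
      rw [hP0]; exact one_mem _)
    obtain ⟨ε, hε, h⟩ := Metric.mem_nhds_iff.mp h1
    obtain ⟨k, hk⟩ := PadicInt.exists_pow_neg_lt p hε
    refine ⟨k, fun x => h ?_⟩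
    rw [mem_ball_zero_iff]
    refine lt_of_le_of_lt ?_ hk
    rw [PadicInt.norm_le_pow_iff_mem_span_pow]
    exact Ideal.mem_span_singleton.mpr (dvd_mul_right _ _)
  refine ⟨P, m, fun x y => ?_, hPc, fun n => ?_, fun x g => ?_, fun x hx => ?_, fun g => ?_⟩
  · change ((φ.symm (Multiplicative.ofAdd x * Multiplicative.ofAdd y) : Γ) : G) = _
    rw [map_mul]; rfl
  · have := hPopen _ (hpn n)
    rwa [← Set.range_comp] at this
  · exact ((Subgroup.mem_center_iff.mp (hc (hm x))) g).symm
  · have h1 : P x = 1 := by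
      have := hHΓ.disjoint.le_bot (show P x ∈ H ⊓ Γ from ⟨hx, Subtype.prop _⟩)
      rwa [Subgroup.mem_bot] at this
    have h2 : φ.symm (Multiplicative.ofAdd x) = 1 := Subtype.ext h1
    rw [map_eq_one_iff _ φ.symm.injective] at h2
    exact ofAdd_eq_one.mp h2
  · obtain ⟨⟨h, γ⟩, hg⟩ := hHΓ.surjective g
    refine ⟨h, h.2, (φ γ).toAdd, ?_⟩
    change g = h * ((φ.symm (φ γ) : Γ) : G)
    rw [ContinuousMulEquiv.symm_apply_apply]
    exact hg.symm

end Iwasawa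

theorem corollary3p11
    (p : ℕ) [Fact p.Prime] (hp : p ≠ 2)
    (G : Type u) [Group G] [TopologicalSpace G] [IsTopologicalGroup G]
    [CompactSpace G] [TotallyDisconnectedSpace G]
    -- `G = H ⋊ Γ` with `H` finite and `Γ` isomorphic to `ℤ_p`
    (H Γ : Subgroup G) [H.Normal] [Finite H] (hHΓ : H.IsComplement' Γ)
    (hΓ : Nonempty (Γ ≃ₜ* Multiplicative ℤ_[p]))
    -- `Γ₀` is an open subgroup of `Γ` that is central in `G`
    (Γ₀ : Subgroup G) (hΓ₀ : Γ₀ ≤ Γ) (hopen : IsOpen (Γ₀ : Set G))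
    (hc : Γ₀ ≤ Subgroup.center G)
    (N : Subgroup G) [N.Normal] [Finite N]
    (hybrid : Iwasawa.IsHybrid p N Γ₀) :
    ∃ (k : ℕ) (n : Fin k → ℕ) (S : Fin k → Type u) (_ : ∀ i, CommRing (S i)),
      (∀ i, 0 < n i ∧ IsDomain (S i) ∧ IsLocalRing (S i) ∧ IsIntegrallyClosed (S i)) ∧
      Nonempty (Iwasawa.complementOrder p N ≃+*
        ((i : Fin k) → Matrix (Fin (n i)) (Fin (n i)) (S i))) := by
  obtain ⟨P, m, hP⟩ := Iwasawa.exists_isSemidirect hHΓ hΓ hΓ₀ hopen hc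
  exact Iwasawa.IsHybrid.exists_ringEquiv_pi_matrix hP hc hybrid
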